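/- Let $M$ be a smooth ($C^\infty$) $n$-dimensional manifold and let $(E,[\cdot,\cdot]_E,\sigma)$ be a Lie algebroid of rank $m$ over $M$, i.e. a smooth vector bundle $\pi:E\to M$ with a Lie bracket on $\Gamma(E)$ and a smooth bundle map $\sigma:E\to TM$ which is a Lie algebra homomorphism on sections and satisfies $[s_1,fs_2]_E=f[s_1,s_2]_E+(\sigma(s_1)f)s_2$. Let $\tau:E^*\to M$ be the dual bundle and let $\mathcal T E^*\to E^*$ be the prolongation of $E$ over $\tau$: its fibre at $u$ is $\mathcal T_uE^*=\{(a,v)\in E_{\tau(u)}\times T_uE^* : \sigma(a)=T_u\tau(v)\}$, its anchor is $\sigma^1(a,v)=v$, and its bracket is the Lie algebroid bracket with $[(X\circ\tau,U),(Y\circ\tau,V)]=([X,Y]_E\circ\tau,[U,V])$ on projectable sections. Let $V\mathcal T E^*$ be the subbundle of all $(0,v)$, let $\theta_E(u)(a,v)=u(a)$, and let $\omega_E=-d^E\theta_E$ be the canonical symplectic section. A nonlinear connection on $\mathcal T E^*$ is a smooth bundle endomorphism $\mathcal N$ with $\mathcal N^2=\mathrm{Id}$ and $V\mathcal T E^*=\ker(\mathrm{Id}+\mathcal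 N)$; put $h=\frac12(\mathrm{Id}+\mathcal N)$ and $v=\frac12(\mathrm{Id}-\mathcal N)$. It is symmetric if its horizontal bundle $\ker(\mathrm{Id}-\mathcal N)$ is Lagrangian for $\omega_E$. Let $\Omega\subseteq E^*$ be open (for instance $E^*$, or $E^*$ without the zero section) and let $\mathcal H:\Omega\to\mathbb R$ be a smooth regular Hamiltonian, i.e. in local coordinates $(q^i,\mu_\alpha)$ of $E^*$ (given by a chart $(q^i)$ of $M$ and a local frame $(s_\alpha)$ of $E$) the matrix $g^{\alpha\beta}=\partial^2\mathcal H/\partial\mu_\alpha\partial\mu_\beta$ is nondegenerate on $\Omega$, with inverse $(g_{\alpha\beta})$. Let $g$ be the induced pseudo-Riemannian metric on $V\mathcal T E^*$ and let $\mathcal J_{\mathcal H}=g_{\alpha\beta}\,\mathcal Q^\alpha\otimes\mathcal P^\beta$ be the induced almost tangent structure, where $\mathcal Q_\alpha=(s_\alpha,\sigma^i_\alpha\,\partial/\partial q^i)$, $\mathcal P^\alpha=(0,\partial/\partial\mu_\alpha)$ is the local basis of $\mathcal T E^*$ with dual basis $\mathcal Q^\alpha,\mathcal P_\alpha$, and $\sigma(s_\alpha)=\sigma_\alpha^i\,\partial/\partial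 q^i$, $[s_\alpha,s_\beta]_E=L^\gamma_{\alpha\beta}s_\gamma$. Everything below is over $\Omega$. Then there is a unique smooth section $\rho_{\mathcal H}$ of $\mathcal T E^*$ with $i_{\rho_{\mathcal H}}\omega_E=d^E\mathcal H$ (the Hamilton section). The formula $\mathcal N(\nu)=-(\mathcal L_{\rho_{\mathcal H}}\mathcal J_{\mathcal H})(\nu)=-[\rho_{\mathcal H},\mathcal J_{\mathcal H}\nu]+\mathcal J_{\mathcal H}[\rho_{\mathcal H},\nu]$ defines a nonlinear connection on $\mathcal T E^*$, the canonical nonlinear connection of $\mathcal H$; in all local coordinates it is given by $\mathcal N(\mathcal Q_\alpha)=\mathcal Q_\alpha+2\mathcal N_{\alpha\beta}\mathcal P^\beta$ with $$\mathcal N_{\alpha\beta}=\tfrac12\Big(\sigma^i_\gamma\Big(\frac{\partial g_{\alpha\beta}}{\partial\mu_\gamma}\frac{\partial\mathcal H}{\partial q^i}-\frac{\partial g_{\alpha\beta}}{\partial q^i}\frac{\partial\mathcal H}{\partial\mu_\gamma}\Big)-\frac{\partial^2\mathcal H}{\partial q^i\partial\mu_\varepsilon}\big(\sigma^i_\beta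 g_{\alpha\varepsilon}+\sigma^i_\alpha g_{\beta\varepsilon}\big)+\mu_\gamma L^\gamma_{\kappa\varepsilon}\frac{\partial\mathcal H}{\partial\mu_\varepsilon}\frac{\partial g_{\alpha\beta}}{\partial\mu_\kappa}+\mu_\gamma L^\gamma_{\alpha\beta}+\frac{\partial\mathcal H}{\partial\mu_\delta}\big(g_{\alpha\varepsilon}L^\varepsilon_{\delta\beta}+g_{\beta\varepsilon}L^\varepsilon_{\delta\alpha}\big)\Big).$$ This connection is symmetric, and it is metric with respect to $\rho_{\mathcal H}$, i.e. with $\nabla X=h[\rho_{\mathcal H},hX]+v[\rho_{\mathcal H},vX]$ one has $\rho_{\mathcal H}(g(X,Y))=g(\nabla X,Y)+g(X,\nabla Y)$ for all vertical sections $X,Y$. It is the only nonlinear connection on $\mathcal T E^*$ that is both metric with respect to $\rho_{\mathcal H}$ and symmetric. -/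

import Mathlib

open scoped Manifold ContDiff Topology
open Bundle Set

noncomputable section

/-- Euclidean space of dimension `k`. -/
abbrev Eu (k : ℕ) : Type := EuclideanSpace ℝ (Fin k)

/-- The derivative `v(f)` of a real function `f` on a manifold along a tangent vector `v` at `x`. -/
def dirDeriv {B : Type*} [NormedAddCommGroup B] [NormedSpace ℝ B] {H : Type*} [TopologicalSpace H]
    (I : ModelWithCorners ℝ B H) {X : Type*} [TopologicalSpace X] [ChartedSpace H X]
    (f : X → ℝ) (x : X) (v : TangentSpace I x) : ℝ :=
  mfderiv I 𝓘(ℝ, ℝ) f x v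

/-- A Lie algebroid structure on a smooth vector bundle `E → M` of rank `m` over a smooth manifold
of dimension `n`: a smooth bundle map `σ : E → TM` (the anchor) and a Lie bracket on the space of
smooth sections of `E`, such that the Leibniz rule holds and `σ` is a homomorphism of Lie algebras
on sections. -/
structure LieAlgebroid (n m : ℕ) (M : Type*) [TopologicalSpace M]
    [ChartedSpace (Eu n) M] [IsManifold (𝓡 n) ∞ M]
    (E : M → Type*) [TopologicalSpace (TotalSpace (Eu m) E)]
    [∀ x, AddCommGroup (E x)] [∀ x, Module ℝ (E x)] [∀ x, TopologicalSpace (E x)]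
    [FiberBundle (Eu m) E] [VectorBundle ℝ (Eu m) E]
    [ContMDiffVectorBundle ∞ (Eu m) E (𝓡 n)] where
  /-- The anchor. -/
  anchor : ∀ x : M, E x →ₗ[ℝ] TangentSpace (𝓡 n) x
  /-- The anchor is a smooth bundle map. -/
  contMDiff_anchor :
    ContMDiff ((𝓡 n).prod 𝓘(ℝ, Eu m)) (𝓡 n).tangent ∞
      (fun e : TotalSpace (Eu m) E => (⟨e.proj, anchor e.proj e.snd⟩ : TangentBundle (𝓡 n) M))
  /-- The bracket of smooth sections. -/
  bracket : Cₛ^∞⟮𝓡 n; Eu m, E⟯ → Cₛ^∞⟮𝓡 n; Eu m, E⟯ → Cₛ^∞⟮𝓡 n; Eu m, E⟯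
  bracket_add_right : ∀ s t₁ t₂, bracket s (t₁ + t₂) = bracket s t₁ + bracket s t₂
  bracket_smul_right : ∀ (c : ℝ) (s t), bracket s (c • t) = c • bracket s t
  bracket_skew : ∀ s t, bracket s t = -bracket t s
  jacobi : ∀ s₁ s₂ s₃,
    bracket s₁ (bracket s₂ s₃) + bracket s₂ (bracket s₃ s₁) + bracket s₃ (bracket s₁ s₂) = 0
  /-- `σ [s, t] = [σ s, σ t]`. -/
  anchor_bracket : ∀ s t x, anchor x (bracket s t x) =
    VectorField.mlieBracket (𝓡 n) (fun y => anchor y (s y)) (fun y => anchor y (t y)) x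
  /-- `[s, f t] = f [s, t] + (σ(s) f) t`. -/
  leibniz : ∀ (f : M → ℝ), ContMDiff (𝓡 n) 𝓘(ℝ, ℝ) ∞ f →
    ∀ s t ft : Cₛ^∞⟮𝓡 n; Eu m, E⟯, (∀ x, ft x = f x • t x) →
      ∀ x, bracket s ft x = f x • bracket s t x + dirDeriv (𝓡 n) f x (anchor x (s x)) • t x

/-- The total space `E*` of the dual bundle `τ : E* → M`; the point `u` lies over `u.proj`, and
`u.snd` is a linear form on the fibre of `E` over `u.proj`. -/
abbrev DualTotal (m : ℕ) {M : Type*} (E : M → Type*)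
    [∀ x, AddCommGroup (E x)] [∀ x, Module ℝ (E x)] [∀ x, TopologicalSpace (E x)] : Type _ :=
  TotalSpace (Eu m →L[ℝ] ℝ) (fun x => E x →L[ℝ] Bundle.Trivial M ℝ x)

/-- The model with corners of the manifold `E*`. -/
abbrev dualModel (n m : ℕ) : ModelWithCorners ℝ (Eu n × (Eu m →L[ℝ] ℝ))
    (ModelProd (Eu n) (Eu m →L[ℝ] ℝ)) :=
  (𝓡 n).prod 𝓘(ℝ, Eu m →L[ℝ] ℝ)

section Prolongation

variable {n m : ℕ} {M : Type*} [TopologicalSpace M] [ChartedSpace (Eu n) M]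
  [IsManifold (𝓡 n) ∞ M] {E : M → Type*} [TopologicalSpace (TotalSpace (Eu m) E)]
  [∀ x, AddCommGroup (E x)] [∀ x, Module ℝ (E x)] [∀ x, TopologicalSpace (E x)]
  [FiberBundle (Eu m) E] [VectorBundle ℝ (Eu m) E] [ContMDiffVectorBundle ∞ (Eu m) E (𝓡 n)]

/-- The linear form by which a covector `u ∈ E*` acts on the fibre of `E`. -/
def covec (u : DualTotal m E) : E u.proj →ₗ[ℝ] ℝ := (u.snd : E u.proj →L[ℝ] ℝ).toLinearMap

/-! ### The prolongation `𝒯E*` -/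

/-- The fibre at `u` of the prolongation `𝒯E*` of the Lie algebroid over `τ : E* → M`: all pairs
`(a, v)` with `a ∈ E_{τ(u)}`, `v ∈ T_u E*` and `σ(a) = Tτ(v)`. The projection `p ↦ p.1.2` is the
anchor `σ¹` of `𝒯E*`. -/
def Prolong (A : LieAlgebroid n m M E) (u : DualTotal m E) :
    Submodule ℝ (E u.proj × TangentSpace (dualModel n m) u) :=
  LinearMap.eqLocus (A.anchor u.proj ∘ₗ LinearMap.fst ℝ (E u.proj) (TangentSpace (dualModel n m) u))
    ((mfderiv (dualModel n m) (𝓡 n) (fun w : DualTotal m E => w.proj) u).toLinearMap ∘ₗ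
      LinearMap.snd ℝ (E u.proj) (TangentSpace (dualModel n m) u))

/-- The vertical subspace `V𝒯E*`: the kernel of `(a, v) ↦ a`. -/
def VertProlong (A : LieAlgebroid n m M E) (u : DualTotal m E) : Submodule ℝ (Prolong A u) :=
  LinearMap.ker (LinearMap.fst ℝ (E u.proj) (TangentSpace (dualModel n m) u) ∘ₗ
    (Prolong A u).subtype)

/-- Smoothness on `Ω ⊆ E*` of a section of `𝒯E*`: both of its components are smooth. -/
def SmoothProlong (A : LieAlgebroid n m M E) (Ω : Set (DualTotal m E))
    (ρ : ∀ u, Prolong A u) : Prop :=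
  ContMDiffOn (dualModel n m) ((𝓡 n).prod 𝓘(ℝ, Eu m)) ∞
      (fun u => (⟨u.proj, (ρ u).1.1⟩ : TotalSpace (Eu m) E)) Ω ∧
    ContMDiffOn (dualModel n m) (dualModel n m).tangent ∞
      (fun u => (⟨u, (ρ u).1.2⟩ : TangentBundle (dualModel n m) (DualTotal m E))) Ω

/-! ### The bracket of `𝒯E*` -/

/-- A smooth section of `E` which near `x` is the section through `a ∈ E_x` that is constant in the
preferred local trivialization at `x`. -/
def constSection (x : M) (a : E x) : Cₛ^∞⟮𝓡 n; Eu m, E⟯ :=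
  Classical.epsilon fun s : Cₛ^∞⟮𝓡 n; Eu m, E⟯ =>
    ∀ᶠ y in 𝓝 x, s y = FiberBundle.extend (Eu m) a y

/-- For a map `a : E* → E` over `M` and a tangent vector `v` at `u ∈ E*`, the derivative of `a`
along `v` in the preferred local trivialization of `E` at `τ(u)`: if `(s_α)` is the local frame
constant in that trivialization and `a = a^α s_α`, this is `v(a^α) s_α`. -/
def trivDeriv (u : DualTotal m E) (a : ∀ w : DualTotal m E, E w.proj)
    (v : TangentSpace (dualModel n m) u) : E u.proj :=
  (trivializationAt (Eu m) E u.proj).symm u.proj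
    (mfderiv (dualModel n m) 𝓘(ℝ, Eu m)
      (fun w => (trivializationAt (Eu m) E u.proj ⟨w.proj, a w⟩).2) u v)

/-- The first component of the bracket of two sections `ρ₁ = (a, U)` and `ρ₂ = (b, V)` of `𝒯E*`.
For `a = a^α s_α`, `b = b^β s_β` with a local frame `(s_α)` of `E` it is
`a^α b^β [s_α, s_β] + U(b^β) s_β - V(a^α) s_α`; here the frame is the one that is constant in the
preferred local trivialization. For projectable sections `a = X ∘ τ`, `b = Y ∘ τ` it is
`[X, Y] ∘ τ`. -/
def bracketFst (A : LieAlgebroid n m M E) (ρ₁ ρ₂ : ∀ u, Prolong A u) (u : DualTotal m E) :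
    E u.proj :=
  A.bracket (constSection u.proj (ρ₁ u).1.1) (constSection u.proj (ρ₂ u).1.1) u.proj
    + trivDeriv u (fun w => (ρ₂ w).1.1) (ρ₁ u).1.2
    - trivDeriv u (fun w => (ρ₁ w).1.1) (ρ₂ u).1.2

/-- The second component of the bracket of two sections of `𝒯E*`: the Lie bracket of their images
under the anchor. -/
def bracketSnd (A : LieAlgebroid n m M E) (ρ₁ ρ₂ : ∀ u, Prolong A u) (u : DualTotal m E) :
    TangentSpace (dualModel n m) u :=
  VectorField.mlieBracket (dualModel n m) (fun w => (ρ₁ w).1.2) (fun w => (ρ₂ w).1.2) u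

open Classical in
/-- The bracket of two sections of `𝒯E*`. (The pair of the two components lies in the fibre of
`𝒯E*` wherever the two sections are smooth; elsewhere the value does not matter.) -/
def prolongBracket (A : LieAlgebroid n m M E) (ρ₁ ρ₂ : ∀ u, Prolong A u) (u : DualTotal m E) :
    Prolong A u :=
  if h : (bracketFst A ρ₁ ρ₂ u, bracketSnd A ρ₁ ρ₂ u) ∈ Prolong A u then ⟨_, h⟩ else 0

/-! ### The Liouville section and the canonical symplectic section -/

/-- The Liouville section `θ_E`, `θ_E(u)(a, v) = u(a)`. -/
def liouville (A : LieAlgebroid n m M E) (u : DualTotal m E) (p : Prolong A u) : ℝ :=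
  covec u p.1.1

/-- The canonical symplectic section `ω_E = -d^E θ_E`, evaluated on two sections of `𝒯E*`, where
`d^E θ(ρ₁, ρ₂) = σ¹(ρ₁)(θ(ρ₂)) - σ¹(ρ₂)(θ(ρ₁)) - θ([ρ₁, ρ₂])`. -/
def symplectic (A : LieAlgebroid n m M E) (ρ₁ ρ₂ : ∀ u, Prolong A u) (u : DualTotal m E) : ℝ :=
  -(dirDeriv (dualModel n m) (fun w => liouville A w (ρ₂ w)) u (ρ₁ u).1.2
    - dirDeriv (dualModel n m) (fun w => liouville A w (ρ₁ w)) u (ρ₂ u).1.2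
    - liouville A u (prolongBracket A ρ₁ ρ₂ u))

/-! ### Nonlinear connections -/

/-- `N` is a nonlinear connection on `𝒯E*` over `Ω ⊆ E*`: a smooth bundle endomorphism with
`N² = Id` and `V𝒯E* = ker (Id + N)`. -/
structure IsNonlinearConnection (A : LieAlgebroid n m M E) (Ω : Set (DualTotal m E))
    (N : ∀ u, Prolong A u →ₗ[ℝ] Prolong A u) : Prop where
  smooth : ∀ ρ : ∀ u, Prolong A u, SmoothProlong A Ω ρ → SmoothProlong A Ω (fun u => N u (ρ u))
  sq : ∀ u ∈ Ω, N u ∘ₗ N u = LinearMap.id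
  ker : ∀ u ∈ Ω, LinearMap.ker (LinearMap.id + N u) = VertProlong A u

/-- The horizontal projector `h = (Id + N) / 2`. -/
def horProj {A : LieAlgebroid n m M E} (N : ∀ u, Prolong A u →ₗ[ℝ] Prolong A u)
    (u : DualTotal m E) : Prolong A u →ₗ[ℝ] Prolong A u :=
  (1 / 2 : ℝ) • (LinearMap.id + N u)

/-- The vertical projector `v = (Id - N) / 2`. -/
def verProj {A : LieAlgebroid n m M E} (N : ∀ u, Prolong A u →ₗ[ℝ] Prolong A u)
    (u : DualTotal m E) : Prolong A u →ₗ[ℝ] Prolong A u :=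
  (1 / 2 : ℝ) • (LinearMap.id - N u)

/-- `N` is symmetric over `Ω`: the horizontal bundle `ker (Id - N)` is Lagrangian for `ω_E`, that
is, `ω_E` vanishes on any two horizontal sections. (The rank of the horizontal bundle of a nonlinear
connection is half the rank of `𝒯E*`.) -/
def IsSymmetricConnection (A : LieAlgebroid n m M E) (Ω : Set (DualTotal m E))
    (N : ∀ u, Prolong A u →ₗ[ℝ] Prolong A u) : Prop :=
  ∀ ρ₁ ρ₂ : ∀ u, Prolong A u, SmoothProlong A Ω ρ₁ → SmoothProlong A Ω ρ₂ →
    (∀ u ∈ Ω, N u (ρ₁ u) = ρ₁ u) → (∀ u ∈ Ω, N u (ρ₂ u) = ρ₂ u) →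
      ∀ u ∈ Ω, symplectic A ρ₁ ρ₂ u = 0

/-- The dynamical covariant derivative `∇_ρ X = h[ρ, hX] + v[ρ, vX]`. -/
def dynCovDeriv (A : LieAlgebroid n m M E) (N : ∀ u, Prolong A u →ₗ[ℝ] Prolong A u)
    (ρ X : ∀ u, Prolong A u) (u : DualTotal m E) : Prolong A u :=
  horProj N u (prolongBracket A ρ (fun w => horProj N w (X w)) u)
    + verProj N u (prolongBracket A ρ (fun w => verProj N w (X w)) u)

/-! ### The Hamiltonian -/

/-- The vertical Hessian of `H : E* → ℝ` at `u`: the second derivative of the restriction of `H` to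
the fibre of `E*` through `u`, in the directions `φ`, `ψ`. In local coordinates it is
`g^{αβ} φ_α ψ_β` with `g^{αβ} = ∂²H/∂μ_α∂μ_β`. -/
def fibreHess (H : DualTotal m E → ℝ) (u : DualTotal m E)
    (φ ψ : E u.proj →L[ℝ] Bundle.Trivial M ℝ u.proj) : ℝ :=
  deriv (fun s : ℝ => deriv (fun t : ℝ => H ⟨u.proj, u.snd + s • φ + t • ψ⟩) 0) 0

/-- `H` is a regular Hamiltonian on `Ω ⊆ E*`: it is smooth there and its vertical Hessian is
nondegenerate. -/
structure IsRegularHamiltonian (n : ℕ) {m : ℕ} {M : Type*} [TopologicalSpace M]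
    [ChartedSpace (Eu n) M] [IsManifold (𝓡 n) ∞ M]
    {E : M → Type*} [TopologicalSpace (TotalSpace (Eu m) E)]
    [∀ x, AddCommGroup (E x)] [∀ x, Module ℝ (E x)] [∀ x, TopologicalSpace (E x)]
    [FiberBundle (Eu m) E] [VectorBundle ℝ (Eu m) E] [ContMDiffVectorBundle ∞ (Eu m) E (𝓡 n)]
    (Ω : Set (DualTotal m E)) (H : DualTotal m E → ℝ) : Prop where
  smooth : ContMDiffOn (dualModel n m) 𝓘(ℝ, ℝ) ∞ H Ω
  nondegenerate : ∀ u ∈ Ω, ∀ φ, (∀ ψ, fibreHess H u φ ψ = 0) → φ = 0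

/-- The canonical isomorphism (vertical lift) from the fibre of `E*` through `u` to the vertical
tangent vectors at `u`: the velocity at `t = 0` of `t ↦ u + t φ`. -/
def vertLift (u : DualTotal m E) (φ : E u.proj →L[ℝ] Bundle.Trivial M ℝ u.proj) :
    TangentSpace (dualModel n m) u :=
  mfderiv 𝓘(ℝ, ℝ) (dualModel n m) (fun t : ℝ => (⟨u.proj, u.snd + t • φ⟩ : DualTotal m E)) 0
    (1 : ℝ)

/-- The inverse of the vertical lift, on vertical tangent vectors. -/
def vertCoord (u : DualTotal m E) (v : TangentSpace (dualModel n m) u) :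
    E u.proj →L[ℝ] Bundle.Trivial M ℝ u.proj :=
  Function.invFun (vertLift (n := n) u) v

/-- The pseudo-Riemannian metric `g` induced by the Hamiltonian on the vertical bundle `V𝒯E*`. -/
def vertMetric (A : LieAlgebroid n m M E) (H : DualTotal m E → ℝ) (u : DualTotal m E)
    (p q : Prolong A u) : ℝ :=
  fibreHess H u (vertCoord u p.1.2) (vertCoord u q.1.2)

/-- `ρ` is the Hamilton section of `H` over `Ω`: `i_ρ ω_E = d^E H`. -/
def IsHamiltonSection (A : LieAlgebroid n m M E) (Ω : Set (DualTotal m E))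
    (H : DualTotal m E → ℝ) (ρ : ∀ u, Prolong A u) : Prop :=
  SmoothProlong A Ω ρ ∧ ∀ ν : ∀ u, Prolong A u, SmoothProlong A Ω ν →
    ∀ u ∈ Ω, symplectic A ρ ν u = dirDeriv (dualModel n m) H u (ν u).1.2

/-- `N` is metric over `Ω` with respect to the section `ρ` and the metric `g` of `H`:
`ρ(g(X, Y)) = g(∇_ρ X, Y) + g(X, ∇_ρ Y)` for all vertical sections `X`, `Y`. -/
def IsMetricConnection (A : LieAlgebroid n m M E) (Ω : Set (DualTotal m E))
    (H : DualTotal m E → ℝ) (ρ : ∀ u, Prolong A u)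
    (N : ∀ u, Prolong A u →ₗ[ℝ] Prolong A u) : Prop :=
  ∀ X Y : ∀ u, Prolong A u, SmoothProlong A Ω X → SmoothProlong A Ω Y →
    (∀ u ∈ Ω, X u ∈ VertProlong A u) → (∀ u ∈ Ω, Y u ∈ VertProlong A u) →
      ∀ u ∈ Ω, dirDeriv (dualModel n m) (fun w => vertMetric A H w (X w) (Y w)) u (ρ u).1.2 =
        vertMetric A H u (dynCovDeriv A N ρ X u) (Y u)
          + vertMetric A H u (X u) (dynCovDeriv A N ρ Y u)

/-- For `a ∈ E_{τ(u)}` the covector `φ` with `g_u(φ, ψ) = ψ(a)` for all `ψ`; in local coordinates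
`φ_β = g_{αβ} a^α` with `(g_{αβ})` the inverse matrix of `(g^{αβ})`. -/
def flat (H : DualTotal m E → ℝ) (u : DualTotal m E) (a : E u.proj) :
    E u.proj →L[ℝ] Bundle.Trivial M ℝ u.proj :=
  Classical.epsilon fun φ => ∀ ψ, fibreHess H u φ ψ = ψ a

open Classical in
/-- The adapted almost tangent structure `𝒥_H = g_{αβ} 𝒬^α ⊗ 𝒫^β` of `H`, which maps `(a, v)` to
the vertical element `(0, φ^v)` with `φ` the covector that corresponds to `a` under `g`. (The pair
lies in the fibre of `𝒯E*`, since `φ^v` is vertical.) -/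
def tangentStructure (A : LieAlgebroid n m M E) (H : DualTotal m E → ℝ) (u : DualTotal m E)
    (p : Prolong A u) : Prolong A u :=
  if h : ((0 : E u.proj), vertLift u (flat H u p.1.1)) ∈ Prolong A u then ⟨_, h⟩ else 0

/-- `N = -ℒ_ρ 𝒥_H` over `Ω`, where `(ℒ_ρ 𝒥)(ν) = [ρ, 𝒥ν] - 𝒥[ρ, ν]`. -/
def IsLieDerivConnection (A : LieAlgebroid n m M E) (Ω : Set (DualTotal m E))
    (H : DualTotal m E → ℝ) (ρ : ∀ u, Prolong A u)
    (N : ∀ u, Prolong A u →ₗ[ℝ] Prolong A u) : Prop :=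
  ∀ ν : ∀ u, Prolong A u, SmoothProlong A Ω ν → ∀ u ∈ Ω,
    N u (ν u) = -(prolongBracket A ρ (fun w => tangentStructure A H w (ν w)) u
      - tangentStructure A H u (prolongBracket A ρ ν u))

/-! ### Local coordinates -/

/-- Local coordinates for a Lie algebroid: a chart `(q^i)` of `M`, an open subset `W` of its domain,
and smooth sections `s_α` of `E` that form a basis of the fibre at each point of `W`. -/
structure LocalFrame (n m : ℕ) (M : Type*) [TopologicalSpace M]
    [ChartedSpace (Eu n) M] [IsManifold (𝓡 n) ∞ M]
    (E : M → Type*) [TopologicalSpace (TotalSpace (Eu m) E)]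
    [∀ x, AddCommGroup (E x)] [∀ x, Module ℝ (E x)] [∀ x, TopologicalSpace (E x)]
    [FiberBundle (Eu m) E] [VectorBundle ℝ (Eu m) E]
    [ContMDiffVectorBundle ∞ (Eu m) E (𝓡 n)] where
  chart : OpenPartialHomeomorph M (Eu n)
  chart_mem : chart ∈ IsManifold.maximalAtlas (𝓡 n) ∞ M
  W : Set M
  isOpen_W : IsOpen W
  W_subset : W ⊆ chart.source
  s : Fin m → Cₛ^∞⟮𝓡 n; Eu m, E⟯
  isFrame : IsLocalFrameOn (𝓡 n) (Eu m) ∞ (fun α x => s α x) W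

namespace LocalFrame

variable (A : LieAlgebroid n m M E) (c : LocalFrame n m M E)

/-- `σ_α^i`, given by `σ(s_α) = σ_α^i ∂/∂q^i`. -/
def sig (α : Fin m) (i : Fin n) (x : M) : ℝ :=
  dirDeriv (𝓡 n) (fun y => c.chart y i) x (A.anchor x (c.s α x))

/-- `L_{αβ}^γ`, given by `[s_α, s_β] = L_{αβ}^γ s_γ`. -/
def str (α β γ : Fin m) (x : M) : ℝ :=
  c.isFrame.coeff γ x (A.bracket (c.s α) (c.s β) x)

/-- The point of `E*` with local coordinates `(q, μ)`: the covector at `chart⁻¹(q)` whose value on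
`s_α` is `μ_α`. -/
def point (q : Eu n) (μ : Fin m → ℝ) : DualTotal m E :=
  ⟨c.chart.symm q, Classical.epsilon
    fun φ : E (c.chart.symm q) →L[ℝ] Bundle.Trivial M ℝ (c.chart.symm q) =>
      ∀ α, φ (c.s α (c.chart.symm q)) = μ α⟩

/-- The coordinates `q` of a point of `E*`. -/
def qCoord (u : DualTotal m E) : Eu n := c.chart u.proj

/-- The coordinates `μ_α` of a point of `E*`. -/
def muCoord (u : DualTotal m E) (α : Fin m) : ℝ := covec u (c.s α u.proj)

/-- `∂f/∂q^i` for a function `f` of the local coordinates `(q, μ)`. -/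
def pdq (i : Fin n) (f : Eu n → (Fin m → ℝ) → ℝ) (q : Eu n) (μ : Fin m → ℝ) : ℝ :=
  deriv (fun t : ℝ => f (q + t • EuclideanSpace.single i (1 : ℝ)) μ) 0

/-- `∂f/∂μ_α` for a function `f` of the local coordinates `(q, μ)`. -/
def pdmu (α : Fin m) (f : Eu n → (Fin m → ℝ) → ℝ) (q : Eu n) (μ : Fin m → ℝ) : ℝ :=
  deriv (fun t : ℝ => f q (μ + t • Pi.single α (1 : ℝ))) 0

/-- The tangent vector `∂/∂q^i` at `u`. -/
def partialQ (i : Fin n) (u : DualTotal m E) : TangentSpace (dualModel n m) u :=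
  mfderiv 𝓘(ℝ, ℝ) (dualModel n m)
    (fun t : ℝ => c.point (c.qCoord u + t • EuclideanSpace.single i (1 : ℝ)) (c.muCoord u)) 0
    (1 : ℝ)

/-- The tangent vector `∂/∂μ_α` at `u`. -/
def partialMu (α : Fin m) (u : DualTotal m E) : TangentSpace (dualModel n m) u :=
  mfderiv 𝓘(ℝ, ℝ) (dualModel n m)
    (fun t : ℝ => c.point (c.qCoord u) (c.muCoord u + t • Pi.single α (1 : ℝ))) 0 (1 : ℝ)

/-- `𝒬_α = (s_α, σ_α^i ∂/∂q^i)`. -/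
def frameQ (α : Fin m) (u : DualTotal m E) : E u.proj × TangentSpace (dualModel n m) u :=
  (c.s α u.proj, ∑ i, c.sig A α i u.proj • c.partialQ i u)

/-- `𝒫^α = (0, ∂/∂μ_α)`. -/
def frameP (α : Fin m) (u : DualTotal m E) : E u.proj × TangentSpace (dualModel n m) u :=
  (0, c.partialMu α u)

variable (H : DualTotal m E → ℝ)

/-- The Hamiltonian in local coordinates. -/
def ham (q : Eu n) (μ : Fin m → ℝ) : ℝ := H (c.point q μ)

/-- The matrix `g^{αβ} = ∂²H/∂μ_α∂μ_β`. -/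
def gUp (q : Eu n) (μ : Fin m → ℝ) : Matrix (Fin m) (Fin m) ℝ :=
  Matrix.of fun α β => pdmu α (pdmu β (c.ham H)) q μ

/-- The inverse matrix `g_{αβ}`. -/
def gLow (α β : Fin m) (q : Eu n) (μ : Fin m → ℝ) : ℝ := (c.gUp H q μ)⁻¹ α β

/-- The coefficients of the canonical nonlinear connection,
`N_{αβ} = (1/2) (σ_γ^i {g_{αβ}, H}_i^γ - ∂²H/∂q^i∂μ_ε (σ_β^i g_{αε} + σ_α^i g_{βε})
  + μ_γ L_{κε}^γ ∂H/∂μ_ε ∂g_{αβ}/∂μ_κ + μ_γ L_{αβ}^γ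
  + ∂H/∂μ_δ (g_{αε} L_{δβ}^ε + g_{βε} L_{δα}^ε))`, where
`{g_{αβ}, H}_i^γ = ∂g_{αβ}/∂μ_γ ∂H/∂q^i - ∂g_{αβ}/∂q^i ∂H/∂μ_γ`. -/
def canonicalCoeff (α β : Fin m) (u : DualTotal m E) : ℝ :=
  let x := u.proj
  let q := c.qCoord u
  let μ := c.muCoord u
  (1 / 2) *
    ((∑ γ, ∑ i, c.sig A γ i x *
        (pdmu γ (c.gLow H α β) q μ * pdq i (c.ham H) q μ
          - pdq i (c.gLow H α β) q μ * pdmu γ (c.ham H) q μ))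
      - (∑ i, ∑ ε, pdq i (pdmu ε (c.ham H)) q μ *
          (c.sig A β i x * c.gLow H α ε q μ + c.sig A α i x * c.gLow H β ε q μ))
      + (∑ γ, ∑ ε, ∑ κ, μ γ * c.str A κ ε γ x * pdmu ε (c.ham H) q μ *
          pdmu κ (c.gLow H α β) q μ)
      + (∑ γ, μ γ * c.str A α β γ x)
      + (∑ δ, ∑ ε, pdmu δ (c.ham H) q μ *
          (c.gLow H α ε q μ * c.str A δ β ε x + c.gLow H β ε q μ * c.str A δ α ε x)))

end LocalFrame

/-- `N` has the coefficients `N_{αβ}` of the canonical nonlinear connection of `H` in all local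
coordinates: `N(𝒬_α) = 𝒬_α + 2 N_{αβ} 𝒫^β`. -/
def HasCanonicalCoeff (A : LieAlgebroid n m M E) (Ω : Set (DualTotal m E))
    (H : DualTotal m E → ℝ) (N : ∀ u, Prolong A u →ₗ[ℝ] Prolong A u) : Prop :=
  ∀ c : LocalFrame n m M E, ∀ u ∈ Ω, u.proj ∈ c.W → ∀ α,
    ∃ hQ : c.frameQ A α u ∈ Prolong A u,
      (N u ⟨c.frameQ A α u, hQ⟩ : E u.proj × TangentSpace (dualModel n m) u) =
        c.frameQ A α u + (2 : ℝ) • ∑ β, c.canonicalCoeff A H α β u • c.frameP β u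

/-- `N` is the canonical nonlinear connection over `Ω` induced by the regular Hamiltonian `H` with
Hamilton section `ρ`: `N = -ℒ_ρ 𝒥_H`, and its local coefficients are the canonical ones. -/
def IsCanonicalConnection (A : LieAlgebroid n m M E) (Ω : Set (DualTotal m E))
    (H : DualTotal m E → ℝ) (ρ : ∀ u, Prolong A u)
    (N : ∀ u, Prolong A u →ₗ[ℝ] Prolong A u) : Prop :=
  IsLieDerivConnection A Ω H ρ N ∧ HasCanonicalCoeff A Ω H N

end Prolongation

end

set_option linter.unusedSectionVars false

noncomputable section

/-! ### Calculus of directional derivatives. -/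

section DirDeriv

variable {B : Type*} [NormedAddCommGroup B] [NormedSpace ℝ B] {G : Type*} [TopologicalSpace G]
  {I : ModelWithCorners ℝ B G} {X : Type*} [TopologicalSpace X] [ChartedSpace G X]
  {f g : X → ℝ} {x : X}

/-! The theorem reduces to matrix algebra in the frame `𝒬_α, 𝒫^α` over coordinates `(q, μ)`. Write
`G = (g^{αβ})`, `L = G⁻¹`, `T_{αβ} = μ_γ L^γ_{αβ}`, `ρ_β` for the `𝒫`-coordinates of the Hamilton
section, `R_{εβ} = ∂ρ_β/∂μ_ε`, `D = ρ(G)`.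

In this frame `ω_E` is the standard symplectic form plus `T` on the `𝒬`-part (`symplectic_eq`). It
is therefore nondegenerate (`symp_ext`), and `i_ρ ω_E = dH` has exactly one solution, with
coordinates `∂H/∂μ_α` and `hamP`.

A nonlinear connection is at each point a matrix `k`: it keeps `𝒬`-coordinates, is `-1` on vertical
vectors, and sends `𝒬_α` to `𝒬_α + 2 k_{αβ} 𝒫^β` (`exists_hasMatrix_of_connection`). Symmetry says
`k - kᵀ = T` (`sub_transpose_of_symmetric`). On vertical sections `∇` is `ρ` acting on the
components plus the matrix `B = -R + G k` (`dynCovDeriv_coords`), so metricity says `D = B G + G Bᵀ`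
(`metric_defect`). Multiplying by `L` on both sides turns this into `k + kᵀ = L D L + L R + (L R)ᵀ`.
One condition fixes the skew part of `k` and the other its symmetric part, whence uniqueness.

For existence, the coordinates of `-ℒ_ρ 𝒥_H` are computed. The derivatives of the argument cancel,
and what remains is a nonlinear connection with matrix `k = (1/2)(-ρ(L) + L R + (L R)ᵀ + T)`, which
is `connCoeff` (`lieDeriv_coords`). Differentiating `G L = 1` gives `L D L = -ρ(L)`, so this `k` has
the required symmetric and skew parts (`connCoeff_relations`). Expanding `ρ` and `R` gives the
explicit coefficients (`connCoeff_eq`).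

Both `ρ` and the connection are constructed at each point in one frame. They do not depend on that
frame because they are characterised by the frame-free expressions `symplectic` and `-ℒ_ρ 𝒥_H`,
tested on global smooth sections through any given vector (`exists_section_eq`). Such sections come
from bump functions on `E*`. -/

theorem dirDeriv_eq_mvfderiv (f : X → ℝ) (x : X) (v : TangentSpace I x) :
    dirDeriv I f x v = mvfderiv I f x v := rfl

theorem dirDeriv_add_right (v w : TangentSpace I x) :
    dirDeriv I f x (v + w) = dirDeriv I f x v + dirDeriv I f x w :=
  map_add (mvfderiv I f x) v w

theorem dirDeriv_sub_right (v w : TangentSpace I x) :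
    dirDeriv I f x (v - w) = dirDeriv I f x v - dirDeriv I f x w :=
  map_sub (mvfderiv I f x) v w

theorem dirDeriv_neg_right (v : TangentSpace I x) :
    dirDeriv I f x (-v) = -dirDeriv I f x v :=
  map_neg (mvfderiv I f x) v

theorem dirDeriv_zero_right : dirDeriv I f x 0 = 0 :=
  map_zero (mvfderiv I f x)

theorem dirDeriv_smul_right (c : ℝ) (v : TangentSpace I x) :
    dirDeriv I f x (c • v) = c * dirDeriv I f x v :=
  map_smul (mvfderiv I f x) c v

theorem dirDeriv_sum_right {ι : Type*} (s : Finset ι) (v : ι → TangentSpace I x) :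
    dirDeriv I f x (∑ i ∈ s, v i) = ∑ i ∈ s, dirDeriv I f x (v i) :=
  map_sum (mvfderiv I f x) v s

theorem dirDeriv_congr (h : f =ᶠ[𝓝 x] g) (v : TangentSpace I x) :
    dirDeriv I f x v = dirDeriv I g x v := by
  unfold dirDeriv
  rw [h.mfderiv_eq]
  rfl

theorem dirDeriv_const (c : ℝ) (v : TangentSpace I x) : dirDeriv I (fun _ => c) x v = 0 := by
  rw [dirDeriv_eq_mvfderiv, mvfderiv_const]; rfl

theorem dirDeriv_add (hf : MDifferentiableAt I 𝓘(ℝ, ℝ) f x) (hg : MDifferentiableAt I 𝓘(ℝ, ℝ) g x)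
    (v : TangentSpace I x) :
    dirDeriv I (fun y => f y + g y) x v = dirDeriv I f x v + dirDeriv I g x v :=
  DFunLike.congr_fun (mvfderiv_add hf hg) v

theorem dirDeriv_neg (v : TangentSpace I x) :
    dirDeriv I (fun y => -f y) x v = -dirDeriv I f x v :=
  DFunLike.congr_fun (mvfderiv_neg (g := f) (x := x) (I := I)) v

theorem dirDeriv_mul (hf : MDifferentiableAt I 𝓘(ℝ, ℝ) f x) (hg : MDifferentiableAt I 𝓘(ℝ, ℝ) g x)
    (v : TangentSpace I x) :
    dirDeriv I (fun y => f y * g y) x v = f x * dirDeriv I g x v + dirDeriv I f x v * g x := by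
  have := DFunLike.congr_fun (mvfderiv_mul hf hg) v
  refine Eq.trans this ?_
  change f x * dirDeriv I g x v + g x * dirDeriv I f x v = _
  ring

theorem dirDeriv_sum {ι : Type} (s : Finset ι) {f : ι → X → ℝ}
    (hf : ∀ i ∈ s, MDifferentiableAt I 𝓘(ℝ, ℝ) (f i) x) (v : TangentSpace I x) :
    dirDeriv I (fun y => ∑ i ∈ s, f i y) x v = ∑ i ∈ s, dirDeriv I (f i) x v := by
  classical
  induction s using Finset.induction_on with
  | empty => simpa using dirDeriv_const 0 v
  | insert a s ha ih =>
    simp only [Finset.sum_insert ha]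
    rw [dirDeriv_add (hf a (Finset.mem_insert_self a s)),
      ih fun i hi => hf i (Finset.mem_insert_of_mem hi)]
    have h := MDifferentiableAt.sum (I := I) (z := x) (t := s)
      (fun i hi => hf i (Finset.mem_insert_of_mem hi))
    rwa [Finset.sum_fn] at h

end DirDeriv

/-! ### The Lie bracket of vector fields as a commutator of derivations. -/

theorem mlieBracket_eq_lieBracket {B : Type*} [NormedAddCommGroup B] [NormedSpace ℝ B]
    (V W : ∀ y : B, TangentSpace 𝓘(ℝ, B) y) :
    VectorField.mlieBracket 𝓘(ℝ, B) V W = VectorField.lieBracket ℝ V W := by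
  rw [← VectorField.mlieBracketWithin_univ, VectorField.mlieBracketWithin_eq_lieBracketWithin]
  exact VectorField.lieBracketWithin_univ

section Bracket

open VectorField

variable {B : Type*} [NormedAddCommGroup B] [NormedSpace ℝ B] [CompleteSpace B]
  {G : Type*} [TopologicalSpace G]
  {I : ModelWithCorners ℝ B G} [I.Boundaryless] {X : Type*} [TopologicalSpace X]
  [ChartedSpace G X] [IsManifold I ∞ X]
  {f g : X → ℝ} {x : X}

/-- `[V, W] f = V (W f) - W (V f)`. -/
theorem dirDeriv_mlieBracket {V W : ∀ y : X, TangentSpace I y}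
    (hf : ContMDiffAt I 𝓘(ℝ, ℝ) ∞ f x)
    (hV : MDifferentiableAt I I.tangent (fun y => (⟨y, V y⟩ : TangentBundle I X)) x)
    (hW : MDifferentiableAt I I.tangent (fun y => (⟨y, W y⟩ : TangentBundle I X)) x) :
    dirDeriv I f x (mlieBracket I V W x) =
      dirDeriv I (fun y => dirDeriv I f y (W y)) x (V x)
        - dirDeriv I (fun y => dirDeriv I f y (V y)) x (W x) := by
  have : IsManifold I (minSmoothness ℝ 3) X := by
    rw [minSmoothness_of_isRCLikeNormedField]
    exact IsManifold.of_le (n := ∞) ENat.LEInfty.out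
  have : IsManifold I 2 X := IsManifold.of_le (n := ∞) ENat.LEInfty.out
  have : IsManifold I 1 X := IsManifold.of_le (n := ∞) ENat.LEInfty.out
  set φ := extChartAt I x with hφ
  set z := φ x with hz
  have hzx : φ.symm z = x := extChartAt_to_inv x
  have hsm : ∀ y ∈ φ.target, ContMDiffAt 𝓘(ℝ, B) I ∞ φ.symm y := fun y hy =>
    (contMDiffOn_extChartAt_symm x).contMDiffAt ((isOpen_extChartAt_target x).mem_nhds hy)
  have hinv : ∀ y ∈ φ.target, (mfderiv 𝓘(ℝ, B) I φ.symm y).IsInvertible := fun y hy => by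
    have := isInvertible_mfderivWithin_extChartAt_symm (I := I) hy
    rwa [ModelWithCorners.range_eq_univ, mfderivWithin_univ] at this
  have hzt : z ∈ φ.target := mem_extChartAt_target x
  set F : B → ℝ := f ∘ φ.symm with hF
  -- The pullback to the chart is hidden behind an opaque `P` with values in the model space, so
  -- that the ordinary Fréchet derivative applies to it.
  obtain ⟨P, hP⟩ : ∃ P : (∀ y, TangentSpace I y) → B → B,
      ∀ U, P U = mpullback 𝓘(ℝ, B) I φ.symm U := ⟨_, fun _ => rfl⟩
  have key : ∀ U : ∀ y : X, TangentSpace I y, ∀ y ∈ φ.target,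
      ∀ h : X → ℝ, MDifferentiableAt I 𝓘(ℝ, ℝ) h (φ.symm y) →
      dirDeriv I h (φ.symm y) (U (φ.symm y)) = fderiv ℝ (h ∘ φ.symm) y (P U y) := by
    intro U y hy h hfy
    have h1 : mfderiv 𝓘(ℝ, B) I φ.symm y (P U y) = U (φ.symm y) := by
      rw [hP, mpullback_apply]
      exact (hinv y hy).self_apply_inverse _
    have h2 := mfderiv_comp (I' := I) y hfy
      ((hsm y hy).mdifferentiableAt (by simp))
    rw [← mfderiv_eq_fderiv, h2]
    change _ = mfderiv I 𝓘(ℝ, ℝ) h (φ.symm y) (mfderiv 𝓘(ℝ, B) I φ.symm y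
      (P U y))
    rw [h1]
    rfl
  have hFs : ContDiffAt ℝ ∞ F z := by
    rw [← contMDiffAt_iff_contDiffAt]
    exact ContMDiffAt.comp z (by rwa [hzx]) (hsm z hzt)
  have hnear : ∀ᶠ y in 𝓝 z, y ∈ φ.target := (isOpen_extChartAt_target x).mem_nhds hzt
  have hfnear : ∀ᶠ y in 𝓝 z, MDifferentiableAt I 𝓘(ℝ, ℝ) f (φ.symm y) := by
    have h1 : ∀ᶠ y in 𝓝 x, ContMDiffAt I 𝓘(ℝ, ℝ) 1 f y :=
      (contMDiffAt_iff_contMDiffAt_nhds (by simp)).1 (hf.of_le ENat.LEInfty.out)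
    have h2 := (hsm z hzt).continuousAt
    rw [ContinuousAt, hzx] at h2
    exact (h2.eventually h1).mono fun y hy => hy.mdifferentiableAt one_ne_zero
  have hdiff : ∀ U : ∀ y : X, TangentSpace I y,
      MDifferentiableAt I I.tangent (fun y => (⟨y, U y⟩ : TangentBundle I X)) x →
      DifferentiableAt ℝ (P U) z := by
    intro U hU
    rw [← hzx] at hU
    have h1 := MDifferentiableAt.mpullback_vectorField hU (hsm z hzt) (hinv z hzt)
      ENat.LEInfty.out
    rw [← mdifferentiableAt_iff_differentiableAt, hP]
    exact ((contMDiff_snd_tangentBundle_modelSpace (n := 1) B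
      𝓘(ℝ, B)).contMDiffAt.mdifferentiableAt one_ne_zero).comp z h1
  have hF2 : DifferentiableAt ℝ (fderiv ℝ F) z :=
    (hFs.fderiv_right (m := 1) (by rw [one_add_one_eq_two]; exact ENat.LEInfty.out)).differentiableAt one_ne_zero
  have second : ∀ U U' : ∀ y : X, TangentSpace I y,
      MDifferentiableAt I I.tangent (fun y => (⟨y, U y⟩ : TangentBundle I X)) x →
      dirDeriv I (fun y => dirDeriv I f y (U y)) x (U' x) =
        fderiv ℝ (fderiv ℝ F) z (P U' z)
            (P U z)
          + fderiv ℝ F z (fderiv ℝ (P U) z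
            (P U' z)) := by
    intro U U' hU
    set K : X → ℝ := fun y => dirDeriv I f y (U y) with hK
    set L : B → ℝ := fun y => fderiv ℝ F y (P U y) with hL
    have hKL : K ∘ φ.symm =ᶠ[𝓝 z] L := by
      filter_upwards [hnear, hfnear] with y hy hfy
      exact key U y hy f hfy
    have hLd : DifferentiableAt ℝ L z := hF2.clm_apply (hdiff U hU)
    have hKd : MDifferentiableAt I 𝓘(ℝ, ℝ) K x := by
      have h1 : MDifferentiableAt I 𝓘(ℝ, ℝ) (L ∘ φ) x :=
        MDifferentiableAt.comp x hLd.mdifferentiableAt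
          (mdifferentiableAt_extChartAt (mem_chart_source G x))
      refine h1.congr_of_eventuallyEq ?_
      have h2 := (continuousAt_extChartAt (I := I) x).eventually hKL
      filter_upwards [h2, extChartAt_source_mem_nhds (I := I) x] with y hy hys
      have h3 : φ.symm (φ y) = y := φ.left_inv hys
      have h4 : K (φ.symm (φ y)) = L (φ y) := hy
      rw [h3] at h4
      exact h4
    have h5 := key U' z hzt K (by rwa [hzx])
    rw [hKL.fderiv_eq, hL, fderiv_clm_apply hF2 (hdiff U hU)] at h5
    rw [hzx] at h5
    rw [h5]
    change fderiv ℝ F z (fderiv ℝ (P U) z (P U' z)) + fderiv ℝ (fderiv ℝ F) z (P U' z) (P U z) = _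
    rw [add_comm]
  have hmain := key (mlieBracket I V W) z hzt f (by rw [hzx]; exact hf.mdifferentiableAt (by simp))
  have hbr : P (mlieBracket I V W) z = lieBracket ℝ (P V) (P W) z := by
    rw [hP, mpullback_mlieBracket (n := ∞) (by rwa [hzx]) (by rwa [hzx]) (hsm z hzt)
      (by rw [minSmoothness_of_isRCLikeNormedField]; exact ENat.LEInfty.out), ← hP, ← hP]
    exact congrFun (mlieBracket_eq_lieBracket (P V) (P W)) z
  rw [hbr, hzx, lieBracket] at hmain
  rw [second W V hW, second V W hV, hmain, map_sub]
  -- Both iterated derivatives contain the second derivative of `F`, with arguments in opposite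
  -- order. These terms cancel by symmetry, and the first-order terms are the bracket in the chart.
  have hsymm : IsSymmSndFDerivAt ℝ F z := hFs.isSymmSndFDerivAt (by
    rw [minSmoothness_of_isRCLikeNormedField]; exact ENat.LEInfty.out)
  rw [hsymm.eq (P V z) (P W z)]
  abel

end Bracket

/-! ### Smooth dependence of derivatives on the point and the vector. -/

section Smoothness

variable {B : Type*} [NormedAddCommGroup B] [NormedSpace ℝ B] {G : Type*} [TopologicalSpace G]
  {I : ModelWithCorners ℝ B G} {X : Type*} [TopologicalSpace X] [ChartedSpace G X]
  {B' : Type*} [NormedAddCommGroup B'] [NormedSpace ℝ B'] {G' : Type*} [TopologicalSpace G']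
  {J : ModelWithCorners ℝ B' G'} {Y : Type*} [TopologicalSpace Y] [ChartedSpace G' Y]
  [IsManifold J ∞ Y]
  {B'' : Type*} [NormedAddCommGroup B''] [NormedSpace ℝ B''] {G'' : Type*} [TopologicalSpace G'']
  {K : ModelWithCorners ℝ B'' G''} {Z : Type*} [TopologicalSpace Z] [ChartedSpace G'' Z]
  [IsManifold K ∞ Z]

/-- The derivative of a smooth map applied to a smooth family of tangent vectors is smooth. -/
theorem contMDiffAt_mfderiv_apply {g : Y → Z} {b : X → Y} {w : ∀ x, TangentSpace J (b x)} {x₀ : X}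
    (hg : ContMDiffAt J K ∞ g (b x₀))
    (hw : ContMDiffAt I J.tangent ∞ (fun x => (⟨b x, w x⟩ : TangentBundle J Y)) x₀) :
    ContMDiffAt I K.tangent ∞
      (fun x => (⟨g (b x), mfderiv J K g (b x) (w x)⟩ : TangentBundle K Z)) x₀ := by
  have : IsManifold J 1 Y := IsManifold.of_le (n := ∞) ENat.LEInfty.out
  have : IsManifold K 1 Z := IsManifold.of_le (n := ∞) ENat.LEInfty.out
  have hb : ContMDiffAt I J ∞ b x₀ :=
    (Bundle.contMDiff_proj (TangentSpace J)).contMDiffAt.comp x₀ hw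
  have h1 := ContMDiffAt.mfderiv_const hg (m := ∞) (by simp)
  have h2 := ContMDiffAt.comp x₀ h1 hb
  exact ContMDiffAt.clm_apply_of_inCoordinates (b₁ := b) (b₂ := g ∘ b) (v := w)
    (ϕ := fun x => mfderiv J K g (b x)) h2 hw (hg.comp x₀ hb)

theorem contMDiffAt_dirDeriv {f : Y → ℝ} {b : X → Y} {w : ∀ x, TangentSpace J (b x)} {x₀ : X}
    (hf : ContMDiffAt J 𝓘(ℝ, ℝ) ∞ f (b x₀))
    (hw : ContMDiffAt I J.tangent ∞ (fun x => (⟨b x, w x⟩ : TangentBundle J Y)) x₀) :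
    ContMDiffAt I 𝓘(ℝ, ℝ) ∞ (fun x => dirDeriv J f (b x) (w x)) x₀ :=
  (contMDiff_snd_tangentBundle_modelSpace ℝ 𝓘(ℝ, ℝ)).contMDiffAt.comp x₀
    (contMDiffAt_mfderiv_apply hf hw)

end Smoothness

/-! ### Hausdorff total spaces, bump functions and extensions. -/

theorem t2Space_totalSpace {X : Type*} [TopologicalSpace X] [T2Space X] (F : Type*)
    [TopologicalSpace F] [T2Space F] (E : X → Type*) [TopologicalSpace (TotalSpace F E)]
    [∀ x, TopologicalSpace (E x)] [FiberBundle F E] : T2Space (TotalSpace F E) := by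
  have hc : Continuous (TotalSpace.proj : TotalSpace F E → X) := FiberBundle.continuous_proj F E
  refine ⟨fun u v huv => ?_⟩
  by_cases h : u.proj = v.proj
  · set e := trivializationAt F E u.proj
    have hu : u ∈ e.source := by
      rw [e.mem_source]; exact FiberBundle.mem_baseSet_trivializationAt' u.proj
    have hv : v ∈ e.source := by
      rw [e.mem_source, ← h]; exact FiberBundle.mem_baseSet_trivializationAt' u.proj
    have hne : e u ≠ e v := fun he => huv (e.injOn hu hv he)
    obtain ⟨P, Q, hP, hQ, huP, hvQ, hd⟩ := t2_separation hne
    refine ⟨e.source ∩ e ⁻¹' P, e.source ∩ e ⁻¹' Q,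
      e.continuousOn.isOpen_inter_preimage e.open_source hP,
      e.continuousOn.isOpen_inter_preimage e.open_source hQ, ⟨hu, huP⟩, ⟨hv, hvQ⟩, ?_⟩
    exact (hd.preimage e).mono inter_subset_right inter_subset_right
  · obtain ⟨P, Q, hP, hQ, huP, hvQ, hd⟩ := t2_separation h
    exact ⟨_, _, hP.preimage hc, hQ.preimage hc, huP, hvQ, hd.preimage _⟩

section Bump

variable {B : Type*} [NormedAddCommGroup B] [NormedSpace ℝ B] [FiniteDimensional ℝ B]
  {G : Type*} [TopologicalSpace G] (I : ModelWithCorners ℝ B G) {X : Type*} [TopologicalSpace X]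
  [ChartedSpace G X] [IsManifold I ∞ X] [T2Space X] {x : X}

theorem exists_contMDiff_bump {U : Set X} (hU : U ∈ 𝓝 x) :
    ∃ χ : X → ℝ, ContMDiff I 𝓘(ℝ, ℝ) ∞ χ ∧ χ =ᶠ[𝓝 x] (fun _ => 1) ∧ tsupport χ ⊆ U := by
  obtain ⟨χ, -, hχ⟩ := (SmoothBumpFunction.nhds_basis_tsupport (I := I) x).mem_iff.1 hU
  exact ⟨χ, χ.contMDiff, χ.eventuallyEq_one, hχ⟩

/-- A bump function makes a local coefficient global without changing its germ. This is needed
because the Leibniz rule of `LieAlgebroid` only accepts globally smooth functions. -/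
theorem exists_contMDiff_extension {U : Set X} (hU : IsOpen U) (hx : x ∈ U) {f : X → ℝ}
    (hf : ContMDiffOn I 𝓘(ℝ, ℝ) ∞ f U) :
    ∃ f' : X → ℝ, ContMDiff I 𝓘(ℝ, ℝ) ∞ f' ∧ f' =ᶠ[𝓝 x] f := by
  obtain ⟨χ, h1, h2, h3⟩ := exists_contMDiff_bump I (hU.mem_nhds hx)
  refine ⟨fun y => χ y * f y, ?_, ?_⟩
  · refine contMDiff_of_tsupport fun y hy => ?_
    have hyU : y ∈ U := h3 (closure_mono (Function.support_mul_subset_left χ f) hy)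
    exact (h1.contMDiffAt).mul (hf.contMDiffAt (hU.mem_nhds hyU))
  · filter_upwards [h2] with y hy
    simp [hy]

end Bump

/-! ### Local frames of `E` and the induced coordinates of `E*`. -/

section Frames

variable {n m : ℕ} {M : Type*} [TopologicalSpace M] [ChartedSpace (Eu n) M]
  [IsManifold (𝓡 n) ∞ M] {E : M → Type*} [TopologicalSpace (TotalSpace (Eu m) E)]
  [∀ x, AddCommGroup (E x)] [∀ x, Module ℝ (E x)] [∀ x, TopologicalSpace (E x)]
  [FiberBundle (Eu m) E] [VectorBundle ℝ (Eu m) E] [ContMDiffVectorBundle ∞ (Eu m) E (𝓡 n)]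

namespace LocalFrame

variable (c : LocalFrame n m M E)

/-- The isomorphism of the fibre of `E` with `ℝ^m` given by the frame. -/
def fibreEquiv {x : M} (hx : x ∈ c.W) : E x ≃ₗ[ℝ] (Fin m → ℝ) :=
  (c.isFrame.toBasisAt hx).equivFun

theorem coeff_eq {x : M} (hx : x ∈ c.W) (a : E x) (α : Fin m) :
    c.isFrame.coeff α x a = c.fibreEquiv hx a α := by
  simp [fibreEquiv, IsLocalFrameOn.coeff, hx]

theorem sum_coeff {x : M} (hx : x ∈ c.W) (a : E x) :
    ∑ α, c.isFrame.coeff α x a • c.s α x = a := by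
  have h := (c.isFrame.toBasisAt hx).sum_equivFun a
  simp only [IsLocalFrameOn.toBasisAt_coe] at h
  simp only [coeff_eq c hx]
  exact h

theorem coeff_frame {x : M} (hx : x ∈ c.W) (α β : Fin m) :
    c.isFrame.coeff α x (c.s β x) = if α = β then 1 else 0 := by
  rw [coeff_eq c hx, fibreEquiv, ← c.isFrame.toBasisAt_coe hx, Module.Basis.equivFun_self]
  simp [eq_comm]

theorem coeff_sum {x : M} (hx : x ∈ c.W) (a : Fin m → ℝ) (α : Fin m) :
    c.isFrame.coeff α x (∑ β, a β • c.s β x) = a α := by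
  simp [coeff_frame c hx]

theorem ext_coeff {x : M} (hx : x ∈ c.W) {a b : E x}
    (h : ∀ α, c.isFrame.coeff α x a = c.isFrame.coeff α x b) : a = b := by
  rw [← sum_coeff c hx a, ← sum_coeff c hx b]
  simp only [h]

/-- The coefficients in the frame are given by a smooth matrix in a trivialization. -/
theorem exists_coeff_matrix {x : M} (hx : x ∈ c.W) :
    ∃ R : M → (Eu m →L[ℝ] (Fin m → ℝ)),
      ContMDiffAt (𝓡 n) 𝓘(ℝ, Eu m →L[ℝ] (Fin m → ℝ)) ∞ R x ∧
      ∀ y ∈ c.W, y ∈ (trivializationAt (Eu m) E x).baseSet → ∀ (a : E y) (α : Fin m),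
        c.isFrame.coeff α y a = R y ((trivializationAt (Eu m) E x) ⟨y, a⟩).2 α := by
  set T := trivializationAt (Eu m) E x with hT
  -- `S y` assembles a vector from its frame coefficients and reads it in the trivialization, so it
  -- is smooth in `y`. The wanted matrix is its inverse, and inversion is smooth at invertible maps.
  let S : M → ((Fin m → ℝ) →L[ℝ] Eu m) := fun y =>
    ∑ α, (ContinuousLinearMap.proj (R := ℝ) (φ := fun _ : Fin m => ℝ) α).smulRight
      (T ⟨y, c.s α y⟩).2
  have hS : ∀ y (hy : y ∈ c.W) (hyT : y ∈ T.baseSet), S y =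
      (((c.fibreEquiv hy).symm.trans (T.linearEquivAt ℝ y hyT)).toContinuousLinearEquiv :
        (Fin m → ℝ) →L[ℝ] Eu m) := by
    intro y hy hyT
    ext1 μ
    have : (c.fibreEquiv hy).symm μ = ∑ α, μ α • c.s α y := by
      rw [fibreEquiv, Module.Basis.equivFun_symm_apply]
      simp only [IsLocalFrameOn.toBasisAt_coe]
    simp [S, this, map_sum]
  have hxT : x ∈ T.baseSet := FiberBundle.mem_baseSet_trivializationAt' x
  have hSs : ContMDiffAt (𝓡 n) 𝓘(ℝ, (Fin m → ℝ) →L[ℝ] Eu m) ∞ S x := by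
    refine ContMDiffAt.sum fun α _ => ?_
    have h1 : ContMDiffAt (𝓡 n) 𝓘(ℝ, Eu m) ∞ (fun y => (T ⟨y, c.s α y⟩).2) x :=
      ((contMDiffAt_totalSpace).1 ((c.s α).contMDiff.contMDiffAt (x := x))).2
    exact ((ContinuousLinearMap.smulRightL ℝ (Fin m → ℝ) (Eu m)
      (ContinuousLinearMap.proj α)).contDiff.contMDiff.contMDiffAt).comp x h1
  refine ⟨fun y => (S y).inverse, ?_, ?_⟩
  · have h2 := contDiffAt_map_inverse (n := ∞) (𝕜 := ℝ)
      (((c.fibreEquiv hx).symm.trans (T.linearEquivAt ℝ x hxT)).toContinuousLinearEquiv)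
    rw [← hS x hx hxT] at h2
    exact h2.contMDiffAt.comp x hSs
  · intro y hy hyT a α
    change _ = (S y).inverse _ α
    rw [coeff_eq c hy, hS y hy hyT, ContinuousLinearMap.inverse_equiv]
    have h3 : (T ⟨y, a⟩).2 = ((c.fibreEquiv hy).symm.trans (T.linearEquivAt ℝ y hyT))
        (c.fibreEquiv hy a) := by simp
    rw [h3]
    exact congrFun (((c.fibreEquiv hy).symm.trans
      (T.linearEquivAt ℝ y hyT)).symm_apply_apply (c.fibreEquiv hy a)).symm α

theorem contMDiffAt_coeff {B : Type*} [NormedAddCommGroup B] [NormedSpace ℝ B] {G : Type*}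
    [TopologicalSpace G] {I : ModelWithCorners ℝ B G} {X : Type*} [TopologicalSpace X]
    [ChartedSpace G X] {b : X → M} {a : ∀ x, E (b x)} {x₀ : X} (hx : b x₀ ∈ c.W)
    (ha : ContMDiffAt I ((𝓡 n).prod 𝓘(ℝ, Eu m)) ∞
      (fun x => (⟨b x, a x⟩ : TotalSpace (Eu m) E)) x₀) (α : Fin m) :
    ContMDiffAt I 𝓘(ℝ, ℝ) ∞ (fun x => c.isFrame.coeff α (b x) (a x)) x₀ := by
  obtain ⟨R, hR, hRc⟩ := c.exists_coeff_matrix hx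
  obtain ⟨hb, ha'⟩ := contMDiffAt_totalSpace.1 ha
  have h1 : ContMDiffAt I 𝓘(ℝ, Fin m → ℝ) ∞
      (fun x => R (b x) ((trivializationAt (Eu m) E (b x₀)) ⟨b x, a x⟩).2) x₀ :=
    (hR.comp x₀ hb).clm_apply ha'
  have h2 := (contMDiffAt_pi_space.1 h1) α
  refine h2.congr_of_eventuallyEq ?_
  have hc := hb.continuousAt
  filter_upwards [hc.eventually (c.isOpen_W.mem_nhds hx), hc.eventually
    ((trivializationAt (Eu m) E (b x₀)).open_baseSet.mem_nhds
      (FiberBundle.mem_baseSet_trivializationAt' (b x₀)))] with x hx1 hx2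
  exact hRc _ hx1 hx2 _ _

/-- A map into `E` with smooth coefficients is smooth. -/
theorem contMDiffAt_sum_smul {B : Type*} [NormedAddCommGroup B] [NormedSpace ℝ B] {G : Type*}
    [TopologicalSpace G] {I : ModelWithCorners ℝ B G} {X : Type*} [TopologicalSpace X]
    [ChartedSpace G X] {b : X → M} {a : ∀ x, E (b x)} {x₀ : X}
    (hx : b x₀ ∈ c.W) (hb : ContMDiffAt I (𝓡 n) ∞ b x₀)
    (ha : ∀ α, ContMDiffAt I 𝓘(ℝ, ℝ) ∞ (fun x => c.isFrame.coeff α (b x) (a x)) x₀) :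
    ContMDiffAt I ((𝓡 n).prod 𝓘(ℝ, Eu m)) ∞
      (fun x => (⟨b x, a x⟩ : TotalSpace (Eu m) E)) x₀ := by
  refine contMDiffAt_totalSpace.2 ⟨hb, ?_⟩
  have h1 : ∀ α, ContMDiffAt I 𝓘(ℝ, Eu m) ∞
      (fun x => ((trivializationAt (Eu m) E (b x₀)) ⟨b x, c.s α (b x)⟩).2) x₀ := fun α =>
    ((contMDiffAt_totalSpace).1 ((c.s α).contMDiff.contMDiffAt (x := b x₀))).2.comp x₀ hb
  have h2 : ContMDiffAt I 𝓘(ℝ, Eu m) ∞ (fun x => ∑ α, c.isFrame.coeff α (b x) (a x) •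
      ((trivializationAt (Eu m) E (b x₀)) ⟨b x, c.s α (b x)⟩).2) x₀ :=
    ContMDiffAt.sum fun α _ => (ha α).smul (h1 α)
  refine h2.congr_of_eventuallyEq ?_
  have hc := hb.continuousAt
  filter_upwards [hc.eventually (c.isOpen_W.mem_nhds hx), hc.eventually
    ((trivializationAt (Eu m) E (b x₀)).open_baseSet.mem_nhds
      (FiberBundle.mem_baseSet_trivializationAt' (b x₀)))] with x hx1 hx2
  have h3 : ∀ e : E (b x), ((trivializationAt (Eu m) E (b x₀)) ⟨b x, e⟩).2 =
      (trivializationAt (Eu m) E (b x₀)).linearEquivAt ℝ (b x) hx2 e := fun e => rfl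
  simp only [h3, ← map_smul, ← map_sum]
  rw [c.sum_coeff hx1]

end LocalFrame

/-- Linear forms on the fibres of a vector bundle of finite rank are continuous. -/
theorem continuous_linearForm {M : Type*} [TopologicalSpace M] (F : Type*)
    [NormedAddCommGroup F] [NormedSpace ℝ F] [FiniteDimensional ℝ F] {E : M → Type*}
    [TopologicalSpace (TotalSpace F E)] [∀ x, AddCommGroup (E x)] [∀ x, Module ℝ (E x)]
    [∀ x, TopologicalSpace (E x)] [FiberBundle F E] [VectorBundle ℝ F E] {x : M} (f : E x →ₗ[ℝ] ℝ) : Continuous f := by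
  set T := trivializationAt F E x
  have hx : x ∈ T.baseSet := FiberBundle.mem_baseSet_trivializationAt' x
  have h1 : Continuous (f ∘ₗ (T.linearEquivAt ℝ x hx).symm.toLinearMap) :=
    LinearMap.continuous_of_finiteDimensional _
  have h2 : (f : E x → ℝ) = (f ∘ₗ (T.linearEquivAt ℝ x hx).symm.toLinearMap) ∘
      (T.continuousLinearEquivAt ℝ x hx) := by
    funext e
    change f e = f ((T.linearEquivAt ℝ x hx).symm (T.linearEquivAt ℝ x hx e))
    rw [LinearEquiv.symm_apply_apply]
  rw [h2]
  exact h1.comp (T.continuousLinearEquivAt ℝ x hx).continuous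

namespace LocalFrame

variable (c : LocalFrame n m M E)

/-- The covector whose value on the frame section `s_α` is `μ_α`. -/
def dualCovec (x : M) (μ : Fin m → ℝ) : E x →L[ℝ] Bundle.Trivial M ℝ x :=
  ⟨∑ α, μ α • c.isFrame.coeff α x, continuous_linearForm (Eu m) _⟩

theorem dualCovec_apply (x : M) (μ : Fin m → ℝ) (a : E x) :
    c.dualCovec x μ a = ∑ α, μ α * c.isFrame.coeff α x a := by
  change (∑ α, μ α • c.isFrame.coeff α x) a = _
  simp

theorem dualCovec_frame {x : M} (hx : x ∈ c.W) (μ : Fin m → ℝ) (α : Fin m) :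
    c.dualCovec x μ (c.s α x) = μ α := by
  rw [dualCovec_apply]
  simp [c.coeff_frame hx]

theorem covec_ext {x : M} (hx : x ∈ c.W) {φ ψ : E x →L[ℝ] Bundle.Trivial M ℝ x}
    (h : ∀ α, φ (c.s α x) = ψ (c.s α x)) : φ = ψ := by
  ext a
  rw [← c.sum_coeff hx a]
  simp only [map_sum, map_smul, h]

/-- The ε-choice in `point` is forced: `dualCovec` is a witness, and a covector is determined by its
values on the frame. -/
theorem point_eq {q : Eu n} (hq : c.chart.symm q ∈ c.W) (μ : Fin m → ℝ) :
    c.point q μ = ⟨c.chart.symm q, c.dualCovec _ μ⟩ := by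
  unfold point
  congr 1
  have h := Classical.epsilon_spec (p := fun φ : E (c.chart.symm q) →L[ℝ]
      Bundle.Trivial M ℝ (c.chart.symm q) => ∀ α, φ (c.s α (c.chart.symm q)) = μ α)
    ⟨_, c.dualCovec_frame hq μ⟩
  refine c.covec_ext hq fun α => ?_
  rw [h α, c.dualCovec_frame hq]

/-- The part of `E*` covered by the local coordinates. -/
def dom : Set (DualTotal m E) := {u | u.proj ∈ c.W}

/-- The range of the local coordinates. -/
def ran : Set (Eu n × (Fin m → ℝ)) := {p | p.1 ∈ c.chart.target ∧ c.chart.symm p.1 ∈ c.W}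

/-- The coordinate map `u ↦ (q, μ)`. -/
def coord (u : DualTotal m E) : Eu n × (Fin m → ℝ) := (c.qCoord u, c.muCoord u)

/-- The inverse of the coordinate map. -/
def param (p : Eu n × (Fin m → ℝ)) : DualTotal m E := c.point p.1 p.2

theorem isOpen_dom : IsOpen c.dom :=
  c.isOpen_W.preimage (FiberBundle.continuous_proj (Eu m →L[ℝ] ℝ) _)

theorem isOpen_ran : IsOpen c.ran := by
  have h : IsOpen (c.chart.target ∩ c.chart.symm ⁻¹' c.W) :=
    c.chart.isOpen_inter_preimage_symm c.isOpen_W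
  exact h.preimage continuous_fst

theorem coord_mem_ran {u : DualTotal m E} (hu : u ∈ c.dom) : c.coord u ∈ c.ran := by
  have h := c.W_subset hu
  refine ⟨c.chart.map_source h, ?_⟩
  change c.chart.symm (c.chart u.proj) ∈ c.W
  rw [c.chart.left_inv h]
  exact hu

theorem param_mem_dom {p : Eu n × (Fin m → ℝ)} (hp : p ∈ c.ran) : c.param p ∈ c.dom := hp.2

theorem coord_param {p : Eu n × (Fin m → ℝ)} (hp : p ∈ c.ran) : c.coord (c.param p) = p := by
  refine Prod.ext ?_ ?_
  · exact c.chart.right_inv hp.1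
  · funext α
    change c.muCoord (c.point p.1 p.2) α = p.2 α
    rw [c.point_eq hp.2]
    exact c.dualCovec_frame hp.2 p.2 α

theorem ext_coord {u v : DualTotal m E} (hu : u ∈ c.dom) (hv : v ∈ c.dom)
    (h : c.coord u = c.coord v) : u = v := by
  obtain ⟨x, φ⟩ := u
  obtain ⟨y, ψ⟩ := v
  have hxy : x = y := c.chart.injOn (c.W_subset hu) (c.W_subset hv) (congrArg Prod.fst h)
  subst hxy
  congr 1
  exact c.covec_ext hu fun α => congrFun (congrArg Prod.snd h) α

theorem param_coord {u : DualTotal m E} (hu : u ∈ c.dom) : c.param (c.coord u) = u :=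
  c.ext_coord (c.param_mem_dom (c.coord_mem_ran hu)) hu (c.coord_param (c.coord_mem_ran hu))

theorem contMDiffAt_proj (u : DualTotal m E) :
    ContMDiffAt (dualModel n m) (𝓡 n) ∞ (fun w : DualTotal m E => w.proj) u :=
  (Bundle.contMDiff_proj _).contMDiffAt

theorem contMDiffAt_chart {x : M} (hx : x ∈ c.W) :
    ContMDiffAt (𝓡 n) 𝓘(ℝ, Eu n) ∞ c.chart x :=
  (contMDiffOn_of_mem_maximalAtlas c.chart_mem).contMDiffAt
    (c.chart.open_source.mem_nhds (c.W_subset hx))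

theorem contMDiffAt_qCoord {u : DualTotal m E} (hu : u ∈ c.dom) :
    ContMDiffAt (dualModel n m) 𝓘(ℝ, Eu n) ∞ c.qCoord u :=
  (c.contMDiffAt_chart hu).comp u (contMDiffAt_proj u)

theorem contMDiffAt_muCoord (u : DualTotal m E) (α : Fin m) :
    ContMDiffAt (dualModel n m) 𝓘(ℝ, ℝ) ∞ (fun w => c.muCoord w α) u := by
  have h1 : ContMDiffAt (dualModel n m) ((𝓡 n).prod 𝓘(ℝ, Eu m)) ∞
      (fun w : DualTotal m E => (⟨w.proj, c.s α w.proj⟩ : TotalSpace (Eu m) E)) u :=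
    (c.s α).contMDiff.contMDiffAt.comp u (contMDiffAt_proj u)
  have h2 := ContMDiffAt.clm_bundle_apply (F₁ := Eu m) (F₂ := ℝ) (E₁ := E)
    (E₂ := Bundle.Trivial M ℝ) (b := fun w : DualTotal m E => w.proj) (ϕ := fun w => w.snd)
    (v := fun w => c.s α w.proj) (x := u) (n := ∞) (IM := dualModel n m) (IB := 𝓡 n)
    contMDiffAt_id h1
  exact (contMDiffAt_totalSpace.1 h2).2

theorem contMDiffAt_coord {u : DualTotal m E} (hu : u ∈ c.dom) :
    ContMDiffAt (dualModel n m) 𝓘(ℝ, Eu n × (Fin m → ℝ)) ∞ c.coord u :=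
  (c.contMDiffAt_qCoord hu).prodMk_space
    (contMDiffAt_pi_space.2 fun α => c.contMDiffAt_muCoord u α)

/-- Read in the trivialization, `dualCovec` is the row `μ` composed with the smooth coefficient
matrix of `exists_coeff_matrix`. -/
theorem contMDiffAt_param {p : Eu n × (Fin m → ℝ)} (hp : p ∈ c.ran) :
    ContMDiffAt 𝓘(ℝ, Eu n × (Fin m → ℝ)) (dualModel n m) ∞ c.param p := by
  have hq : ContMDiffAt 𝓘(ℝ, Eu n × (Fin m → ℝ)) (𝓡 n) ∞
      (fun r : Eu n × (Fin m → ℝ) => c.chart.symm r.1) p :=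
    ((contMDiffOn_symm_of_mem_maximalAtlas c.chart_mem).contMDiffAt
      (c.chart.open_target.mem_nhds hp.1)).comp p contDiff_fst.contMDiff.contMDiffAt
  rw [contMDiffAt_hom_bundle]
  refine ⟨hq, ?_⟩
  obtain ⟨R, hR, hRc⟩ := c.exists_coeff_matrix hp.2
  have hx : (c.param p).proj = c.chart.symm p.1 := rfl
  rw [hx]
  have h1 : ContMDiffAt 𝓘(ℝ, Eu n × (Fin m → ℝ)) 𝓘(ℝ, Eu m →L[ℝ] ℝ) ∞
      (fun r : Eu n × (Fin m → ℝ) => (∑ α, r.2 α • ContinuousLinearMap.proj (R := ℝ)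
        (φ := fun _ : Fin m => ℝ) α).comp (R (c.chart.symm r.1))) p := by
    refine ContMDiffAt.clm_comp ?_ (hR.comp p hq)
    have h2 : ContDiff ℝ ∞ (fun r : Eu n × (Fin m → ℝ) => ∑ α, r.2 α •
      ContinuousLinearMap.proj (R := ℝ) (φ := fun _ : Fin m => ℝ) α) := by fun_prop
    exact h2.contMDiff.contMDiffAt
  refine h1.congr_of_eventuallyEq ?_
  have hb := (trivializationAt (Eu m) E (c.chart.symm p.1)).open_baseSet.mem_nhds
    (FiberBundle.mem_baseSet_trivializationAt' (c.chart.symm p.1))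
  filter_upwards [c.isOpen_ran.mem_nhds hp, hq.continuousAt.eventually hb] with r hr hrb
  ext e
  have hpar : c.param r = ⟨c.chart.symm r.1, c.dualCovec _ r.2⟩ := c.point_eq hr.2 r.2
  rw [hpar]
  change ContinuousLinearMap.inCoordinates (Eu m) E ℝ (Trivial M ℝ) (c.chart.symm p.1)
    (c.chart.symm r.1) (c.chart.symm p.1) (c.chart.symm r.1) (c.dualCovec _ r.2) e = _
  rw [ContinuousLinearMap.inCoordinates_eq hrb (by trivial)]
  change c.dualCovec (c.chart.symm r.1) r.2
    ((trivializationAt (Eu m) E (c.chart.symm p.1)).symm (c.chart.symm r.1) e) = _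
  rw [c.dualCovec_apply]
  simp only [hRc _ hr.2 hrb]
  rw [Trivialization.apply_mk_symm _ hrb]
  simp

end LocalFrame
end Frames

/-! ### Partial derivatives and components of tangent vectors of `E*`. -/

section Coordinates

variable {n m : ℕ} {M : Type*} [TopologicalSpace M] [ChartedSpace (Eu n) M]
  [IsManifold (𝓡 n) ∞ M] {E : M → Type*} [TopologicalSpace (TotalSpace (Eu m) E)]
  [∀ x, AddCommGroup (E x)] [∀ x, Module ℝ (E x)] [∀ x, TopologicalSpace (E x)]
  [FiberBundle (Eu m) E] [VectorBundle ℝ (Eu m) E] [ContMDiffVectorBundle ∞ (Eu m) E (𝓡 n)]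

namespace LocalFrame

theorem hasDerivAt_line {V : Type*} [NormedAddCommGroup V] [NormedSpace ℝ V] (p v : V) :
    HasDerivAt (fun t : ℝ => p + t • v) v 0 := by
  simpa using ((hasDerivAt_id (0 : ℝ)).smul_const v).const_add p

theorem deriv_line {V : Type*} [NormedAddCommGroup V] [NormedSpace ℝ V] {F : V → ℝ} {p : V}
    (hF : DifferentiableAt ℝ F p) (v : V) :
    deriv (fun t : ℝ => F (p + t • v)) 0 = fderiv ℝ F p v := by
  have h1 : HasFDerivAt F (fderiv ℝ F p) (p + (0 : ℝ) • v) := by simpa using hF.hasFDerivAt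
  exact (h1.comp_hasDerivAt (0 : ℝ) (hasDerivAt_line p v)).deriv

theorem pdq_eq_fderiv {f : Eu n → (Fin m → ℝ) → ℝ} {p : Eu n × (Fin m → ℝ)}
    (hf : DifferentiableAt ℝ (fun r : Eu n × (Fin m → ℝ) => f r.1 r.2) p) (i : Fin n) :
    pdq i f p.1 p.2 = fderiv ℝ (fun r : Eu n × (Fin m → ℝ) => f r.1 r.2) p
      (EuclideanSpace.single i (1 : ℝ), 0) := by
  rw [← deriv_line hf, pdq]
  simp

theorem pdmu_eq_fderiv {f : Eu n → (Fin m → ℝ) → ℝ} {p : Eu n × (Fin m → ℝ)}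
    (hf : DifferentiableAt ℝ (fun r : Eu n × (Fin m → ℝ) => f r.1 r.2) p) (α : Fin m) :
    pdmu α f p.1 p.2 = fderiv ℝ (fun r : Eu n × (Fin m → ℝ) => f r.1 r.2) p
      (0, Pi.single α (1 : ℝ)) := by
  rw [← deriv_line hf, pdmu]
  simp

theorem fderiv_eq_sum {f : Eu n → (Fin m → ℝ) → ℝ} {p : Eu n × (Fin m → ℝ)}
    (hf : DifferentiableAt ℝ (fun r : Eu n × (Fin m → ℝ) => f r.1 r.2) p)
    (v : Eu n × (Fin m → ℝ)) :
    fderiv ℝ (fun r : Eu n × (Fin m → ℝ) => f r.1 r.2) p v =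
      ∑ i, v.1 i * pdq i f p.1 p.2 + ∑ α, v.2 α * pdmu α f p.1 p.2 := by
  have h1 : v = ∑ i, v.1 i • ((EuclideanSpace.single i (1 : ℝ), 0) : Eu n × (Fin m → ℝ)) +
      ∑ α, v.2 α • ((0, Pi.single α (1 : ℝ)) : Eu n × (Fin m → ℝ)) := by
    refine Prod.ext ?_ ?_
    · ext j
      simp [Prod.fst_sum, Pi.single_apply]
    · ext j
      simp [Prod.snd_sum, Pi.single_apply]
  conv_lhs => rw [h1]
  simp only [map_add, map_sum, map_smul, pdq_eq_fderiv hf, pdmu_eq_fderiv hf, smul_eq_mul]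

variable (c : LocalFrame n m M E)

/-- The components of a tangent vector in the local coordinates. -/
def coordDeriv (u : DualTotal m E) (v : TangentSpace (dualModel n m) u) :
    Eu n × (Fin m → ℝ) :=
  mfderiv (dualModel n m) 𝓘(ℝ, Eu n × (Fin m → ℝ)) c.coord u v

/-- The tangent vector with given components in the local coordinates. -/
def tangentOf (p : Eu n × (Fin m → ℝ)) (v : Eu n × (Fin m → ℝ)) :
    TangentSpace (dualModel n m) (c.param p) :=
  mfderiv 𝓘(ℝ, Eu n × (Fin m → ℝ)) (dualModel n m) c.param p v

theorem coordDeriv_tangentOf {p : Eu n × (Fin m → ℝ)} (hp : p ∈ c.ran)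
    (v : Eu n × (Fin m → ℝ)) : c.coordDeriv (c.param p) (c.tangentOf p v) = v := by
  have h1 : c.coord ∘ c.param =ᶠ[𝓝 p] id := by
    filter_upwards [c.isOpen_ran.mem_nhds hp] with r hr
    exact c.coord_param hr
  have h2 := mfderiv_comp p
    ((c.contMDiffAt_coord (c.param_mem_dom hp)).mdifferentiableAt (by simp))
    ((c.contMDiffAt_param hp).mdifferentiableAt (by simp))
  rw [h1.mfderiv_eq] at h2
  have h3 := DFunLike.congr_fun h2 v
  refine Eq.trans h3.symm ?_
  rw [mfderiv_id]
  rfl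

/-- The equality is heterogeneous because `c.param (c.coord u)` equals `u` only propositionally, so
the two vectors lie in formally different tangent spaces. -/
theorem mfderiv_param_coordDeriv {u : DualTotal m E} (hu : u ∈ c.dom)
    (v : TangentSpace (dualModel n m) u) :
    HEq (c.tangentOf (c.coord u) (c.coordDeriv u v)) v := by
  have h1 : c.param ∘ c.coord =ᶠ[𝓝 u] id := by
    filter_upwards [c.isOpen_dom.mem_nhds hu] with r hr
    exact c.param_coord hr
  have h2 := mfderiv_comp u
    ((c.contMDiffAt_param (c.coord_mem_ran hu)).mdifferentiableAt (by simp))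
    ((c.contMDiffAt_coord hu).mdifferentiableAt (by simp))
  rw [h1.mfderiv_eq] at h2
  have h3 := DFunLike.congr_fun h2 v
  refine HEq.trans (heq_of_eq h3.symm) ?_
  rw [mfderiv_id]
  rfl

theorem coordDeriv_injective {u : DualTotal m E} (hu : u ∈ c.dom)
    {v w : TangentSpace (dualModel n m) u} (h : c.coordDeriv u v = c.coordDeriv u w) : v = w := by
  have h1 := c.mfderiv_param_coordDeriv hu v
  rw [h] at h1
  exact eq_of_heq (h1.symm.trans (c.mfderiv_param_coordDeriv hu w))

theorem coordDeriv_fst {u : DualTotal m E} (hu : u ∈ c.dom)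
    (v : TangentSpace (dualModel n m) u) (i : Fin n) :
    (c.coordDeriv u v).1 i = dirDeriv (dualModel n m) (fun w => c.qCoord w i) u v := by
  let L : (Eu n × (Fin m → ℝ)) →L[ℝ] ℝ :=
    (EuclideanSpace.proj i : Eu n →L[ℝ] ℝ).comp (ContinuousLinearMap.fst ℝ (Eu n) (Fin m → ℝ))
  have h2 := mfderiv_comp (I' := 𝓘(ℝ, Eu n × (Fin m → ℝ))) (I'' := 𝓘(ℝ, ℝ)) (g := L) u
    (L.differentiableAt.mdifferentiableAt) ((c.contMDiffAt_coord hu).mdifferentiableAt (by simp))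
  rw [mfderiv_eq_fderiv, L.fderiv] at h2
  exact (DFunLike.congr_fun h2 v).symm

theorem coordDeriv_snd {u : DualTotal m E} (hu : u ∈ c.dom)
    (v : TangentSpace (dualModel n m) u) (α : Fin m) :
    (c.coordDeriv u v).2 α = dirDeriv (dualModel n m) (fun w => c.muCoord w α) u v := by
  let L : (Eu n × (Fin m → ℝ)) →L[ℝ] ℝ :=
    (ContinuousLinearMap.proj (R := ℝ) (φ := fun _ : Fin m => ℝ) α).comp
      (ContinuousLinearMap.snd ℝ (Eu n) (Fin m → ℝ))
  have h2 := mfderiv_comp (I' := 𝓘(ℝ, Eu n × (Fin m → ℝ))) (I'' := 𝓘(ℝ, ℝ)) (g := L) u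
    (L.differentiableAt.mdifferentiableAt) ((c.contMDiffAt_coord hu).mdifferentiableAt (by simp))
  rw [mfderiv_eq_fderiv, L.fderiv] at h2
  exact (DFunLike.congr_fun h2 v).symm

/-- A function on `E*` that is smooth at `u` is smooth in the coordinates. -/
theorem contDiffAt_comp_param {f : DualTotal m E → ℝ} {u : DualTotal m E} (hu : u ∈ c.dom)
    (hf : ContMDiffAt (dualModel n m) 𝓘(ℝ, ℝ) ∞ f u) :
    ContDiffAt ℝ ∞ (fun p => f (c.param p)) (c.coord u) := by
  rw [← contMDiffAt_iff_contDiffAt]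
  exact ContMDiffAt.comp _ (by rwa [c.param_coord hu]) (c.contMDiffAt_param (c.coord_mem_ran hu))

/-- The derivative of a function given in coordinates. -/
theorem dirDeriv_comp_coord {f : Eu n → (Fin m → ℝ) → ℝ} {u : DualTotal m E} (hu : u ∈ c.dom)
    (hf : DifferentiableAt ℝ (fun r : Eu n × (Fin m → ℝ) => f r.1 r.2) (c.coord u))
    (v : TangentSpace (dualModel n m) u) :
    dirDeriv (dualModel n m) (fun w => f (c.qCoord w) (c.muCoord w)) u v =
      ∑ i, (c.coordDeriv u v).1 i * pdq i f (c.qCoord u) (c.muCoord u)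
        + ∑ α, (c.coordDeriv u v).2 α * pdmu α f (c.qCoord u) (c.muCoord u) := by
  have h2 := mfderiv_comp (I' := 𝓘(ℝ, Eu n × (Fin m → ℝ))) (I'' := 𝓘(ℝ, ℝ)) u
    hf.mdifferentiableAt ((c.contMDiffAt_coord hu).mdifferentiableAt (by simp))
  rw [mfderiv_eq_fderiv] at h2
  refine Eq.trans (DFunLike.congr_fun h2 v) ?_
  exact fderiv_eq_sum hf (c.coordDeriv u v)

/-- The derivative of a function on `E*` in coordinates. -/
theorem dirDeriv_eq_sum {f : DualTotal m E → ℝ} {u : DualTotal m E} (hu : u ∈ c.dom)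
    (hf : ContMDiffAt (dualModel n m) 𝓘(ℝ, ℝ) ∞ f u)
    (v : TangentSpace (dualModel n m) u) :
    dirDeriv (dualModel n m) f u v =
      ∑ i, (c.coordDeriv u v).1 i * pdq i (c.ham f) (c.qCoord u) (c.muCoord u)
        + ∑ α, (c.coordDeriv u v).2 α * pdmu α (c.ham f) (c.qCoord u) (c.muCoord u) := by
  rw [← c.dirDeriv_comp_coord hu ((c.contDiffAt_comp_param hu hf).differentiableAt (by simp))]
  refine dirDeriv_congr ?_ v
  filter_upwards [c.isOpen_dom.mem_nhds hu] with w hw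
  change f w = f (c.param (c.coord w))
  rw [c.param_coord hw]

end LocalFrame
end Coordinates

/-! ### Coordinates and smoothness on the prolongation. -/

section ProlongCoordinates

variable {n m : ℕ} {M : Type*} [TopologicalSpace M] [ChartedSpace (Eu n) M]
  [IsManifold (𝓡 n) ∞ M] {E : M → Type*} [TopologicalSpace (TotalSpace (Eu m) E)]
  [∀ x, AddCommGroup (E x)] [∀ x, Module ℝ (E x)] [∀ x, TopologicalSpace (E x)]
  [FiberBundle (Eu m) E] [VectorBundle ℝ (Eu m) E] [ContMDiffVectorBundle ∞ (Eu m) E (𝓡 n)]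

/-- Smoothness of a section of `𝒯E*` at a point. -/
def SmoothProlongAt (A : LieAlgebroid n m M E) (ρ : ∀ u, Prolong A u) (u : DualTotal m E) : Prop :=
  ContMDiffAt (dualModel n m) ((𝓡 n).prod 𝓘(ℝ, Eu m)) ∞
      (fun w => (⟨w.proj, (ρ w).1.1⟩ : TotalSpace (Eu m) E)) u ∧
    ContMDiffAt (dualModel n m) (dualModel n m).tangent ∞
      (fun w => (⟨w, (ρ w).1.2⟩ : TangentBundle (dualModel n m) (DualTotal m E))) u

theorem smoothProlong_iff {A : LieAlgebroid n m M E} {Ω : Set (DualTotal m E)} (hΩ : IsOpen Ω)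
    {ρ : ∀ u, Prolong A u} : SmoothProlong A Ω ρ ↔ ∀ u ∈ Ω, SmoothProlongAt A ρ u :=
  ⟨fun h _ hu => ⟨h.1.contMDiffAt (hΩ.mem_nhds hu), h.2.contMDiffAt (hΩ.mem_nhds hu)⟩,
    fun h => ⟨fun u hu => (h u hu).1.contMDiffWithinAt, fun u hu => (h u hu).2.contMDiffWithinAt⟩⟩

theorem SmoothProlong.at {A : LieAlgebroid n m M E} {Ω : Set (DualTotal m E)} (hΩ : IsOpen Ω)
    {ρ : ∀ u, Prolong A u} (h : SmoothProlong A Ω ρ) {u : DualTotal m E} (hu : u ∈ Ω) :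
    SmoothProlongAt A ρ u := (smoothProlong_iff hΩ).1 h u hu

namespace LocalFrame

variable (c : LocalFrame n m M E)

/-- Common source of the components of `partialQ`, `partialMu` and `vertLift`: each is the velocity
of a curve that is a straight line in coordinates. -/
theorem coordDeriv_curve {γ : ℝ → DualTotal m E} (h0 : γ 0 ∈ c.dom) (v : Eu n × (Fin m → ℝ))
    (hγ : ∀ᶠ t in 𝓝 (0 : ℝ), γ t = c.param (c.coord (γ 0) + t • v)) :
    c.coordDeriv (γ 0) (mfderiv 𝓘(ℝ, ℝ) (dualModel n m) γ 0 (1 : ℝ)) = v := by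
  have hline : Differentiable ℝ (fun t : ℝ => c.coord (γ 0) + t • v) := by fun_prop
  have h1 : MDifferentiableAt 𝓘(ℝ, ℝ) (dualModel n m)
      (fun t : ℝ => c.param (c.coord (γ 0) + t • v)) 0 := by
    have hp : c.coord (γ 0) + (0 : ℝ) • v ∈ c.ran := by simpa using c.coord_mem_ran h0
    exact MDifferentiableAt.comp (I' := 𝓘(ℝ, Eu n × (Fin m → ℝ))) (g := c.param) (0 : ℝ)
      ((c.contMDiffAt_param hp).mdifferentiableAt (by simp)) (hline 0).mdifferentiableAt
  have hγd : MDifferentiableAt 𝓘(ℝ, ℝ) (dualModel n m) γ 0 := h1.congr_of_eventuallyEq hγ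
  have h2 := mfderiv_comp (I' := dualModel n m) (I'' := 𝓘(ℝ, Eu n × (Fin m → ℝ))) (0 : ℝ)
    ((c.contMDiffAt_coord h0).mdifferentiableAt (by simp)) hγd
  have h3 : c.coord ∘ γ =ᶠ[𝓝 0] fun t : ℝ => c.coord (γ 0) + t • v := by
    have h4 : ∀ᶠ t in 𝓝 (0 : ℝ), c.coord (γ 0) + t • v ∈ c.ran := by
      refine hline.continuous.continuousAt.eventually (c.isOpen_ran.mem_nhds ?_)
      simpa using c.coord_mem_ran h0
    filter_upwards [hγ, h4] with t ht ht4
    rw [Function.comp_apply, ht, c.coord_param ht4]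
  rw [h3.mfderiv_eq, mfderiv_eq_fderiv] at h2
  refine Eq.trans (DFunLike.congr_fun h2 (1 : ℝ)).symm ?_
  change fderiv ℝ (fun t : ℝ => c.coord (γ 0) + t • v) 0 1 = v
  rw [fderiv_apply_one_eq_deriv]
  exact (hasDerivAt_line _ v).deriv

theorem coordDeriv_partialQ {u : DualTotal m E} (hu : u ∈ c.dom) (i : Fin n) :
    c.coordDeriv u (c.partialQ i u) = (EuclideanSpace.single i (1 : ℝ), 0) := by
  set γ : ℝ → DualTotal m E := fun t : ℝ =>
    c.point (c.qCoord u + t • EuclideanSpace.single i (1 : ℝ)) (c.muCoord u) with hγ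
  have h0 : γ 0 = u := by
    simp only [hγ, zero_smul, add_zero]
    exact c.param_coord hu
  have h1 := c.coordDeriv_curve (γ := γ) (h0 ▸ hu) (EuclideanSpace.single i (1 : ℝ), 0)
    (Filter.Eventually.of_forall fun t => by
      rw [h0]; simp [hγ, param, coord])
  -- The velocity is a tangent vector at `γ 0`, which is only propositionally `u`; generalizing the
  -- endpoint allows the transport.
  have h2 : ∀ w, γ 0 = w → c.coordDeriv (γ 0) (mfderiv 𝓘(ℝ, ℝ) (dualModel n m) γ 0 (1 : ℝ)) =
      c.coordDeriv w (mfderiv 𝓘(ℝ, ℝ) (dualModel n m) γ 0 (1 : ℝ)) := by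
    rintro w rfl; rfl
  rw [← h1, h2 u h0]
  rfl

theorem coordDeriv_partialMu {u : DualTotal m E} (hu : u ∈ c.dom) (α : Fin m) :
    c.coordDeriv u (c.partialMu α u) = (0, Pi.single α (1 : ℝ)) := by
  set γ : ℝ → DualTotal m E := fun t : ℝ =>
    c.point (c.qCoord u) (c.muCoord u + t • Pi.single α (1 : ℝ)) with hγ
  have h0 : γ 0 = u := by
    simp only [hγ, zero_smul, add_zero]
    exact c.param_coord hu
  have h1 := c.coordDeriv_curve (γ := γ) (h0 ▸ hu) (0, Pi.single α (1 : ℝ))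
    (Filter.Eventually.of_forall fun t => by
      rw [h0]; simp [hγ, param, coord])
  have h2 : ∀ w, γ 0 = w → c.coordDeriv (γ 0) (mfderiv 𝓘(ℝ, ℝ) (dualModel n m) γ 0 (1 : ℝ)) =
      c.coordDeriv w (mfderiv 𝓘(ℝ, ℝ) (dualModel n m) γ 0 (1 : ℝ)) := by
    rintro w rfl; rfl
  rw [← h1, h2 u h0]
  rfl

theorem coord_add_smul {u : DualTotal m E} (φ : E u.proj →L[ℝ] Bundle.Trivial M ℝ u.proj) (t : ℝ) :
    c.coord ⟨u.proj, u.snd + t • φ⟩ = c.coord u + t • ((0, fun α => φ (c.s α u.proj)) :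
      Eu n × (Fin m → ℝ)) := by
  refine Prod.ext ?_ ?_
  · simp [coord, qCoord]
  · funext α
    rfl

theorem coordDeriv_vertLift {u : DualTotal m E} (hu : u ∈ c.dom)
    (φ : E u.proj →L[ℝ] Bundle.Trivial M ℝ u.proj) :
    c.coordDeriv u (vertLift u φ) = (0, fun α => φ (c.s α u.proj)) := by
  set γ : ℝ → DualTotal m E := fun t : ℝ => ⟨u.proj, u.snd + t • φ⟩ with hγ
  have h0 : γ 0 = u := by
    simp only [hγ, zero_smul, add_zero]
  have h1 := c.coordDeriv_curve (γ := γ) (h0 ▸ hu) (0, fun α => φ (c.s α u.proj))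
    (Filter.Eventually.of_forall fun t => by
      rw [h0, ← c.coord_add_smul φ t]
      exact (c.param_coord (u := γ t) hu).symm)
  have h2 : ∀ w, γ 0 = w → c.coordDeriv (γ 0) (mfderiv 𝓘(ℝ, ℝ) (dualModel n m) γ 0 (1 : ℝ)) =
      c.coordDeriv w (mfderiv 𝓘(ℝ, ℝ) (dualModel n m) γ 0 (1 : ℝ)) := by
    rintro w rfl; rfl
  rw [← h1, h2 u h0]
  rfl

theorem exists_coordDeriv_eq {u : DualTotal m E} (hu : u ∈ c.dom) (w : Eu n × (Fin m → ℝ)) :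
    ∃ v : TangentSpace (dualModel n m) u, c.coordDeriv u v = w := by
  obtain ⟨p, hp, rfl⟩ : ∃ p ∈ c.ran, c.param p = u :=
    ⟨_, c.coord_mem_ran hu, c.param_coord hu⟩
  exact ⟨c.tangentOf p w, c.coordDeriv_tangentOf hp w⟩

/-- A field with smooth components is the image, under the differential of the smooth map `param`,
of a smooth field along `coord`. -/
theorem contMDiffAt_of_coordDeriv {V : ∀ u : DualTotal m E, TangentSpace (dualModel n m) u}
    {u : DualTotal m E} (hu : u ∈ c.dom)
    (hV : ContMDiffAt (dualModel n m) 𝓘(ℝ, Eu n × (Fin m → ℝ)) ∞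
      (fun w => c.coordDeriv w (V w)) u) :
    ContMDiffAt (dualModel n m) (dualModel n m).tangent ∞
      (fun w => (⟨w, V w⟩ : TangentBundle (dualModel n m) (DualTotal m E))) u := by
  have h1 : ContMDiffAt (dualModel n m) 𝓘(ℝ, Eu n × (Fin m → ℝ)).tangent ∞
      (fun w => (⟨c.coord w, c.coordDeriv w (V w)⟩ :
        TangentBundle 𝓘(ℝ, Eu n × (Fin m → ℝ)) (Eu n × (Fin m → ℝ)))) u := by
    refine contMDiffAt_totalSpace.2 ⟨c.contMDiffAt_coord hu, ?_⟩
    refine hV.congr_of_eventuallyEq (Filter.Eventually.of_forall fun w => ?_)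
    simp
  have h2 := contMDiffAt_mfderiv_apply (c.contMDiffAt_param (c.coord_mem_ran hu)) h1
  refine h2.congr_of_eventuallyEq ?_
  filter_upwards [c.isOpen_dom.mem_nhds hu] with w hw
  have h3 := c.param_coord hw
  have h4 := c.mfderiv_param_coordDeriv hw (V w)
  exact (TotalSpace.ext h3 h4).symm

theorem mdifferentiable_chart : c.chart.MDifferentiable (𝓡 n) (𝓡 n) :=
  ⟨(contMDiffOn_of_mem_maximalAtlas c.chart_mem).mdifferentiableOn (by simp),
    (contMDiffOn_symm_of_mem_maximalAtlas c.chart_mem).mdifferentiableOn (by simp)⟩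

theorem mfderiv_chart_apply {x : M} (hx : x ∈ c.W) (v : TangentSpace (𝓡 n) x) (i : Fin n) :
    (EuclideanSpace.proj i : Eu n →L[ℝ] ℝ) (mfderiv (𝓡 n) 𝓘(ℝ, Eu n) c.chart x v) =
      dirDeriv (𝓡 n) (fun y => c.chart y i) x v := by
  let L : Eu n →L[ℝ] ℝ := EuclideanSpace.proj i
  have h2 := mfderiv_comp (I' := 𝓘(ℝ, Eu n)) (I'' := 𝓘(ℝ, ℝ)) (g := L) x
    (L.differentiableAt.mdifferentiableAt) ((c.contMDiffAt_chart hx).mdifferentiableAt (by simp))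
  rw [mfderiv_eq_fderiv, L.fderiv] at h2
  exact (DFunLike.congr_fun h2 v).symm

theorem tangent_ext {x : M} (hx : x ∈ c.W) {v w : TangentSpace (𝓡 n) x}
    (h : ∀ i, dirDeriv (𝓡 n) (fun y => c.chart y i) x v =
      dirDeriv (𝓡 n) (fun y => c.chart y i) x w) : v = w := by
  refine c.mdifferentiable_chart.mfderiv_injective (c.W_subset hx) ?_
  have h1 : ∀ i, (EuclideanSpace.proj i : Eu n →L[ℝ] ℝ) (mfderiv (𝓡 n) 𝓘(ℝ, Eu n) c.chart x v) =
      (EuclideanSpace.proj i : Eu n →L[ℝ] ℝ) (mfderiv (𝓡 n) 𝓘(ℝ, Eu n) c.chart x w) := fun i => by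
    rw [c.mfderiv_chart_apply hx, c.mfderiv_chart_apply hx, h i]
  exact PiLp.ext h1

theorem contMDiffAt_chart_apply {x : M} (hx : x ∈ c.W) (i : Fin n) :
    ContMDiffAt (𝓡 n) 𝓘(ℝ, ℝ) ∞ (fun y => c.chart y i) x :=
  (EuclideanSpace.proj i : Eu n →L[ℝ] ℝ).contDiff.contMDiff.contMDiffAt.comp x
    (c.contMDiffAt_chart hx)

theorem dirDeriv_comp_proj {f : M → ℝ} {u : DualTotal m E}
    (hf : MDifferentiableAt (𝓡 n) 𝓘(ℝ, ℝ) f u.proj) (v : TangentSpace (dualModel n m) u) :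
    dirDeriv (dualModel n m) (fun w : DualTotal m E => f w.proj) u v =
      dirDeriv (𝓡 n) f u.proj
        (mfderiv (dualModel n m) (𝓡 n) (fun w : DualTotal m E => w.proj) u v) := by
  have h2 := mfderiv_comp (I' := 𝓡 n) (I'' := 𝓘(ℝ, ℝ)) u hf
    ((contMDiffAt_proj u).mdifferentiableAt (by simp))
  exact DFunLike.congr_fun h2 v

variable (A : LieAlgebroid n m M E)

theorem dirDeriv_anchor {x : M} (hx : x ∈ c.W) (a : E x) (i : Fin n) :
    dirDeriv (𝓡 n) (fun y => c.chart y i) x (A.anchor x a) =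
      ∑ α, c.isFrame.coeff α x a * c.sig A α i x := by
  conv_lhs => rw [← c.sum_coeff hx a]
  rw [map_sum, dirDeriv_sum_right]
  simp only [map_smul, dirDeriv_smul_right]
  rfl

/-- Tangent vectors of `M` are detected by the chart functions, so `σ(a) = Tτ(v)` amounts to one
equation per `q^i`. Thus `a` fixes the `q`-components of `v` and leaves the `μ`-components free,
which is why `cQ` and `cP` together are coordinates on the fibre. -/
theorem mem_prolong_iff {u : DualTotal m E} (hu : u ∈ c.dom) (a : E u.proj)
    (v : TangentSpace (dualModel n m) u) :
    (a, v) ∈ Prolong A u ↔ ∀ i, dirDeriv (dualModel n m) (fun w => c.qCoord w i) u v =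
      ∑ α, c.isFrame.coeff α u.proj a * c.sig A α i u.proj := by
  have h1 : ∀ i, dirDeriv (dualModel n m) (fun w => c.qCoord w i) u v =
      dirDeriv (𝓡 n) (fun y => c.chart y i) u.proj
        (mfderiv (dualModel n m) (𝓡 n) (fun w : DualTotal m E => w.proj) u v) := fun i =>
    dirDeriv_comp_proj ((c.contMDiffAt_chart_apply hu i).mdifferentiableAt (by simp)) v
  constructor
  · intro h i
    have h2 : A.anchor u.proj a =
      mfderiv (dualModel n m) (𝓡 n) (fun w : DualTotal m E => w.proj) u v := h
    rw [h1, ← h2, c.dirDeriv_anchor A hu]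
  · intro h
    change A.anchor u.proj a =
      mfderiv (dualModel n m) (𝓡 n) (fun w : DualTotal m E => w.proj) u v
    refine c.tangent_ext hu fun i => ?_
    rw [c.dirDeriv_anchor A hu, ← h1, h i]

variable {A}

/-- The coordinates `p^α` of an element `p` of `𝒯E*` with respect to `𝒬_α`. -/
def cQ (α : Fin m) {u : DualTotal m E} (p : Prolong A u) : ℝ := c.isFrame.coeff α u.proj p.1.1

/-- The coordinates `p_α` of an element `p` of `𝒯E*` with respect to `𝒫^α`. -/
def cP (α : Fin m) {u : DualTotal m E} (p : Prolong A u) : ℝ :=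
  dirDeriv (dualModel n m) (fun w => c.muCoord w α) u p.1.2

section

variable {u : DualTotal m E}

theorem cQ_add (α : Fin m) (p q : Prolong A u) : c.cQ α (p + q) = c.cQ α p + c.cQ α q :=
  map_add (c.isFrame.coeff α u.proj) _ _

theorem cQ_sub (α : Fin m) (p q : Prolong A u) : c.cQ α (p - q) = c.cQ α p - c.cQ α q :=
  map_sub (c.isFrame.coeff α u.proj) _ _

theorem cQ_neg (α : Fin m) (p : Prolong A u) : c.cQ α (-p) = -c.cQ α p :=
  map_neg (c.isFrame.coeff α u.proj) _

theorem cQ_smul (α : Fin m) (r : ℝ) (p : Prolong A u) : c.cQ α (r • p) = r * c.cQ α p :=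
  map_smul (c.isFrame.coeff α u.proj) _ _

theorem cQ_zero (α : Fin m) : c.cQ α (0 : Prolong A u) = 0 :=
  map_zero (c.isFrame.coeff α u.proj)

theorem cP_add (α : Fin m) (p q : Prolong A u) : c.cP α (p + q) = c.cP α p + c.cP α q :=
  dirDeriv_add_right _ _

theorem cP_sub (α : Fin m) (p q : Prolong A u) : c.cP α (p - q) = c.cP α p - c.cP α q :=
  dirDeriv_sub_right _ _

theorem cP_neg (α : Fin m) (p : Prolong A u) : c.cP α (-p) = -c.cP α p :=
  dirDeriv_neg_right _

theorem cP_smul (α : Fin m) (r : ℝ) (p : Prolong A u) : c.cP α (r • p) = r * c.cP α p :=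
  dirDeriv_smul_right _ _

theorem cP_zero (α : Fin m) : c.cP α (0 : Prolong A u) = 0 :=
  dirDeriv_zero_right

theorem coordDeriv_prolong_fst (hu : u ∈ c.dom) (p : Prolong A u) (i : Fin n) :
    (c.coordDeriv u p.1.2).1 i = ∑ α, c.cQ α p * c.sig A α i u.proj := by
  rw [c.coordDeriv_fst hu]
  exact (c.mem_prolong_iff A hu p.1.1 p.1.2).1 p.2 i

theorem coordDeriv_prolong_snd (hu : u ∈ c.dom) (p : Prolong A u) (α : Fin m) :
    (c.coordDeriv u p.1.2).2 α = c.cP α p := c.coordDeriv_snd hu _ α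

theorem prolong_ext (hu : u ∈ c.dom) {p q : Prolong A u} (hQ : ∀ α, c.cQ α p = c.cQ α q)
    (hP : ∀ α, c.cP α p = c.cP α q) : p = q := by
  refine Subtype.ext (Prod.ext (c.ext_coeff hu hQ) (c.coordDeriv_injective hu ?_))
  refine Prod.ext (PiLp.ext fun i => ?_) (funext fun α => ?_)
  · rw [c.coordDeriv_prolong_fst hu, c.coordDeriv_prolong_fst hu]
    simp only [hQ]
  · rw [c.coordDeriv_prolong_snd hu, c.coordDeriv_prolong_snd hu, hP]

variable (A) in
theorem exists_prolong (hu : u ∈ c.dom) (a b : Fin m → ℝ) :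
    ∃ p : Prolong A u, (∀ α, c.cQ α p = a α) ∧ ∀ α, c.cP α p = b α := by
  obtain ⟨v, hv⟩ := c.exists_coordDeriv_eq hu
    (WithLp.toLp 2 fun i => ∑ α, a α * c.sig A α i u.proj, b)
  have h1 : ∀ α, c.isFrame.coeff α u.proj (∑ β, a β • c.s β u.proj) = a α := c.coeff_sum hu a
  refine ⟨⟨(∑ β, a β • c.s β u.proj, v), (c.mem_prolong_iff A hu _ _).2 fun i => ?_⟩, h1,
    fun α => ?_⟩
  · rw [← c.coordDeriv_fst hu, hv]
    simp only [h1]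
  · change dirDeriv (dualModel n m) (fun w => c.muCoord w α) u v = b α
    rw [← c.coordDeriv_snd hu, hv]

open Classical in
variable (A) in
/-- The element of `𝒯E*` with given coordinates. -/
def ofCoords (u : DualTotal m E) (a b : Fin m → ℝ) : Prolong A u :=
  if hu : u ∈ c.dom then (c.exists_prolong A hu a b).choose else 0

theorem cQ_ofCoords (hu : u ∈ c.dom) (a b : Fin m → ℝ) (α : Fin m) : c.cQ α (c.ofCoords A u a b) = a α := by
  rw [ofCoords, dif_pos hu]
  exact (c.exists_prolong A hu a b).choose_spec.1 α

theorem cP_ofCoords (hu : u ∈ c.dom) (a b : Fin m → ℝ) (α : Fin m) : c.cP α (c.ofCoords A u a b) = b α := by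
  rw [ofCoords, dif_pos hu]
  exact (c.exists_prolong A hu a b).choose_spec.2 α

theorem mem_vertProlong_iff (hu : u ∈ c.dom) (p : Prolong A u) :
    p ∈ VertProlong A u ↔ ∀ α, c.cQ α p = 0 := by
  change p.1.1 = 0 ↔ _
  constructor
  · intro h α
    rw [cQ, h, map_zero]
  · intro h
    refine c.ext_coeff hu fun α => ?_
    rw [map_zero]
    exact h α

/-- The derivative of a function along an element of `𝒯E*`, in coordinates. -/
theorem dirDeriv_prolong {f : DualTotal m E → ℝ} (hu : u ∈ c.dom)
    (hf : ContMDiffAt (dualModel n m) 𝓘(ℝ, ℝ) ∞ f u) (p : Prolong A u) :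
    dirDeriv (dualModel n m) f u p.1.2 =
      ∑ α, c.cQ α p * ∑ i, c.sig A α i u.proj * pdq i (c.ham f) (c.qCoord u) (c.muCoord u)
        + ∑ α, c.cP α p * pdmu α (c.ham f) (c.qCoord u) (c.muCoord u) := by
  rw [c.dirDeriv_eq_sum hu hf]
  simp only [c.coordDeriv_prolong_fst hu, c.coordDeriv_prolong_snd hu]
  congr 1
  simp only [Finset.sum_mul, Finset.mul_sum]
  rw [Finset.sum_comm]
  simp only [mul_assoc]

end

variable (A) in
theorem contMDiffAt_sig {x : M} (hx : x ∈ c.W) (α : Fin m) (i : Fin n) :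
    ContMDiffAt (𝓡 n) 𝓘(ℝ, ℝ) ∞ (c.sig A α i) x := by
  refine contMDiffAt_dirDeriv (b := fun y => y) (f := fun y => c.chart y i)
    (w := fun y => A.anchor y (c.s α y)) (c.contMDiffAt_chart_apply hx i) ?_
  exact A.contMDiff_anchor.contMDiffAt.comp x (c.s α).contMDiff.contMDiffAt

theorem contMDiffAt_comp_proj {f : M → ℝ} {u : DualTotal m E}
    (hf : ContMDiffAt (𝓡 n) 𝓘(ℝ, ℝ) ∞ f u.proj) :
    ContMDiffAt (dualModel n m) 𝓘(ℝ, ℝ) ∞ (fun w : DualTotal m E => f w.proj) u :=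
  hf.comp u (contMDiffAt_proj u)

/-- The `q`-components of the tangent part are combinations of the `cQ` with the smooth coefficients
`σ_α^i`, so they impose no further condition. -/
theorem smoothProlongAt_iff {ρ : ∀ u, Prolong A u} {u : DualTotal m E} (hu : u ∈ c.dom) :
    SmoothProlongAt A ρ u ↔
      (∀ α, ContMDiffAt (dualModel n m) 𝓘(ℝ, ℝ) ∞ (fun w => c.cQ α (ρ w)) u) ∧
      ∀ α, ContMDiffAt (dualModel n m) 𝓘(ℝ, ℝ) ∞ (fun w => c.cP α (ρ w)) u := by
  constructor
  · rintro ⟨h1, h2⟩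
    refine ⟨fun α => c.contMDiffAt_coeff (b := fun w : DualTotal m E => w.proj) hu h1 α,
      fun α => ?_⟩
    exact contMDiffAt_dirDeriv (b := fun w : DualTotal m E => w) (w := fun w => (ρ w).1.2)
      (c.contMDiffAt_muCoord u α) h2
  · rintro ⟨h1, h2⟩
    refine ⟨c.contMDiffAt_sum_smul (b := fun w : DualTotal m E => w.proj) hu (contMDiffAt_proj u) h1,
      c.contMDiffAt_of_coordDeriv hu ?_⟩
    have h3 : ContMDiffAt (dualModel n m) 𝓘(ℝ, Fin n → ℝ) ∞
        (fun w => fun i => ∑ α, c.cQ α (ρ w) * c.sig A α i w.proj) u :=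
      contMDiffAt_pi_space.2 fun i => ContMDiffAt.sum fun α _ =>
        (h1 α).mul (contMDiffAt_comp_proj (c.contMDiffAt_sig A hu α i))
    have h4 : ContMDiffAt (dualModel n m) 𝓘(ℝ, Eu n) ∞
        (fun w => (WithLp.toLp 2 fun i => ∑ α, c.cQ α (ρ w) * c.sig A α i w.proj : Eu n)) u :=
      (EuclideanSpace.equiv (Fin n) ℝ).symm.contDiff.contMDiff.contMDiffAt.comp u h3
    refine (h4.prodMk_space (contMDiffAt_pi_space.2 h2)).congr_of_eventuallyEq ?_
    filter_upwards [c.isOpen_dom.mem_nhds hu] with w hw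
    refine Prod.ext (PiLp.ext fun i => ?_) (funext fun α => ?_)
    · rw [c.coordDeriv_prolong_fst hw]
    · rw [c.coordDeriv_prolong_snd hw]

end LocalFrame
end ProlongCoordinates

/-! ### Locality of the algebroid bracket and its expression in a frame. -/

section LocalBracket

variable {n m : ℕ} {M : Type*} [TopologicalSpace M] [ChartedSpace (Eu n) M]
  [IsManifold (𝓡 n) ∞ M] {E : M → Type*} [TopologicalSpace (TotalSpace (Eu m) E)]
  [∀ x, AddCommGroup (E x)] [∀ x, Module ℝ (E x)] [∀ x, TopologicalSpace (E x)]
  [FiberBundle (Eu m) E] [VectorBundle ℝ (Eu m) E] [ContMDiffVectorBundle ∞ (Eu m) E (𝓡 n)]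

/-- The product of a smooth function and a smooth section. -/
def mulSection {f : M → ℝ} (hf : ContMDiff (𝓡 n) 𝓘(ℝ, ℝ) ∞ f) (s : Cₛ^∞⟮𝓡 n; Eu m, E⟯) :
    Cₛ^∞⟮𝓡 n; Eu m, E⟯ :=
  ⟨fun x => f x • s x, fun x => (hf x).smul_section (s.contMDiff x)⟩

theorem mulSection_apply {f : M → ℝ} (hf : ContMDiff (𝓡 n) 𝓘(ℝ, ℝ) ∞ f)
    (s : Cₛ^∞⟮𝓡 n; Eu m, E⟯) (x : M) : mulSection hf s x = f x • s x := rfl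

section Extension

variable [T2Space M]

/-- The section constant in the trivialization, cut off by a bump function, is global and smooth.
Hence the ε-choice `constSection` has its intended property. -/
theorem exists_section_eventuallyEq_extend (x : M) (a : E x) :
    ∃ s : Cₛ^∞⟮𝓡 n; Eu m, E⟯, ∀ᶠ y in 𝓝 x, s y = FiberBundle.extend (Eu m) a y := by
  set T := trivializationAt (Eu m) E x with hT
  have hx : x ∈ T.baseSet := FiberBundle.mem_baseSet_trivializationAt' x
  obtain ⟨χ, h1, h2, h3⟩ := exists_contMDiff_bump (𝓡 n) (T.open_baseSet.mem_nhds hx)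
  have h4 : ContMDiffOn (𝓡 n) ((𝓡 n).prod 𝓘(ℝ, Eu m)) ∞
      (fun y => TotalSpace.mk' (Eu m) y (FiberBundle.extend (Eu m) a y)) T.baseSet := by
    rw [T.contMDiffOn_section_baseSet_iff]
    refine (contMDiffOn_const (c := (T ⟨x, a⟩).2)).congr fun y hy => ?_
    change (T ⟨y, T.symm y (T ⟨x, a⟩).2⟩).2 = _
    rw [Trivialization.apply_mk_symm T hy]
  refine ⟨⟨χ • FiberBundle.extend (Eu m) a,
    h1.contMDiffOn.smul_section_of_tsupport T.open_baseSet h3 h4⟩, ?_⟩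
  filter_upwards [h2] with y hy
  change χ y • FiberBundle.extend (Eu m) a y = _
  rw [hy, one_smul]

theorem constSection_eventuallyEq (x : M) (a : E x) :
    ∀ᶠ y in 𝓝 x, (constSection x a : Cₛ^∞⟮𝓡 n; Eu m, E⟯) y = FiberBundle.extend (Eu m) a y :=
  Classical.epsilon_spec (exists_section_eventuallyEq_extend x a)

theorem constSection_self (x : M) (a : E x) :
    (constSection x a : Cₛ^∞⟮𝓡 n; Eu m, E⟯) x = a := by
  rw [(constSection_eventuallyEq x a).self_of_nhds, FiberBundle.extend_apply_self]

variable (n m E) in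
-- The frame sections must be global; the cut-off sections used here are only known to agree with
-- the frame of the trivialization near `x`, hence the smaller set `W`.
theorem exists_localFrame (x : M) : ∃ c : LocalFrame n m M E, x ∈ c.W := by
  set T := trivializationAt (Eu m) E x with hT
  have hx : x ∈ T.baseSet := FiberBundle.mem_baseSet_trivializationAt' x
  let b : Module.Basis (Fin m) ℝ (Eu m) := (EuclideanSpace.basisFun (Fin m) ℝ).toBasis
  let s : Fin m → Cₛ^∞⟮𝓡 n; Eu m, E⟯ := fun α => constSection x (T.symm x (b α))
  have h1 : ∀ᶠ y in 𝓝 x, ∀ α, s α y = T.localFrame b α y := by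
    refine Filter.eventually_all.2 fun α => ?_
    filter_upwards [constSection_eventuallyEq (n := n) (m := m) x (T.symm x (b α)),
      T.open_baseSet.mem_nhds hx] with y hy hyT
    refine hy.trans ?_
    rw [T.localFrame_apply_of_mem_baseSet b hyT]
    simp only [FiberBundle.extend, ← hT]
    rw [Trivialization.apply_mk_symm _ hx]
    rfl
  have h2 : ∀ᶠ y in 𝓝 x, y ∈ T.baseSet := T.open_baseSet.mem_nhds hx
  have h3 : ∀ᶠ y in 𝓝 x, y ∈ (chartAt (Eu n) x).source := chart_source_mem_nhds (Eu n) x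
  obtain ⟨W, hW, hWo, hxW⟩ := eventually_nhds_iff.1 (h1.and (h2.and h3))
  refine ⟨⟨chartAt (Eu n) x, IsManifold.chart_mem_maximalAtlas x, W, hWo,
    fun y hy => (hW y hy).2.2, s, ?_⟩, hxW⟩
  refine ((T.isLocalFrameOn_localFrame_baseSet (𝓡 n) ∞ b).mono
    fun y hy => (hW y hy).2.1).congr fun α y hy => ((hW y hy).1 α).symm

end Extension

section Locality

variable [T2Space M] (A : LieAlgebroid n m M E)

theorem LieAlgebroid.bracket_zero_right (s : Cₛ^∞⟮𝓡 n; Eu m, E⟯) : A.bracket s 0 = 0 := by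
  have h := A.bracket_smul_right 0 s 0
  rwa [zero_smul, zero_smul] at h

/-- Let `χ` be a bump function that is 1 near `x`, with support where `t` vanishes. Then `χ t = 0`,
and the Leibniz rule at `x` leaves `0 = [s, t](x)`, since the anchor term is multiplied by `t(x) =
0`. -/
theorem LieAlgebroid.bracket_eq_zero {s t : Cₛ^∞⟮𝓡 n; Eu m, E⟯} {x : M}
    (ht : ∀ᶠ y in 𝓝 x, t y = 0) : A.bracket s t x = 0 := by
  obtain ⟨χ, h1, h2, h3⟩ := exists_contMDiff_bump (𝓡 n) ht
  have h4 := A.leibniz χ h1 s t 0 (fun y => by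
    by_cases hy : y ∈ tsupport χ
    · have : t y = 0 := h3 hy
      rw [this, smul_zero]; rfl
    · rw [image_eq_zero_of_notMem_tsupport hy, zero_smul]; rfl) x
  rw [A.bracket_zero_right, h2.self_of_nhds, ht.self_of_nhds, smul_zero, add_zero, one_smul] at h4
  exact h4.symm

theorem LieAlgebroid.bracket_congr_right {s t t' : Cₛ^∞⟮𝓡 n; Eu m, E⟯} {x : M}
    (ht : ∀ᶠ y in 𝓝 x, t y = t' y) : A.bracket s t x = A.bracket s t' x := by
  have h1 : A.bracket s t = A.bracket s (t - t') + A.bracket s t' := by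
    rw [← A.bracket_add_right, sub_add_cancel]
  have h2 : A.bracket s (t - t') x = 0 := A.bracket_eq_zero (by
    filter_upwards [ht] with y hy
    change t y - t' y = 0
    rw [hy, sub_self])
  rw [h1]
  change A.bracket s (t - t') x + A.bracket s t' x = _
  rw [h2, zero_add]

theorem LieAlgebroid.bracket_sum_right {ι : Type*} (S : Finset ι) (s : Cₛ^∞⟮𝓡 n; Eu m, E⟯)
    (t : ι → Cₛ^∞⟮𝓡 n; Eu m, E⟯) :
    A.bracket s (∑ i ∈ S, t i) = ∑ i ∈ S, A.bracket s (t i) := by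
  classical
  induction S using Finset.induction_on with
  | empty => simpa using A.bracket_zero_right s
  | insert a S ha ih => rw [Finset.sum_insert ha, A.bracket_add_right, ih, Finset.sum_insert ha]

theorem sum_section_apply {ι : Type*} (S : Finset ι) (t : ι → Cₛ^∞⟮𝓡 n; Eu m, E⟯) (x : M) :
    (∑ i ∈ S, t i) x = ∑ i ∈ S, t i x := by
  classical
  induction S using Finset.induction_on with
  | empty => rfl
  | insert a S ha ih =>
    rw [Finset.sum_insert ha, Finset.sum_insert ha, ← ih]
    rfl

variable (c : LocalFrame n m M E)

theorem LocalFrame.contMDiffAt_coeff_section {x : M} (hx : x ∈ c.W) (t : Cₛ^∞⟮𝓡 n; Eu m, E⟯)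
    (α : Fin m) : ContMDiffAt (𝓡 n) 𝓘(ℝ, ℝ) ∞ (fun y => c.isFrame.coeff α y (t y)) x :=
  c.contMDiffAt_coeff (b := fun y => y) hx t.contMDiff.contMDiffAt α

/-- Near `x` the section `t` is a sum of products `g_β s_β` with globally smooth `g_β`; locality
permits the replacement, and the Leibniz rule expands each product. -/
theorem LieAlgebroid.bracket_expand_right {x : M} (hx : x ∈ c.W) (s t : Cₛ^∞⟮𝓡 n; Eu m, E⟯) :
    A.bracket s t x = ∑ β, (c.isFrame.coeff β x (t x) • A.bracket s (c.s β) x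
      + dirDeriv (𝓡 n) (fun y => c.isFrame.coeff β y (t y)) x (A.anchor x (s x)) • c.s β x) := by
  have h1 : ∀ β, ∃ g : M → ℝ, ContMDiff (𝓡 n) 𝓘(ℝ, ℝ) ∞ g ∧
      g =ᶠ[𝓝 x] fun y => c.isFrame.coeff β y (t y) := fun β =>
    exists_contMDiff_extension (𝓡 n) c.isOpen_W hx fun y hy =>
      (c.contMDiffAt_coeff_section hy t β).contMDiffWithinAt
  choose g hg hgt using h1
  have h2 : ∀ᶠ y in 𝓝 x, t y = (∑ β, mulSection (hg β) (c.s β)) y := by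
    filter_upwards [c.isOpen_W.mem_nhds hx, Filter.eventually_all.2 hgt] with y hy hgy
    rw [sum_section_apply]
    simp only [mulSection_apply, hgy]
    exact (c.sum_coeff hy (t y)).symm
  rw [A.bracket_congr_right h2, A.bracket_sum_right, sum_section_apply]
  refine Finset.sum_congr rfl fun β _ => ?_
  rw [A.leibniz (g β) (hg β) s (c.s β) (mulSection (hg β) (c.s β)) (fun _ => rfl) x,
    (hgt β).self_of_nhds, dirDeriv_congr (hgt β)]

/-- The bracket of two sections of `E` in a local frame. -/
theorem LieAlgebroid.coeff_bracket {x : M} (hx : x ∈ c.W) (s t : Cₛ^∞⟮𝓡 n; Eu m, E⟯)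
    (γ : Fin m) :
    c.isFrame.coeff γ x (A.bracket s t x) =
      ∑ α, ∑ β, c.isFrame.coeff α x (s x) * c.isFrame.coeff β x (t x) * c.str A α β γ x
      + dirDeriv (𝓡 n) (fun y => c.isFrame.coeff γ y (t y)) x (A.anchor x (s x))
      - dirDeriv (𝓡 n) (fun y => c.isFrame.coeff γ y (s y)) x (A.anchor x (t x)) := by
  have h1 : ∀ β, c.isFrame.coeff γ x (A.bracket s (c.s β) x) =
      ∑ α, c.isFrame.coeff α x (s x) * c.str A α β γ x
        - dirDeriv (𝓡 n) (fun y => c.isFrame.coeff γ y (s y)) x (A.anchor x (c.s β x)) := by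
    intro β
    -- The Leibniz rule is given in the right slot only; skew symmetry moves `s` there.
    rw [A.bracket_skew]
    change c.isFrame.coeff γ x (-(A.bracket (c.s β) s x)) = _
    rw [A.bracket_expand_right c hx, map_neg, map_sum]
    have h2 : ∀ α, A.bracket (c.s β) (c.s α) x = -A.bracket (c.s α) (c.s β) x := fun α => by
      rw [A.bracket_skew]; rfl
    simp only [map_add, map_smul, c.coeff_frame hx, smul_eq_mul, mul_ite, mul_one, mul_zero,
      Finset.sum_add_distrib, Finset.sum_ite_eq, Finset.mem_univ, if_true, h2, map_neg]
    simp only [LocalFrame.str, mul_neg, Finset.sum_neg_distrib]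
    ring
  have h3 : dirDeriv (𝓡 n) (fun y => c.isFrame.coeff γ y (s y)) x (A.anchor x (t x)) =
      ∑ β, c.isFrame.coeff β x (t x) *
        dirDeriv (𝓡 n) (fun y => c.isFrame.coeff γ y (s y)) x (A.anchor x (c.s β x)) := by
    conv_lhs => rw [← c.sum_coeff hx (t x)]
    rw [map_sum, dirDeriv_sum_right]
    simp only [map_smul, dirDeriv_smul_right]
  rw [A.bracket_expand_right c hx, map_sum, h3]
  simp only [map_add, map_smul, c.coeff_frame hx, smul_eq_mul, mul_ite, mul_one, mul_zero,
    Finset.sum_add_distrib, Finset.sum_ite_eq, Finset.mem_univ, if_true, h1, mul_sub,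
    Finset.sum_sub_distrib]
  rw [Finset.sum_comm (f := fun α β => c.isFrame.coeff α x (s x) * c.isFrame.coeff β x (t x) *
    c.str A α β γ x)]
  simp only [Finset.mul_sum, mul_assoc, mul_left_comm]
  ring

/-- The structure equation `σ(s_α)(σ_β^i) - σ(s_β)(σ_α^i) = L_{αβ}^γ σ_γ^i`. -/
theorem LieAlgebroid.structure_equation {x : M} (hx : x ∈ c.W) (α β : Fin m) (i : Fin n) :
    dirDeriv (𝓡 n) (c.sig A β i) x (A.anchor x (c.s α x))
      - dirDeriv (𝓡 n) (c.sig A α i) x (A.anchor x (c.s β x)) =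
      ∑ γ, c.str A α β γ x * c.sig A γ i x := by
  have h1 := c.dirDeriv_anchor A hx (A.bracket (c.s α) (c.s β) x) i
  have h2 : ∀ δ : Fin m, MDifferentiableAt (𝓡 n) (𝓡 n).tangent
      (fun y => (⟨y, A.anchor y (c.s δ y)⟩ : TangentBundle (𝓡 n) M)) x := fun δ =>
    (A.contMDiff_anchor.contMDiffAt.comp x
      (c.s δ).contMDiff.contMDiffAt).mdifferentiableAt (by simp)
  -- The homomorphism property of the anchor is evaluated on the coordinate function `q^i`.
  rw [A.anchor_bracket, dirDeriv_mlieBracket (c.contMDiffAt_chart_apply hx i) (h2 α) (h2 β)] at h1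
  exact h1

end Locality

end LocalBracket

/-! ### The bracket and the symplectic section of the prolongation in coordinates. -/

section ProlongBracket

variable {n m : ℕ} {M : Type*} [TopologicalSpace M] [ChartedSpace (Eu n) M]
  [IsManifold (𝓡 n) ∞ M] {E : M → Type*} [TopologicalSpace (TotalSpace (Eu m) E)]
  [∀ x, AddCommGroup (E x)] [∀ x, Module ℝ (E x)] [∀ x, TopologicalSpace (E x)]
  [FiberBundle (Eu m) E] [VectorBundle ℝ (Eu m) E] [ContMDiffVectorBundle ∞ (Eu m) E (𝓡 n)]

namespace LocalFrame

variable [T2Space M] (c : LocalFrame n m M E)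

/-- Passing from the frame constant in the trivialization to that of `c` costs a derivative of the
transition matrix `R`. This is the subtracted term; in `coeff_bracketFst` it cancels against the
anchor terms of the bracket of the two `constSection`s, so the bracket has the same form in every
frame. -/
theorem coeff_trivDeriv {u : DualTotal m E} (hu : u ∈ c.dom) {b : ∀ w : DualTotal m E, E w.proj}
    (hb : ContMDiffAt (dualModel n m) ((𝓡 n).prod 𝓘(ℝ, Eu m)) ∞
      (fun w => (⟨w.proj, b w⟩ : TotalSpace (Eu m) E)) u)
    (v : TangentSpace (dualModel n m) u) (γ : Fin m) :
    c.isFrame.coeff γ u.proj (trivDeriv u b v) =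
      dirDeriv (dualModel n m) (fun w : DualTotal m E => c.isFrame.coeff γ w.proj (b w)) u v
        - dirDeriv (𝓡 n) (fun y => c.isFrame.coeff γ y
            ((constSection u.proj (b u) : Cₛ^∞⟮𝓡 n; Eu m, E⟯) y)) u.proj
          (mfderiv (dualModel n m) (𝓡 n) (fun w : DualTotal m E => w.proj) u v) := by
  obtain ⟨R, hR, hRc⟩ := c.exists_coeff_matrix (x := u.proj) hu
  set T := trivializationAt (Eu m) E u.proj with hT
  have hx : u.proj ∈ T.baseSet := FiberBundle.mem_baseSet_trivializationAt' u.proj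
  let B : DualTotal m E → Eu m := fun w => (T ⟨w.proj, b w⟩).2
  have hB : ContMDiffAt (dualModel n m) 𝓘(ℝ, Eu m) ∞ B u := (contMDiffAt_totalSpace.1 hb).2
  let r : Fin m → M → ℝ := fun j y => R y (EuclideanSpace.single j (1 : ℝ)) γ
  have hr : ∀ j, ContMDiffAt (𝓡 n) 𝓘(ℝ, ℝ) ∞ (r j) u.proj := fun j => by
    let L : (Eu m →L[ℝ] (Fin m → ℝ)) →L[ℝ] ℝ :=
      (ContinuousLinearMap.proj (R := ℝ) (φ := fun _ : Fin m => ℝ) γ).comp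
        (ContinuousLinearMap.apply ℝ (Fin m → ℝ) (EuclideanSpace.single j (1 : ℝ)))
    exact L.contDiff.contMDiff.contMDiffAt.comp u.proj hR
  have hRr : ∀ y (a : Eu m), R y a γ = ∑ j, a j * r j y := fun y a => by
    conv_lhs => rw [← (EuclideanSpace.basisFun (Fin m) ℝ).sum_repr a]
    simp [r]
  have hBj : ∀ j, ContMDiffAt (dualModel n m) 𝓘(ℝ, ℝ) ∞ (fun w => B w j) u := fun j =>
    (EuclideanSpace.proj j : Eu m →L[ℝ] ℝ).contDiff.contMDiff.contMDiffAt.comp u hB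
  have hrj : ∀ j, ContMDiffAt (dualModel n m) 𝓘(ℝ, ℝ) ∞
      (fun w : DualTotal m E => r j w.proj) u := fun j => contMDiffAt_comp_proj (hr j)
  let D : Eu m := mfderiv (dualModel n m) 𝓘(ℝ, Eu m) B u v
  have hdB : ∀ j, dirDeriv (dualModel n m) (fun w => B w j) u v =
      D j := fun j => by
    let L : Eu m →L[ℝ] ℝ := EuclideanSpace.proj j
    have h2 := mfderiv_comp (I' := 𝓘(ℝ, Eu m)) (I'' := 𝓘(ℝ, ℝ)) (g := L) u
      (L.differentiableAt.mdifferentiableAt) (hB.mdifferentiableAt (by simp))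
    rw [mfderiv_eq_fderiv, L.fderiv] at h2
    exact DFunLike.congr_fun h2 v
  have hW : ∀ᶠ y in 𝓝 u.proj, y ∈ c.W ∧ y ∈ T.baseSet :=
    (show ∀ᶠ y in 𝓝 u.proj, y ∈ c.W from c.isOpen_W.mem_nhds hu).and (T.open_baseSet.mem_nhds hx)
  have e1 : c.isFrame.coeff γ u.proj (trivDeriv u b v) =
      ∑ j, D j * r j u.proj := by
    rw [hRc _ hu hx, ← hRr]
    change R u.proj (T ⟨u.proj, T.symm u.proj D⟩).2 γ = _
    rw [Trivialization.apply_mk_symm _ hx]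
  have e2 : dirDeriv (dualModel n m)
      (fun w : DualTotal m E => c.isFrame.coeff γ w.proj (b w)) u v =
      ∑ j, (B u j * dirDeriv (dualModel n m) (fun w : DualTotal m E => r j w.proj) u v
        + dirDeriv (dualModel n m) (fun w => B w j) u v * r j u.proj) := by
    have h1 : (fun w : DualTotal m E => c.isFrame.coeff γ w.proj (b w)) =ᶠ[𝓝 u]
        fun w => ∑ j, B w j * r j w.proj := by
      filter_upwards [(contMDiffAt_proj (n := n) u).continuousAt.eventually hW] with w hw
      rw [hRc _ hw.1 hw.2, hRr]
    rw [dirDeriv_congr h1, dirDeriv_sum]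
    · refine Finset.sum_congr rfl fun j _ => ?_
      rw [dirDeriv_mul ((hBj j).mdifferentiableAt (by simp)) ((hrj j).mdifferentiableAt (by simp))]
    · exact fun j _ => ((hBj j).mul (hrj j)).mdifferentiableAt (by simp)
  have e3 : ∀ v', dirDeriv (𝓡 n) (fun y => c.isFrame.coeff γ y
        ((constSection u.proj (b u) : Cₛ^∞⟮𝓡 n; Eu m, E⟯) y)) u.proj v' =
      ∑ j, B u j * dirDeriv (𝓡 n) (r j) u.proj v' := fun v' => by
    have h1 : (fun y => c.isFrame.coeff γ y
        ((constSection u.proj (b u) : Cₛ^∞⟮𝓡 n; Eu m, E⟯) y)) =ᶠ[𝓝 u.proj]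
        fun y => ∑ j, B u j * r j y := by
      filter_upwards [hW, constSection_eventuallyEq (n := n) (m := m) u.proj (b u)] with y hy hc
      rw [hc, hRc _ hy.1 hy.2, FiberBundle.extend, Trivialization.apply_mk_symm _ hy.2, hRr]
    rw [dirDeriv_congr h1, dirDeriv_sum]
    · refine Finset.sum_congr rfl fun j _ => ?_
      rw [dirDeriv_mul mdifferentiableAt_const ((hr j).mdifferentiableAt (by simp)),
        dirDeriv_const, zero_mul, add_zero]
    · exact fun j _ => (contMDiffAt_const.mul (hr j)).mdifferentiableAt (by simp)
  rw [e1, e2, e3, ← Finset.sum_sub_distrib]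
  refine Finset.sum_congr rfl fun j _ => ?_
  rw [dirDeriv_comp_proj ((hr j).mdifferentiableAt (by simp)), hdB]
  ring

variable {A : LieAlgebroid n m M E}

theorem coeff_bracketFst {ρ₁ ρ₂ : ∀ u, Prolong A u} {u : DualTotal m E} (hu : u ∈ c.dom)
    (h₁ : SmoothProlongAt A ρ₁ u) (h₂ : SmoothProlongAt A ρ₂ u) (γ : Fin m) :
    c.isFrame.coeff γ u.proj (bracketFst A ρ₁ ρ₂ u) =
      ∑ α, ∑ β, c.cQ α (ρ₁ u) * c.cQ β (ρ₂ u) * c.str A α β γ u.proj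
        + dirDeriv (dualModel n m) (fun w => c.cQ γ (ρ₂ w)) u (ρ₁ u).1.2
        - dirDeriv (dualModel n m) (fun w => c.cQ γ (ρ₁ w)) u (ρ₂ u).1.2 := by
  have e1 : A.anchor u.proj (ρ₁ u).1.1 =
    mfderiv (dualModel n m) (𝓡 n) (fun w : DualTotal m E => w.proj) u (ρ₁ u).1.2 := (ρ₁ u).2
  have e2 : A.anchor u.proj (ρ₂ u).1.1 =
    mfderiv (dualModel n m) (𝓡 n) (fun w : DualTotal m E => w.proj) u (ρ₂ u).1.2 := (ρ₂ u).2
  rw [bracketFst, map_sub, map_add, A.coeff_bracket c hu, c.coeff_trivDeriv hu h₂.1,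
    c.coeff_trivDeriv hu h₁.1, constSection_self, constSection_self, ← e1, ← e2]
  simp only [cQ]
  ring

theorem mdifferentiableAt_cQ {ρ : ∀ u, Prolong A u} {u : DualTotal m E} (hu : u ∈ c.dom)
    (h : SmoothProlongAt A ρ u) (α : Fin m) :
    MDifferentiableAt (dualModel n m) 𝓘(ℝ, ℝ) (fun w => c.cQ α (ρ w)) u :=
  (((c.smoothProlongAt_iff hu).1 h).1 α).mdifferentiableAt (by simp)

theorem dirDeriv_qCoord {u : DualTotal m E} (hu : u ∈ c.dom) (p : Prolong A u) (i : Fin n) :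
    dirDeriv (dualModel n m) (fun w => c.qCoord w i) u p.1.2 =
      ∑ α, c.cQ α p * c.sig A α i u.proj :=
  (c.mem_prolong_iff A hu p.1.1 p.1.2).1 p.2 i

theorem contMDiffAt_qCoord_apply {u : DualTotal m E} (hu : u ∈ c.dom) (i : Fin n) :
    ContMDiffAt (dualModel n m) 𝓘(ℝ, ℝ) ∞ (fun w => c.qCoord w i) u :=
  contMDiffAt_comp_proj (c.contMDiffAt_chart_apply hu i)

/-- The derivative of a function on `M` along an element of `𝒯E*`. -/
theorem dirDeriv_comp_proj_prolong {f : M → ℝ} {u : DualTotal m E} (hu : u ∈ c.dom)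
    (hf : ContMDiffAt (𝓡 n) 𝓘(ℝ, ℝ) ∞ f u.proj) (p : Prolong A u) :
    dirDeriv (dualModel n m) (fun w : DualTotal m E => f w.proj) u p.1.2 =
      ∑ α, c.cQ α p * dirDeriv (𝓡 n) f u.proj (A.anchor u.proj (c.s α u.proj)) := by
  have e1 : A.anchor u.proj p.1.1 =
    mfderiv (dualModel n m) (𝓡 n) (fun w : DualTotal m E => w.proj) u p.1.2 := p.2
  rw [dirDeriv_comp_proj (hf.mdifferentiableAt (by simp)), ← e1]
  conv_lhs => rw [← c.sum_coeff hu p.1.1]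
  rw [map_sum, dirDeriv_sum_right]
  simp only [map_smul, dirDeriv_smul_right]
  rfl

/-- The commutator of the tangent parts, applied to `q^i`, differentiates the `σ_α^i`. The structure
equation identifies the result with the anchor of the first component, so `prolongBracket` takes its
non-default branch. -/
theorem bracket_mem {ρ₁ ρ₂ : ∀ u, Prolong A u} {u : DualTotal m E} (hu : u ∈ c.dom)
    (h₁ : SmoothProlongAt A ρ₁ u) (h₂ : SmoothProlongAt A ρ₂ u) :
    (bracketFst A ρ₁ ρ₂ u, bracketSnd A ρ₁ ρ₂ u) ∈ Prolong A u := by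
  refine (c.mem_prolong_iff A hu _ _).2 fun i => ?_
  have hd : ∀ {ρ : ∀ u, Prolong A u}, SmoothProlongAt A ρ u → ∀ p : Prolong A u,
      dirDeriv (dualModel n m) (fun w => dirDeriv (dualModel n m) (fun w => c.qCoord w i) w
        (ρ w).1.2) u p.1.2 =
      ∑ β, (c.cQ β (ρ u) * ∑ α, c.cQ α p *
          dirDeriv (𝓡 n) (c.sig A β i) u.proj (A.anchor u.proj (c.s α u.proj))
        + dirDeriv (dualModel n m) (fun w => c.cQ β (ρ w)) u p.1.2 * c.sig A β i u.proj) := by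
    intro ρ h p
    have h1 : (fun w => dirDeriv (dualModel n m) (fun w => c.qCoord w i) w (ρ w).1.2) =ᶠ[𝓝 u]
        fun w => ∑ β, c.cQ β (ρ w) * c.sig A β i w.proj := by
      filter_upwards [c.isOpen_dom.mem_nhds hu] with w hw
      exact c.dirDeriv_qCoord hw (ρ w) i
    have h2 : ∀ β, MDifferentiableAt (dualModel n m) 𝓘(ℝ, ℝ)
        (fun w : DualTotal m E => c.sig A β i w.proj) u := fun β =>
      (contMDiffAt_comp_proj (c.contMDiffAt_sig A hu β i)).mdifferentiableAt (by simp)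
    rw [dirDeriv_congr h1, dirDeriv_sum]
    · refine Finset.sum_congr rfl fun β _ => ?_
      rw [dirDeriv_mul (c.mdifferentiableAt_cQ hu h β) (h2 β),
        c.dirDeriv_comp_proj_prolong hu (c.contMDiffAt_sig A hu β i)]
    · exact fun β _ => (c.mdifferentiableAt_cQ hu h β).mul (h2 β)
  rw [bracketSnd, dirDeriv_mlieBracket (c.contMDiffAt_qCoord_apply hu i)
    (h₁.2.mdifferentiableAt (by simp)) (h₂.2.mdifferentiableAt (by simp)), hd h₂, hd h₁]
  simp only [c.coeff_bracketFst hu h₁ h₂, add_mul, sub_mul, Finset.sum_add_distrib,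
    Finset.sum_sub_distrib]
  have e1 : ∑ γ, (∑ α, ∑ β, c.cQ α (ρ₁ u) * c.cQ β (ρ₂ u) * c.str A α β γ u.proj) *
      c.sig A γ i u.proj = ∑ α, ∑ β, c.cQ α (ρ₁ u) * c.cQ β (ρ₂ u) *
        (dirDeriv (𝓡 n) (c.sig A β i) u.proj (A.anchor u.proj (c.s α u.proj))
      - dirDeriv (𝓡 n) (c.sig A α i) u.proj (A.anchor u.proj (c.s β u.proj))) := by
    simp only [A.structure_equation c hu, Finset.sum_mul, Finset.mul_sum]
    rw [Finset.sum_comm]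
    refine Finset.sum_congr rfl fun α _ => ?_
    rw [Finset.sum_comm]
    simp only [mul_assoc]
  rw [e1]
  simp only [mul_sub, Finset.sum_sub_distrib, Finset.mul_sum]
  rw [Finset.sum_comm (f := fun α β => c.cQ α (ρ₂ u) * (c.cQ β (ρ₁ u) * _))]
  simp only [mul_assoc, mul_left_comm]
  ring

theorem prolongBracket_eq {ρ₁ ρ₂ : ∀ u, Prolong A u} {u : DualTotal m E} (hu : u ∈ c.dom)
    (h₁ : SmoothProlongAt A ρ₁ u) (h₂ : SmoothProlongAt A ρ₂ u) :
    (prolongBracket A ρ₁ ρ₂ u).1 = (bracketFst A ρ₁ ρ₂ u, bracketSnd A ρ₁ ρ₂ u) := by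
  rw [prolongBracket, dif_pos (c.bracket_mem hu h₁ h₂)]

theorem cQ_bracket {ρ₁ ρ₂ : ∀ u, Prolong A u} {u : DualTotal m E} (hu : u ∈ c.dom)
    (h₁ : SmoothProlongAt A ρ₁ u) (h₂ : SmoothProlongAt A ρ₂ u) (γ : Fin m) :
    c.cQ γ (prolongBracket A ρ₁ ρ₂ u) =
      ∑ α, ∑ β, c.cQ α (ρ₁ u) * c.cQ β (ρ₂ u) * c.str A α β γ u.proj
        + dirDeriv (dualModel n m) (fun w => c.cQ γ (ρ₂ w)) u (ρ₁ u).1.2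
        - dirDeriv (dualModel n m) (fun w => c.cQ γ (ρ₁ w)) u (ρ₂ u).1.2 := by
  rw [← c.coeff_bracketFst hu h₁ h₂, cQ, c.prolongBracket_eq hu h₁ h₂]

theorem cP_bracket {ρ₁ ρ₂ : ∀ u, Prolong A u} {u : DualTotal m E} (hu : u ∈ c.dom)
    (h₁ : SmoothProlongAt A ρ₁ u) (h₂ : SmoothProlongAt A ρ₂ u) (γ : Fin m) :
    c.cP γ (prolongBracket A ρ₁ ρ₂ u) =
      dirDeriv (dualModel n m) (fun w => c.cP γ (ρ₂ w)) u (ρ₁ u).1.2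
        - dirDeriv (dualModel n m) (fun w => c.cP γ (ρ₁ w)) u (ρ₂ u).1.2 := by
  rw [cP, c.prolongBracket_eq hu h₁ h₂]
  exact dirDeriv_mlieBracket (c.contMDiffAt_muCoord u γ)
    (h₁.2.mdifferentiableAt (by simp)) (h₂.2.mdifferentiableAt (by simp))

theorem liouville_eq {u : DualTotal m E} (hu : u ∈ c.dom) (p : Prolong A u) :
    liouville A u p = ∑ α, c.muCoord u α * c.cQ α p := by
  rw [liouville]
  conv_lhs => rw [← c.sum_coeff hu p.1.1]
  simp only [map_sum, map_smul, smul_eq_mul, muCoord, cQ, mul_comm]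

/-- The canonical symplectic section in local coordinates. -/
def symp (A : LieAlgebroid n m M E) {u : DualTotal m E} (p q : Prolong A u) : ℝ :=
  ∑ α, (c.cQ α p * c.cP α q - c.cP α p * c.cQ α q)
    + ∑ α, ∑ β, ∑ γ, c.muCoord u γ * c.str A α β γ u.proj * c.cQ α p * c.cQ β q

/-- The derivatives of the coordinates of `ρ₁` and `ρ₂` cancel between the two derivatives of `θ_E`
and `θ_E([ρ₁, ρ₂])`. What remains depends only on the values at `u`. -/
theorem symplectic_eq {ρ₁ ρ₂ : ∀ u, Prolong A u} {u : DualTotal m E} (hu : u ∈ c.dom)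
    (h₁ : SmoothProlongAt A ρ₁ u) (h₂ : SmoothProlongAt A ρ₂ u) :
    symplectic A ρ₁ ρ₂ u = c.symp A (ρ₁ u) (ρ₂ u) := by
  have hd : ∀ {ρ : ∀ u, Prolong A u}, SmoothProlongAt A ρ u → ∀ p : Prolong A u,
      dirDeriv (dualModel n m) (fun w => liouville A w (ρ w)) u p.1.2 =
      ∑ α, (c.muCoord u α * dirDeriv (dualModel n m) (fun w => c.cQ α (ρ w)) u p.1.2
        + c.cP α p * c.cQ α (ρ u)) := by
    intro ρ h p
    have h1 : (fun w => liouville A w (ρ w)) =ᶠ[𝓝 u]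
        fun w => ∑ α, c.muCoord w α * c.cQ α (ρ w) := by
      filter_upwards [c.isOpen_dom.mem_nhds hu] with w hw
      exact c.liouville_eq hw (ρ w)
    have h2 : ∀ α, MDifferentiableAt (dualModel n m) 𝓘(ℝ, ℝ) (fun w => c.muCoord w α) u :=
      fun α => (c.contMDiffAt_muCoord u α).mdifferentiableAt (by simp)
    rw [dirDeriv_congr h1, dirDeriv_sum]
    · refine Finset.sum_congr rfl fun α _ => ?_
      rw [dirDeriv_mul (h2 α) (c.mdifferentiableAt_cQ hu h α)]
      rfl
    · exact fun α _ => (h2 α).mul (c.mdifferentiableAt_cQ hu h α)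
  rw [symplectic, hd h₂, hd h₁, c.liouville_eq hu]
  simp only [c.cQ_bracket hu h₁ h₂, symp, mul_add, mul_sub, Finset.sum_add_distrib,
    Finset.sum_sub_distrib]
  have e1 : ∑ γ, c.muCoord u γ * ∑ α, ∑ β, c.cQ α (ρ₁ u) * c.cQ β (ρ₂ u) *
      c.str A α β γ u.proj = ∑ α, ∑ β, ∑ γ, c.muCoord u γ * c.str A α β γ u.proj *
        c.cQ α (ρ₁ u) * c.cQ β (ρ₂ u) := by
    simp only [Finset.mul_sum]
    rw [Finset.sum_comm]
    refine Finset.sum_congr rfl fun α _ => ?_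
    rw [Finset.sum_comm]
    refine Finset.sum_congr rfl fun β _ => Finset.sum_congr rfl fun γ _ => ?_
    ring
  have e2 : ∑ α, c.cP α (ρ₂ u) * c.cQ α (ρ₁ u) = ∑ α, c.cQ α (ρ₁ u) * c.cP α (ρ₂ u) := by
    simp only [mul_comm]
  rw [e1, e2]
  ring

/-- Every element of `𝒯E*` is the value of a global smooth section with locally constant
coordinates. -/
theorem exists_section {u : DualTotal m E} (hu : u ∈ c.dom) (a b : Fin m → ℝ) :
    ∃ ρ : ∀ u, Prolong A u, (∀ w, SmoothProlongAt A ρ w) ∧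
      (∀ᶠ w in 𝓝 u, ∀ α, c.cQ α (ρ w) = a α ∧ c.cP α (ρ w) = b α) ∧
      (a = 0 → ∀ w, ρ w ∈ VertProlong A w) := by
  have : T2Space (DualTotal m E) := t2Space_totalSpace _ _
  obtain ⟨χ, h1, h2, h3⟩ := exists_contMDiff_bump (dualModel n m) (c.isOpen_dom.mem_nhds hu)
  -- `ofCoords` takes the default value 0 outside `c.dom`; since `χ` is supported inside `c.dom`,
  -- the jump there is harmless.
  refine ⟨fun w => χ w • c.ofCoords A w a b, fun w => ?_, ?_, ?_⟩
  · by_cases hw : w ∈ tsupport χ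
    · have hw' := h3 hw
      refine (c.smoothProlongAt_iff hw').2 ⟨fun α => ?_, fun α => ?_⟩
      · refine ContMDiffAt.congr_of_eventuallyEq (f := fun z => χ z * a α)
          ((h1 w).mul contMDiffAt_const) ?_
        filter_upwards [c.isOpen_dom.mem_nhds hw'] with z hz
        rw [cQ_smul, c.cQ_ofCoords hz]
      · refine ContMDiffAt.congr_of_eventuallyEq (f := fun z => χ z * b α)
          ((h1 w).mul contMDiffAt_const) ?_
        filter_upwards [c.isOpen_dom.mem_nhds hw'] with z hz
        rw [cP_smul, c.cP_ofCoords hz]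
    -- Off the support of `χ` the frame `c` need not be available, so the smoothness of the zero
    -- section is read in another frame.
    · obtain ⟨c', hc'⟩ := exists_localFrame n m E w.proj
      have h4 : ∀ᶠ z in 𝓝 w, χ z = 0 := by
        filter_upwards [(isClosed_tsupport χ).isOpen_compl.mem_nhds hw] with z hz
        exact image_eq_zero_of_notMem_tsupport hz
      refine (c'.smoothProlongAt_iff hc').2 ⟨fun α => ?_, fun α => ?_⟩
      · refine ContMDiffAt.congr_of_eventuallyEq (f := fun _ => (0 : ℝ)) contMDiffAt_const ?_
        filter_upwards [h4] with z hz
        rw [cQ_smul, hz, zero_mul]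
      · refine ContMDiffAt.congr_of_eventuallyEq (f := fun _ => (0 : ℝ)) contMDiffAt_const ?_
        filter_upwards [h4] with z hz
        rw [cP_smul, hz, zero_mul]
  · filter_upwards [h2, c.isOpen_dom.mem_nhds hu] with w hw hwd α
    rw [cQ_smul, cP_smul, c.cQ_ofCoords hwd, c.cP_ofCoords hwd, hw, one_mul, one_mul]
    exact ⟨rfl, rfl⟩
  · rintro rfl w
    by_cases hw : w ∈ c.dom
    · refine (c.mem_vertProlong_iff hw _).2 fun α => ?_
      rw [cQ_smul, c.cQ_ofCoords hw, Pi.zero_apply, mul_zero]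
    · change χ w • c.ofCoords A w 0 b ∈ _
      rw [image_eq_zero_of_notMem_tsupport fun h => hw (h3 h), zero_smul]
      exact zero_mem _

/-- The bridge between sections and fibres: an identity known for smooth sections can be tested on
every vector of a fibre. -/
theorem exists_section_eq {u : DualTotal m E} (hu : u ∈ c.dom) (p : Prolong A u) :
    ∃ ρ : ∀ u, Prolong A u, (∀ w, SmoothProlongAt A ρ w) ∧ ρ u = p := by
  obtain ⟨ρ, h1, h2, -⟩ := c.exists_section (A := A) hu (fun α => c.cQ α p) (fun α => c.cP α p)
  exact ⟨ρ, h1, c.prolong_ext hu (fun α => (h2.self_of_nhds α).1) fun α => (h2.self_of_nhds α).2⟩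

end LocalFrame

end ProlongBracket

/-- By Cramer's rule the entries of the inverse are polynomials in those of `G` divided by the
determinant. -/
theorem contMDiffAt_matrix_inv {B : Type*} [NormedAddCommGroup B] [NormedSpace ℝ B] {H : Type*}
    [TopologicalSpace H] {I : ModelWithCorners ℝ B H} {X : Type*} [TopologicalSpace X]
    [ChartedSpace H X] {m : ℕ} {G : X → Matrix (Fin m) (Fin m) ℝ} {x : X}
    (hG : ∀ α β, ContMDiffAt I 𝓘(ℝ, ℝ) ∞ (fun y => G y α β) x) (h : (G x).det ≠ 0) (α β : Fin m) :
    ContMDiffAt I 𝓘(ℝ, ℝ) ∞ (fun y => (G y)⁻¹ α β) x := by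
  have hdet : ∀ {F : X → Matrix (Fin m) (Fin m) ℝ},
      (∀ α β, ContMDiffAt I 𝓘(ℝ, ℝ) ∞ (fun y => F y α β) x) →
      ContMDiffAt I 𝓘(ℝ, ℝ) ∞ (fun y => (F y).det) x := fun {F} hF => by
    simp only [Matrix.det_apply']
    exact ContMDiffAt.sum fun σ _ =>
      contMDiffAt_const.mul (ContMDiffAt.prod fun i _ => hF (σ i) i)
  have h1 : ∀ y, (G y)⁻¹ α β = ((G y).det)⁻¹ * (G y).adjugate α β := fun y => by
    rw [Matrix.inv_def, Matrix.smul_apply, Ring.inverse_eq_inv', smul_eq_mul]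
  simp only [h1, Matrix.adjugate_apply]
  refine ((hdet hG).inv₀ h).mul (hdet fun i j => ?_)
  simp only [Matrix.updateRow_apply]
  by_cases hi : i = β
  · simp only [hi, if_true]
    exact contMDiffAt_const
  · simp only [hi, if_false]
    exact hG i j

/-! ### Iterated coordinate derivatives and the vertical Hessian. -/

section CoordinateDerivatives

variable {n m : ℕ} {M : Type*} [TopologicalSpace M] [ChartedSpace (Eu n) M]
  [IsManifold (𝓡 n) ∞ M] {E : M → Type*} [TopologicalSpace (TotalSpace (Eu m) E)]
  [∀ x, AddCommGroup (E x)] [∀ x, Module ℝ (E x)] [∀ x, TopologicalSpace (E x)]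
  [FiberBundle (Eu m) E] [VectorBundle ℝ (Eu m) E] [ContMDiffVectorBundle ∞ (Eu m) E (𝓡 n)]

namespace LocalFrame

variable (c : LocalFrame n m M E)

/-- `∂F/∂q^i` for a function `F` on `E*`. -/
def dq (i : Fin n) (F : DualTotal m E → ℝ) (u : DualTotal m E) : ℝ :=
  dirDeriv (dualModel n m) F u (c.partialQ i u)

/-- `∂F/∂μ_α` for a function `F` on `E*`. -/
def dmu (α : Fin m) (F : DualTotal m E → ℝ) (u : DualTotal m E) : ℝ :=
  dirDeriv (dualModel n m) F u (c.partialMu α u)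

variable {u : DualTotal m E} {F : DualTotal m E → ℝ}

theorem dq_eq (hu : u ∈ c.dom) (hF : ContMDiffAt (dualModel n m) 𝓘(ℝ, ℝ) ∞ F u) (i : Fin n) :
    c.dq i F u = pdq i (c.ham F) (c.qCoord u) (c.muCoord u) := by
  rw [dq, c.dirDeriv_eq_sum hu hF, c.coordDeriv_partialQ hu]
  simp

theorem dmu_eq (hu : u ∈ c.dom) (hF : ContMDiffAt (dualModel n m) 𝓘(ℝ, ℝ) ∞ F u) (α : Fin m) :
    c.dmu α F u = pdmu α (c.ham F) (c.qCoord u) (c.muCoord u) := by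
  rw [dmu, c.dirDeriv_eq_sum hu hF, c.coordDeriv_partialMu hu]
  simp [Pi.single_apply]

theorem dirDeriv_eq_dq_dmu {A : LieAlgebroid n m M E} (hu : u ∈ c.dom)
    (hF : ContMDiffAt (dualModel n m) 𝓘(ℝ, ℝ) ∞ F u) (p : Prolong A u) :
    dirDeriv (dualModel n m) F u p.1.2 =
      ∑ α, c.cQ α p * ∑ i, c.sig A α i u.proj * c.dq i F u + ∑ α, c.cP α p * c.dmu α F u := by
  simp only [c.dirDeriv_prolong hu hF, c.dq_eq hu hF, c.dmu_eq hu hF]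

theorem contMDiffAt_dq (hu : u ∈ c.dom) (hF : ContMDiffAt (dualModel n m) 𝓘(ℝ, ℝ) ∞ F u)
    (i : Fin n) : ContMDiffAt (dualModel n m) 𝓘(ℝ, ℝ) ∞ (c.dq i F) u := by
  refine contMDiffAt_dirDeriv (b := fun w : DualTotal m E => w) hF (c.contMDiffAt_of_coordDeriv hu ?_)
  refine ContMDiffAt.congr_of_eventuallyEq (f := fun _ => (EuclideanSpace.single i (1 : ℝ), 0))
    contMDiffAt_const ?_
  filter_upwards [c.isOpen_dom.mem_nhds hu] with w hw
  exact c.coordDeriv_partialQ hw i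

theorem contMDiffAt_dmu (hu : u ∈ c.dom) (hF : ContMDiffAt (dualModel n m) 𝓘(ℝ, ℝ) ∞ F u)
    (α : Fin m) : ContMDiffAt (dualModel n m) 𝓘(ℝ, ℝ) ∞ (c.dmu α F) u := by
  refine contMDiffAt_dirDeriv (b := fun w : DualTotal m E => w) hF (c.contMDiffAt_of_coordDeriv hu ?_)
  refine ContMDiffAt.congr_of_eventuallyEq (f := fun _ => (0, Pi.single α (1 : ℝ)))
    contMDiffAt_const ?_
  filter_upwards [c.isOpen_dom.mem_nhds hu] with w hw
  exact c.coordDeriv_partialMu hw α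

theorem pdq_congr {f g : Eu n → (Fin m → ℝ) → ℝ} {p : Eu n × (Fin m → ℝ)}
    (h : ∀ᶠ r in 𝓝 p, f r.1 r.2 = g r.1 r.2) (i : Fin n) : pdq i f p.1 p.2 = pdq i g p.1 p.2 := by
  have h1 : Filter.Tendsto (fun t : ℝ => (p.1 + t • EuclideanSpace.single i (1 : ℝ), p.2))
      (𝓝 0) (𝓝 p) := by
    have h2 : Continuous (fun t : ℝ => (p.1 + t • EuclideanSpace.single i (1 : ℝ), p.2)) := by
      fun_prop
    simpa using h2.tendsto 0
  exact Filter.EventuallyEq.deriv_eq (h1.eventually h)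

theorem pdmu_congr {f g : Eu n → (Fin m → ℝ) → ℝ} {p : Eu n × (Fin m → ℝ)}
    (h : ∀ᶠ r in 𝓝 p, f r.1 r.2 = g r.1 r.2) (α : Fin m) :
    pdmu α f p.1 p.2 = pdmu α g p.1 p.2 := by
  have h1 : Filter.Tendsto (fun t : ℝ => (p.1, p.2 + t • (Pi.single α (1 : ℝ) : Fin m → ℝ)))
      (𝓝 0) (𝓝 p) := by
    have h2 : Continuous (fun t : ℝ => (p.1, p.2 + t • (Pi.single α (1 : ℝ) : Fin m → ℝ))) := by
      fun_prop
    simpa using h2.tendsto 0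
  exact Filter.EventuallyEq.deriv_eq (h1.eventually h)

variable {Ω : Set (DualTotal m E)} (hΩ : IsOpen Ω)

include hΩ in
-- To differentiate a coordinate expression once more, its first-order identity is needed on a
-- neighbourhood in `(q, μ)`-space. This transfers identities valid over `Ω` to such a
-- neighbourhood.
theorem eventually_coord (hu : u ∈ c.dom) (huΩ : u ∈ Ω) {P : Eu n × (Fin m → ℝ) → Prop}
    (h : ∀ w ∈ c.dom, w ∈ Ω → P (c.coord w)) : ∀ᶠ p in 𝓝 (c.coord u), P p := by
  have h1 : ContinuousAt c.param (c.coord u) :=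
    (c.contMDiffAt_param (c.coord_mem_ran hu)).continuousAt
  have h2 : ∀ᶠ p in 𝓝 (c.coord u), c.param p ∈ Ω := by
    refine h1.eventually (hΩ.mem_nhds ?_)
    rwa [c.param_coord hu]
  filter_upwards [h2, c.isOpen_ran.mem_nhds (c.coord_mem_ran hu)] with p hp hpr
  have h3 := h _ (c.param_mem_dom hpr) hp
  rwa [c.coord_param hpr] at h3

theorem ham_coord (hu : u ∈ c.dom) : c.ham F (c.qCoord u) (c.muCoord u) = F u := by
  change F (c.param (c.coord u)) = F u
  rw [c.param_coord hu]

variable (hF : ContMDiffOn (dualModel n m) 𝓘(ℝ, ℝ) ∞ F Ω)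

include hΩ hF in
theorem ham_dmu (hu : u ∈ c.dom) (huΩ : u ∈ Ω) (α : Fin m) :
    ∀ᶠ p in 𝓝 (c.coord u), pdmu α (c.ham F) p.1 p.2 = c.ham (c.dmu α F) p.1 p.2 :=
  c.eventually_coord hΩ hu huΩ fun w hw hwΩ => by
    change _ = c.ham (c.dmu α F) (c.qCoord w) (c.muCoord w)
    rw [c.ham_coord hw]
    exact (c.dmu_eq hw (hF.contMDiffAt (hΩ.mem_nhds hwΩ)) α).symm

include hΩ hF in
theorem ham_dq (hu : u ∈ c.dom) (huΩ : u ∈ Ω) (i : Fin n) :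
    ∀ᶠ p in 𝓝 (c.coord u), pdq i (c.ham F) p.1 p.2 = c.ham (c.dq i F) p.1 p.2 :=
  c.eventually_coord hΩ hu huΩ fun w hw hwΩ => by
    change _ = c.ham (c.dq i F) (c.qCoord w) (c.muCoord w)
    rw [c.ham_coord hw]
    exact (c.dq_eq hw (hF.contMDiffAt (hΩ.mem_nhds hwΩ)) i).symm

include hΩ hF in
theorem pdq_pdmu (hu : u ∈ c.dom) (huΩ : u ∈ Ω) (i : Fin n) (α : Fin m) :
    pdq i (pdmu α (c.ham F)) (c.qCoord u) (c.muCoord u) = c.dq i (c.dmu α F) u := by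
  rw [c.dq_eq hu (c.contMDiffAt_dmu hu (hF.contMDiffAt (hΩ.mem_nhds huΩ)) α)]
  exact pdq_congr (c.ham_dmu hΩ hF hu huΩ α) i

include hΩ hF in
theorem pdmu_pdmu (hu : u ∈ c.dom) (huΩ : u ∈ Ω) (α β : Fin m) :
    pdmu α (pdmu β (c.ham F)) (c.qCoord u) (c.muCoord u) = c.dmu α (c.dmu β F) u := by
  rw [c.dmu_eq hu (c.contMDiffAt_dmu hu (hF.contMDiffAt (hΩ.mem_nhds huΩ)) β)]
  exact pdmu_congr (c.ham_dmu hΩ hF hu huΩ β) α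

include hΩ hF in
theorem pdmu_pdq (hu : u ∈ c.dom) (huΩ : u ∈ Ω) (α : Fin m) (i : Fin n) :
    pdmu α (pdq i (c.ham F)) (c.qCoord u) (c.muCoord u) = c.dmu α (c.dq i F) u := by
  rw [c.dmu_eq hu (c.contMDiffAt_dq hu (hF.contMDiffAt (hΩ.mem_nhds huΩ)) i)]
  exact pdmu_congr (c.ham_dq hΩ hF hu huΩ i) α

/-- Second partial derivatives commute. -/
theorem fderiv_fderiv_comm {V : Type*} [NormedAddCommGroup V] [NormedSpace ℝ V] {f : V → ℝ} {p : V}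
    (hf : ContDiffAt ℝ ∞ f p) (v w : V) :
    fderiv ℝ (fun r => fderiv ℝ f r v) p w = fderiv ℝ (fun r => fderiv ℝ f r w) p v := by
  have h1 : ContDiffAt ℝ 2 f p := hf.of_le ENat.LEInfty.out
  have h2 : DifferentiableAt ℝ (fderiv ℝ f) p :=
    (h1.fderiv_right (m := 1) (by norm_num)).differentiableAt (by norm_num)
  have h3 : ∀ v w, fderiv ℝ (fun r => fderiv ℝ f r v) p w = fderiv ℝ (fderiv ℝ f) p w v :=
    fun v w => by
    rw [fderiv_clm_apply h2 (differentiableAt_const v)]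
    simp
  rw [h3, h3]
  exact h1.isSymmSndFDerivAt (by simp) w v

include hΩ hF in
theorem contDiffAt_ham (hu : u ∈ c.dom) (huΩ : u ∈ Ω) :
    ContDiffAt ℝ ∞ (fun r : Eu n × (Fin m → ℝ) => c.ham F r.1 r.2) (c.coord u) :=
  c.contDiffAt_comp_param hu (hF.contMDiffAt (hΩ.mem_nhds huΩ))

include hΩ hF in
theorem eventually_differentiableAt_ham (hu : u ∈ c.dom) (huΩ : u ∈ Ω) :
    ∀ᶠ p in 𝓝 (c.coord u),
      DifferentiableAt ℝ (fun r : Eu n × (Fin m → ℝ) => c.ham F r.1 r.2) p :=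
  c.eventually_coord hΩ hu huΩ fun _ hw hwΩ =>
    (c.contDiffAt_ham hΩ hF hw hwΩ).differentiableAt (by simp)

include hΩ hF in
theorem differentiableAt_pdmu (hu : u ∈ c.dom) (huΩ : u ∈ Ω) (α : Fin m) :
    DifferentiableAt ℝ (fun r : Eu n × (Fin m → ℝ) => pdmu α (c.ham F) r.1 r.2) (c.coord u) :=
  ((c.contDiffAt_comp_param hu (c.contMDiffAt_dmu hu
    (hF.contMDiffAt (hΩ.mem_nhds huΩ)) α)).differentiableAt (by simp)).congr_of_eventuallyEq
      (c.ham_dmu hΩ hF hu huΩ α)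

include hΩ hF in
theorem differentiableAt_pdq (hu : u ∈ c.dom) (huΩ : u ∈ Ω) (i : Fin n) :
    DifferentiableAt ℝ (fun r : Eu n × (Fin m → ℝ) => pdq i (c.ham F) r.1 r.2) (c.coord u) :=
  ((c.contDiffAt_comp_param hu (c.contMDiffAt_dq hu
    (hF.contMDiffAt (hΩ.mem_nhds huΩ)) i)).differentiableAt (by simp)).congr_of_eventuallyEq
      (c.ham_dq hΩ hF hu huΩ i)

include hΩ hF in
theorem dmu_dmu_comm (hu : u ∈ c.dom) (huΩ : u ∈ Ω) (α β : Fin m) :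
    c.dmu α (c.dmu β F) u = c.dmu β (c.dmu α F) u := by
  have h1 : ∀ α, (fun r : Eu n × (Fin m → ℝ) => pdmu α (c.ham F) r.1 r.2) =ᶠ[𝓝 (c.coord u)]
      fun r => fderiv ℝ (fun r : Eu n × (Fin m → ℝ) => c.ham F r.1 r.2) r
        (0, Pi.single α (1 : ℝ)) := fun α => by
    filter_upwards [c.eventually_differentiableAt_ham hΩ hF hu huΩ] with p hp
    exact pdmu_eq_fderiv hp α
  rw [← c.pdmu_pdmu hΩ hF hu huΩ, ← c.pdmu_pdmu hΩ hF hu huΩ]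
  refine (pdmu_eq_fderiv (c.differentiableAt_pdmu hΩ hF hu huΩ β) α).trans
    (Eq.trans ?_ (pdmu_eq_fderiv (c.differentiableAt_pdmu hΩ hF hu huΩ α) β).symm)
  rw [(h1 α).fderiv_eq, (h1 β).fderiv_eq]
  exact fderiv_fderiv_comm (c.contDiffAt_ham hΩ hF hu huΩ) _ _

include hΩ hF in
theorem dmu_dq_comm (hu : u ∈ c.dom) (huΩ : u ∈ Ω) (α : Fin m) (i : Fin n) :
    c.dmu α (c.dq i F) u = c.dq i (c.dmu α F) u := by
  have h1 : (fun r : Eu n × (Fin m → ℝ) => pdmu α (c.ham F) r.1 r.2) =ᶠ[𝓝 (c.coord u)]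
      fun r => fderiv ℝ (fun r : Eu n × (Fin m → ℝ) => c.ham F r.1 r.2) r
        (0, Pi.single α (1 : ℝ)) := by
    filter_upwards [c.eventually_differentiableAt_ham hΩ hF hu huΩ] with p hp
    exact pdmu_eq_fderiv hp α
  have h2 : (fun r : Eu n × (Fin m → ℝ) => pdq i (c.ham F) r.1 r.2) =ᶠ[𝓝 (c.coord u)]
      fun r => fderiv ℝ (fun r : Eu n × (Fin m → ℝ) => c.ham F r.1 r.2) r
        (EuclideanSpace.single i (1 : ℝ), 0) := by
    filter_upwards [c.eventually_differentiableAt_ham hΩ hF hu huΩ] with p hp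
    exact pdq_eq_fderiv hp i
  rw [← c.pdmu_pdq hΩ hF hu huΩ, ← c.pdq_pdmu hΩ hF hu huΩ]
  refine (pdmu_eq_fderiv (c.differentiableAt_pdq hΩ hF hu huΩ i) α).trans
    (Eq.trans ?_ (pdq_eq_fderiv (c.differentiableAt_pdmu hΩ hF hu huΩ α) i).symm)
  rw [h1.fderiv_eq, h2.fderiv_eq]
  exact fderiv_fderiv_comm (c.contDiffAt_ham hΩ hF hu huΩ) _ _

include hΩ hF in
/-- The vertical Hessian in local coordinates. -/
theorem fibreHess_eq (hu : u ∈ c.dom) (huΩ : u ∈ Ω)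
    (φ ψ : E u.proj →L[ℝ] Bundle.Trivial M ℝ u.proj) :
    fibreHess F u φ ψ = ∑ α, ∑ β, φ (c.s α u.proj) * ψ (c.s β u.proj) *
      c.dmu α (c.dmu β F) u := by
  set Φ : Eu n × (Fin m → ℝ) := (0, fun α => φ (c.s α u.proj)) with hΦ
  set Ψ : Eu n × (Fin m → ℝ) := (0, fun α => ψ (c.s α u.proj)) with hΨ
  let f : Eu n × (Fin m → ℝ) → ℝ := fun r => c.ham F r.1 r.2
  have h1 : ∀ s t : ℝ, F ⟨u.proj, u.snd + s • φ + t • ψ⟩ = f (c.coord u + s • Φ + t • Ψ) := by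
    intro s t
    have e1 := c.coord_add_smul (u := u) φ s
    have e2 := c.coord_add_smul (u := (⟨u.proj, u.snd + s • φ⟩ : DualTotal m E)) ψ t
    rw [e1] at e2
    change _ = F (c.param _)
    rw [← e2, c.param_coord]
    exact hu
  have hline : Filter.Tendsto (fun s : ℝ => c.coord u + s • Φ) (𝓝 0) (𝓝 (c.coord u)) := by
    have h2 : Continuous (fun s : ℝ => c.coord u + s • Φ) := by fun_prop
    simpa using h2.tendsto 0
  have h2 : (fun s : ℝ => deriv (fun t : ℝ => F ⟨u.proj, u.snd + s • φ + t • ψ⟩) 0) =ᶠ[𝓝 0]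
      fun s => ∑ β, ψ (c.s β u.proj) *
        (fun r : Eu n × (Fin m → ℝ) => pdmu β (c.ham F) r.1 r.2) (c.coord u + s • Φ) := by
    filter_upwards [hline.eventually (c.eventually_differentiableAt_ham hΩ hF hu huΩ)] with s hs
    simp only [h1]
    rw [deriv_line hs, fderiv_eq_sum hs]
    simp [hΨ]
  rw [fibreHess, h2.deriv_eq, Finset.sum_comm]
  have h3 : ∀ β, HasDerivAt (fun s : ℝ => (fun r : Eu n × (Fin m → ℝ) => pdmu β (c.ham F) r.1 r.2)
      (c.coord u + s • Φ)) (∑ α, φ (c.s α u.proj) * c.dmu α (c.dmu β F) u) 0 := fun β => by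
    have e0 := c.differentiableAt_pdmu hΩ hF hu huΩ β
    have e1 : HasFDerivAt (fun r : Eu n × (Fin m → ℝ) => pdmu β (c.ham F) r.1 r.2)
      (fderiv ℝ (fun r : Eu n × (Fin m → ℝ) => pdmu β (c.ham F) r.1 r.2) (c.coord u))
      (c.coord u + (0 : ℝ) • Φ) := by
      rw [zero_smul, add_zero]
      exact e0.hasFDerivAt
    have e2 := e1.comp_hasDerivAt (0 : ℝ) (hasDerivAt_line (c.coord u) Φ)
    rw [fderiv_eq_sum e0] at e2
    simp only [← c.pdmu_pdmu hΩ hF hu huΩ]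
    refine HasDerivAt.congr_deriv e2 ?_
    simp [hΦ, coord]
  rw [(HasDerivAt.fun_sum fun β _ => (h3 β).const_mul (ψ (c.s β u.proj))).deriv]
  refine Finset.sum_congr rfl fun β _ => ?_
  rw [Finset.mul_sum]
  refine Finset.sum_congr rfl fun α _ => ?_
  ring

theorem vertLift_injective (hu : u ∈ c.dom) : Function.Injective (vertLift (n := n) u) := by
  intro φ ψ h
  have h1 := c.coordDeriv_vertLift hu φ
  rw [h, c.coordDeriv_vertLift hu ψ] at h1
  exact c.covec_ext hu fun α => (congrFun (congrArg Prod.snd h1) α).symm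

variable {A : LieAlgebroid n m M E}

/-- `vertCoord` is an `invFun`, meaningful on the image of the injective vertical lift. A vertical
`p` has no `∂/∂q` components, so its tangent part is the lift of the covector with components `cP`.
-/
theorem vertCoord_apply (hu : u ∈ c.dom) {p : Prolong A u} (hp : p ∈ VertProlong A u) (α : Fin m) :
    vertCoord u p.1.2 (c.s α u.proj) = c.cP α p := by
  have h1 : vertLift u (c.dualCovec u.proj fun α => c.cP α p) = p.1.2 := by
    refine c.coordDeriv_injective hu ?_
    rw [c.coordDeriv_vertLift hu]
    refine Prod.ext (PiLp.ext fun i => ?_) (funext fun α => ?_)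
    · rw [c.coordDeriv_prolong_fst hu]
      simp [(c.mem_vertProlong_iff hu p).1 hp]
    · rw [c.coordDeriv_prolong_snd hu]
      exact c.dualCovec_frame hu _ α
  rw [vertCoord, ← h1, Function.leftInverse_invFun (c.vertLift_injective hu)]
  exact c.dualCovec_frame hu _ α

end LocalFrame

end CoordinateDerivatives

/-! ### The metric and the almost tangent structure of a regular Hamiltonian. -/

section Hamiltonian

variable {n m : ℕ} {M : Type*} [TopologicalSpace M] [ChartedSpace (Eu n) M]
  [IsManifold (𝓡 n) ∞ M] {E : M → Type*} [TopologicalSpace (TotalSpace (Eu m) E)]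
  [∀ x, AddCommGroup (E x)] [∀ x, Module ℝ (E x)] [∀ x, TopologicalSpace (E x)]
  [FiberBundle (Eu m) E] [VectorBundle ℝ (Eu m) E] [ContMDiffVectorBundle ∞ (Eu m) E (𝓡 n)]

namespace LocalFrame

variable (c : LocalFrame n m M E) (H : DualTotal m E → ℝ)

/-- `g^{αβ}` as a function on `E*`. -/
def gU (α β : Fin m) (u : DualTotal m E) : ℝ := c.gUp H (c.qCoord u) (c.muCoord u) α β

/-- `g_{αβ}` as a function on `E*`. -/
def gL (α β : Fin m) (u : DualTotal m E) : ℝ := c.gLow H α β (c.qCoord u) (c.muCoord u)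

variable {H} {Ω : Set (DualTotal m E)} (hΩ : IsOpen Ω) (hH : IsRegularHamiltonian n Ω H)
  {u : DualTotal m E} (hu : u ∈ c.dom) (huΩ : u ∈ Ω)

include hΩ hH hu huΩ

theorem gU_eq (α β : Fin m) : c.gU H α β u = c.dmu α (c.dmu β H) u :=
  c.pdmu_pdmu hΩ hH.smooth hu huΩ α β

theorem gU_comm (α β : Fin m) : c.gU H α β u = c.gU H β α u := by
  rw [c.gU_eq hΩ hH hu huΩ, c.gU_eq hΩ hH hu huΩ, c.dmu_dmu_comm hΩ hH.smooth hu huΩ]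

theorem contMDiffAt_gU (α β : Fin m) :
    ContMDiffAt (dualModel n m) 𝓘(ℝ, ℝ) ∞ (c.gU H α β) u := by
  refine (c.contMDiffAt_dmu hu (c.contMDiffAt_dmu hu
    (hH.smooth.contMDiffAt (hΩ.mem_nhds huΩ)) β) α).congr_of_eventuallyEq ?_
  filter_upwards [hΩ.mem_nhds huΩ, c.isOpen_dom.mem_nhds hu] with w hw hwd
  exact c.gU_eq hΩ hH hwd hw α β

theorem fibreHess_eq_gU (φ ψ : E u.proj →L[ℝ] Bundle.Trivial M ℝ u.proj) :
    fibreHess H u φ ψ = ∑ α, ∑ β, φ (c.s α u.proj) * ψ (c.s β u.proj) * c.gU H α β u := by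
  simp only [c.fibreHess_eq hΩ hH.smooth hu huΩ, c.gU_eq hΩ hH hu huΩ]

/-- A null vector of the matrix would be the component vector of a nonzero covector in the radical
of the vertical Hessian. -/
theorem det_gUp_ne_zero : (c.gUp H (c.qCoord u) (c.muCoord u)).det ≠ 0 := by
  intro h
  obtain ⟨v, hv0, hv⟩ := Matrix.exists_vecMul_eq_zero_iff.2 h
  refine hv0 ?_
  have h1 : c.dualCovec u.proj v = 0 := hH.nondegenerate u huΩ _ fun ψ => by
    rw [c.fibreHess_eq_gU hΩ hH hu huΩ, Finset.sum_comm]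
    refine Finset.sum_eq_zero fun β _ => ?_
    have h2 := congrFun hv β
    have h3 : ∑ α, v α * c.gU H α β u = 0 := h2
    simp only [c.dualCovec_frame hu]
    calc ∑ α, v α * ψ (c.s β u.proj) * c.gU H α β u
        = ψ (c.s β u.proj) * ∑ α, v α * c.gU H α β u := by
          rw [Finset.mul_sum]
          exact Finset.sum_congr rfl fun α _ => by ring
      _ = 0 := by rw [h3, mul_zero]
  funext α
  rw [← c.dualCovec_frame hu v α, h1]
  rfl

theorem contMDiffAt_gL (α β : Fin m) :
    ContMDiffAt (dualModel n m) 𝓘(ℝ, ℝ) ∞ (c.gL H α β) u :=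
  contMDiffAt_matrix_inv (c.contMDiffAt_gU hΩ hH hu huΩ) (c.det_gUp_ne_zero hΩ hH hu huΩ) α β

theorem sum_gU_gL (α γ : Fin m) :
    ∑ β, c.gU H α β u * c.gL H β γ u = if α = γ then 1 else 0 := by
  have h := Matrix.mul_nonsing_inv (c.gUp H (c.qCoord u) (c.muCoord u))
    (isUnit_iff_ne_zero.2 (c.det_gUp_ne_zero hΩ hH hu huΩ))
  have h1 := congrFun (congrFun h α) γ
  rwa [Matrix.mul_apply, Matrix.one_apply] at h1

theorem sum_gL_gU (α γ : Fin m) :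
    ∑ β, c.gL H α β u * c.gU H β γ u = if α = γ then 1 else 0 := by
  have h := Matrix.nonsing_inv_mul (c.gUp H (c.qCoord u) (c.muCoord u))
    (isUnit_iff_ne_zero.2 (c.det_gUp_ne_zero hΩ hH hu huΩ))
  have h1 := congrFun (congrFun h α) γ
  rwa [Matrix.mul_apply, Matrix.one_apply] at h1

theorem gL_comm (α β : Fin m) : c.gL H α β u = c.gL H β α u := by
  have h : (c.gUp H (c.qCoord u) (c.muCoord u)).transpose = c.gUp H (c.qCoord u) (c.muCoord u) := by
    ext α β
    exact c.gU_comm hΩ hH hu huΩ β α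
  have h1 := Matrix.transpose_nonsing_inv (c.gUp H (c.qCoord u) (c.muCoord u))
  rw [h] at h1
  exact congrFun (congrFun h1 β) α

theorem pdmu_gLow (γ α β : Fin m) :
    pdmu γ (c.gLow H α β) (c.qCoord u) (c.muCoord u) = c.dmu γ (c.gL H α β) u := by
  rw [c.dmu_eq hu (c.contMDiffAt_gL hΩ hH hu huΩ α β)]
  refine pdmu_congr (p := c.coord u) (c.eventually_coord hΩ hu huΩ fun w hw _ => ?_) γ
  exact (c.ham_coord (F := c.gL H α β) hw).symm

theorem pdq_gLow (i : Fin n) (α β : Fin m) :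
    pdq i (c.gLow H α β) (c.qCoord u) (c.muCoord u) = c.dq i (c.gL H α β) u := by
  rw [c.dq_eq hu (c.contMDiffAt_gL hΩ hH hu huΩ α β)]
  refine pdq_congr (p := c.coord u) (c.eventually_coord hΩ hu huΩ fun w hw _ => ?_) i
  exact (c.ham_coord (F := c.gL H α β) hw).symm

variable {A : LieAlgebroid n m M E}

/-- The metric on the vertical bundle in local coordinates. -/
theorem vertMetric_eq {p q : Prolong A u} (hp : p ∈ VertProlong A u) (hq : q ∈ VertProlong A u) :
    vertMetric A H u p q = ∑ α, ∑ β, c.cP α p * c.cP β q * c.gU H α β u := by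
  simp only [vertMetric, c.fibreHess_eq_gU hΩ hH hu huΩ, c.vertCoord_apply hu hp,
    c.vertCoord_apply hu hq]

/-- The ε-choice in `flat` is genuine, since lowering the index with `gL` gives a witness. Testing
the chosen covector on the dual frame and contracting with `gL` then recovers its components. -/
theorem flat_apply (a : E u.proj) (γ : Fin m) :
    flat H u a (c.s γ u.proj) = ∑ α, c.isFrame.coeff α u.proj a * c.gL H α γ u := by
  have hex : ∃ φ : E u.proj →L[ℝ] Bundle.Trivial M ℝ u.proj, ∀ ψ, fibreHess H u φ ψ = ψ a := by
    refine ⟨c.dualCovec u.proj fun γ => ∑ α, c.isFrame.coeff α u.proj a * c.gL H α γ u,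
      fun ψ => ?_⟩
    rw [c.fibreHess_eq_gU hΩ hH hu huΩ]
    simp only [c.dualCovec_frame hu]
    calc _ = ∑ β, ψ (c.s β u.proj) * ∑ α, c.isFrame.coeff α u.proj a *
          ∑ γ, c.gL H α γ u * c.gU H γ β u := by
          rw [Finset.sum_comm]
          refine Finset.sum_congr rfl fun β _ => ?_
          simp only [Finset.mul_sum, Finset.sum_mul]
          rw [Finset.sum_comm]
          exact Finset.sum_congr rfl fun α _ => Finset.sum_congr rfl fun γ _ => by ring
      _ = ψ (∑ β, c.isFrame.coeff β u.proj a • c.s β u.proj) := by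
          simp only [c.sum_gL_gU hΩ hH hu huΩ, mul_ite, mul_one, mul_zero, Finset.sum_ite_eq',
            Finset.mem_univ, if_true, map_sum, map_smul]
          exact Finset.sum_congr rfl fun β _ => mul_comm _ _
      _ = ψ a := by rw [c.sum_coeff hu]
  have h1 : ∀ ψ, fibreHess H u (flat H u a) ψ = ψ a := Classical.epsilon_spec hex
  have h2 : ∀ β, ∑ α, flat H u a (c.s α u.proj) * c.gU H α β u =
      c.isFrame.coeff β u.proj a := fun β => by
    have h3 := h1 (c.dualCovec u.proj (Pi.single β 1))
    rw [c.fibreHess_eq_gU hΩ hH hu huΩ, c.dualCovec_apply] at h3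
    simpa [c.dualCovec_frame hu, Pi.single_apply] using h3
  simp only [← h2, Finset.sum_mul]
  rw [Finset.sum_comm]
  simp only [mul_assoc, ← Finset.mul_sum, c.sum_gU_gL hΩ hH hu huΩ]
  simp

omit hΩ hH huΩ in
theorem vertLift_mem (φ : E u.proj →L[ℝ] Bundle.Trivial M ℝ u.proj) :
    ((0 : E u.proj), vertLift u φ) ∈ Prolong A u := by
  refine (c.mem_prolong_iff A hu _ _).2 fun i => ?_
  rw [← c.coordDeriv_fst hu, c.coordDeriv_vertLift hu]
  simp

omit hΩ hH huΩ in
theorem tangentStructure_val (p : Prolong A u) :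
    (tangentStructure A H u p).1 = (0, vertLift u (flat H u p.1.1)) := by
  rw [tangentStructure, dif_pos (c.vertLift_mem hu _)]

omit hΩ hH huΩ in
theorem cQ_tangentStructure (p : Prolong A u) (α : Fin m) :
    c.cQ α (tangentStructure A H u p) = 0 := by
  rw [cQ, c.tangentStructure_val hu, map_zero]

theorem cP_tangentStructure (p : Prolong A u) (β : Fin m) :
    c.cP β (tangentStructure A H u p) = ∑ α, c.cQ α p * c.gL H α β u := by
  rw [← c.coordDeriv_prolong_snd hu, c.tangentStructure_val hu, c.coordDeriv_vertLift hu]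
  exact c.flat_apply hΩ hH hu huΩ p.1.1 β

end LocalFrame

end Hamiltonian

/-! ### Existence and uniqueness of the Hamilton section. -/

section HamiltonSection

variable {n m : ℕ} {M : Type*} [TopologicalSpace M] [ChartedSpace (Eu n) M]
  [IsManifold (𝓡 n) ∞ M] {E : M → Type*} [TopologicalSpace (TotalSpace (Eu m) E)]
  [∀ x, AddCommGroup (E x)] [∀ x, Module ℝ (E x)] [∀ x, TopologicalSpace (E x)]
  [FiberBundle (Eu m) E] [VectorBundle ℝ (Eu m) E] [ContMDiffVectorBundle ∞ (Eu m) E (𝓡 n)]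

namespace LocalFrame

variable [T2Space M] (c : LocalFrame n m M E) {A : LieAlgebroid n m M E}
  {H : DualTotal m E → ℝ} {Ω : Set (DualTotal m E)} {u : DualTotal m E}

/-- Nondegeneracy of `ω_E`. Pairing with `𝒫^β` reads off the `𝒬`-coordinates; once these agree, so
do the structure-function terms, and pairing with `𝒬_β` reads off the `𝒫`-coordinates. -/
theorem symp_ext (hu : u ∈ c.dom) {p q : Prolong A u} (h : ∀ r, c.symp A p r = c.symp A q r) :
    p = q := by
  have hQ : ∀ β, c.cQ β p = c.cQ β q := fun β => by
    obtain ⟨r, hrQ, hrP⟩ := c.exists_prolong A hu 0 (Pi.single β 1)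
    simpa [symp, hrQ, hrP, Pi.single_apply] using h r
  refine c.prolong_ext hu hQ fun β => ?_
  obtain ⟨r, hrQ, hrP⟩ := c.exists_prolong A hu (Pi.single β 1) 0
  simpa [symp, hrQ, hrP, hQ, Pi.single_apply] using h r

/-- Both sides compute the frame-free `symplectic` on global sections through `p` and `q`. -/
theorem symp_eq_symp (c' : LocalFrame n m M E) (hu : u ∈ c.dom) (hu' : u ∈ c'.dom)
    (p q : Prolong A u) : c.symp A p q = c'.symp A p q := by
  obtain ⟨ρ₁, h₁, rfl⟩ := c.exists_section_eq hu p
  obtain ⟨ρ₂, h₂, rfl⟩ := c.exists_section_eq hu q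
  rw [← c.symplectic_eq hu (h₁ u) (h₂ u), c'.symplectic_eq hu' (h₁ u) (h₂ u)]

variable (A H) in
/-- The coordinates `ρ_β` of the Hamilton section. -/
def hamP (β : Fin m) (u : DualTotal m E) : ℝ :=
  -∑ i, c.sig A β i u.proj * c.dq i H u
    + ∑ α, ∑ γ, c.muCoord u γ * c.str A α β γ u.proj * c.dmu α H u

/-- Comparison of coefficients: those of the `𝒫`-coordinates of `q` give `∂H/∂μ_α`, and those of its
`𝒬`-coordinates then give `hamP`, whose second sum comes from the structure functions in `ω_E`. -/
theorem symp_of_coords (hu : u ∈ c.dom) (hH : ContMDiffAt (dualModel n m) 𝓘(ℝ, ℝ) ∞ H u)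
    {p : Prolong A u} (hQ : ∀ α, c.cQ α p = c.dmu α H u) (hP : ∀ β, c.cP β p = c.hamP A H β u)
    (q : Prolong A u) : c.symp A p q = dirDeriv (dualModel n m) H u q.1.2 := by
  rw [c.dirDeriv_eq_dq_dmu hu hH, symp, Finset.sum_comm, ← Finset.sum_add_distrib,
    ← Finset.sum_add_distrib]
  refine Finset.sum_congr rfl fun β _ => ?_
  rw [hQ, hP, hamP]
  have e1 : ∑ α, ∑ γ, c.muCoord u γ * c.str A α β γ u.proj * c.cQ α p * c.cQ β q =
      (∑ α, ∑ γ, c.muCoord u γ * c.str A α β γ u.proj * c.dmu α H u) * c.cQ β q := by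
    simp only [hQ, Finset.sum_mul]
  rw [e1]
  ring

theorem str_skew {x : M} (α β γ : Fin m) : c.str A β α γ x = -c.str A α β γ x := by
  rw [str, A.bracket_skew]
  exact map_neg (c.isFrame.coeff γ x) _

theorem contMDiffAt_str (hu : u ∈ c.dom) (α β γ : Fin m) :
    ContMDiffAt (dualModel n m) 𝓘(ℝ, ℝ) ∞ (fun w : DualTotal m E => c.str A α β γ w.proj) u :=
  contMDiffAt_comp_proj (c.contMDiffAt_coeff_section hu _ γ)

theorem contMDiffAt_hamP (hu : u ∈ c.dom) (hH : ContMDiffAt (dualModel n m) 𝓘(ℝ, ℝ) ∞ H u)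
    (β : Fin m) : ContMDiffAt (dualModel n m) 𝓘(ℝ, ℝ) ∞ (c.hamP A H β) u := by
  refine ContMDiffAt.add (ContMDiffAt.neg (ContMDiffAt.sum fun i _ => ?_))
    (ContMDiffAt.sum fun α _ => ContMDiffAt.sum fun γ _ => ?_)
  · exact (contMDiffAt_comp_proj (c.contMDiffAt_sig A hu β i)).mul (c.contMDiffAt_dq hu hH i)
  · exact ((c.contMDiffAt_muCoord u γ).mul (c.contMDiffAt_str hu α β γ)).mul
      (c.contMDiffAt_dmu hu hH α)

end LocalFrame

variable [T2Space M] {A : LieAlgebroid n m M E} {H : DualTotal m E → ℝ}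
  {Ω : Set (DualTotal m E)} {ρ : ∀ u, Prolong A u}

/-- The section `ρ` has the coordinates of the Hamilton section of `H` in all local frames. -/
def HasHamiltonCoords (A : LieAlgebroid n m M E) (Ω : Set (DualTotal m E))
    (H : DualTotal m E → ℝ) (ρ : ∀ u, Prolong A u) : Prop :=
  ∀ u ∈ Ω, ∀ c : LocalFrame n m M E, u ∈ c.dom →
    (∀ α, c.cQ α (ρ u) = c.dmu α H u) ∧ ∀ β, c.cP β (ρ u) = c.hamP A H β u

variable (A) in
-- At each point the vector is prescribed in one frame. The vector prescribed in any other frame is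
-- the same, because both represent `dH` under a nondegenerate form that does not depend on the
-- frame.
theorem exists_hasHamiltonCoords (hΩ : IsOpen Ω)
    (hH : ContMDiffOn (dualModel n m) 𝓘(ℝ, ℝ) ∞ H Ω) :
    ∃ ρ : ∀ u, Prolong A u, HasHamiltonCoords A Ω H ρ := by
  have h1 : ∀ u, ∃ p : Prolong A u, u ∈ Ω → ∀ c : LocalFrame n m M E, u ∈ c.dom →
      (∀ α, c.cQ α p = c.dmu α H u) ∧ ∀ β, c.cP β p = c.hamP A H β u := by
    intro u
    by_cases hu : u ∈ Ω
    · obtain ⟨c₀, hc₀⟩ := exists_localFrame n m E u.proj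
      have hHu := hH.contMDiffAt (hΩ.mem_nhds hu)
      obtain ⟨p, hQ, hP⟩ := c₀.exists_prolong A hc₀ (fun α => c₀.dmu α H u)
        (fun β => c₀.hamP A H β u)
      refine ⟨p, fun _ c hc => ?_⟩
      obtain ⟨p', hQ', hP'⟩ := c.exists_prolong A hc (fun α => c.dmu α H u)
        (fun β => c.hamP A H β u)
      have h2 : p = p' := c.symp_ext hc fun r => by
        rw [c.symp_eq_symp c₀ hc hc₀, c₀.symp_of_coords hc₀ hHu hQ hP,
          c.symp_of_coords hc hHu hQ' hP']
      rw [h2]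
      exact ⟨hQ', hP'⟩
    · exact ⟨0, fun h => absurd h hu⟩
  choose ρ hρ using h1
  exact ⟨ρ, fun u hu => hρ u hu⟩

namespace HasHamiltonCoords

theorem smoothProlongAt (hρ : HasHamiltonCoords A Ω H ρ) (hΩ : IsOpen Ω)
    (hH : ContMDiffOn (dualModel n m) 𝓘(ℝ, ℝ) ∞ H Ω) {u : DualTotal m E} (hu : u ∈ Ω) :
    SmoothProlongAt A ρ u := by
  obtain ⟨c, hc⟩ := exists_localFrame n m E u.proj
  have hHu := hH.contMDiffAt (hΩ.mem_nhds hu)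
  refine (c.smoothProlongAt_iff hc).2 ⟨fun α => ?_, fun α => ?_⟩
  · refine (c.contMDiffAt_dmu hc hHu α).congr_of_eventuallyEq ?_
    filter_upwards [hΩ.mem_nhds hu, c.isOpen_dom.mem_nhds hc] with w hw hwc
    exact (hρ w hw c hwc).1 α
  · refine (c.contMDiffAt_hamP (A := A) hc hHu α).congr_of_eventuallyEq ?_
    filter_upwards [hΩ.mem_nhds hu, c.isOpen_dom.mem_nhds hc] with w hw hwc
    exact (hρ w hw c hwc).2 α

theorem isHamiltonSection (hρ : HasHamiltonCoords A Ω H ρ) (hΩ : IsOpen Ω)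
    (hH : ContMDiffOn (dualModel n m) 𝓘(ℝ, ℝ) ∞ H Ω) : IsHamiltonSection A Ω H ρ := by
  refine ⟨(smoothProlong_iff hΩ).2 fun u hu => hρ.smoothProlongAt hΩ hH hu, fun ν hν u hu => ?_⟩
  obtain ⟨c, hc⟩ := exists_localFrame n m E u.proj
  rw [c.symplectic_eq hc (hρ.smoothProlongAt hΩ hH hu) (hν.at hΩ hu)]
  exact c.symp_of_coords hc (hH.contMDiffAt (hΩ.mem_nhds hu)) (hρ u hu c hc).1 (hρ u hu c hc).2 _

theorem eq_of_isHamiltonSection (hρ : HasHamiltonCoords A Ω H ρ) (hΩ : IsOpen Ω)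
    (hH : ContMDiffOn (dualModel n m) 𝓘(ℝ, ℝ) ∞ H Ω) {ρ' : ∀ u, Prolong A u}
    (hρ' : IsHamiltonSection A Ω H ρ') {u : DualTotal m E} (hu : u ∈ Ω) : ρ' u = ρ u := by
  obtain ⟨c, hc⟩ := exists_localFrame n m E u.proj
  refine c.symp_ext hc fun r => ?_
  obtain ⟨ν, hν, rfl⟩ := c.exists_section_eq hc r
  have h1 := hρ'.2 ν ((smoothProlong_iff hΩ).2 fun w _ => hν w) u hu
  rw [c.symplectic_eq hc (hρ'.1.at hΩ hu) (hν u)] at h1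
  rw [h1]
  exact (c.symp_of_coords hc (hH.contMDiffAt (hΩ.mem_nhds hu)) (hρ u hu c hc).1
    (hρ u hu c hc).2 _).symm

end HasHamiltonCoords

/-! ### Canonical coefficients and the Lie derivative of the almost tangent structure. -/

namespace LocalFrame

variable (c : LocalFrame n m M E) {u : DualTotal m E}

theorem cQ_sum {ι : Type*} (S : Finset ι) (p : ι → Prolong A u) (α : Fin m) :
    c.cQ α (∑ i ∈ S, p i) = ∑ i ∈ S, c.cQ α (p i) := by
  classical
  induction S using Finset.induction_on with
  | empty => simpa using c.cQ_zero α
  | insert a S ha ih => rw [Finset.sum_insert ha, cQ_add, ih, Finset.sum_insert ha]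

theorem cP_sum {ι : Type*} (S : Finset ι) (p : ι → Prolong A u) (α : Fin m) :
    c.cP α (∑ i ∈ S, p i) = ∑ i ∈ S, c.cP α (p i) := by
  classical
  induction S using Finset.induction_on with
  | empty => simpa using c.cP_zero α
  | insert a S ha ih => rw [Finset.sum_insert ha, cP_add, ih, Finset.sum_insert ha]

theorem frameP_mem (hu : u ∈ c.dom) (α : Fin m) : c.frameP α u ∈ Prolong A u := by
  refine (c.mem_prolong_iff A hu _ _).2 fun i => ?_
  rw [← c.coordDeriv_fst hu, c.coordDeriv_partialMu hu]
  simp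

theorem cQ_frameP (hu : u ∈ c.dom) (α β : Fin m) :
    c.cQ β (⟨c.frameP α u, c.frameP_mem hu α⟩ : Prolong A u) = 0 :=
  map_zero (c.isFrame.coeff β u.proj)

theorem cP_frameP (hu : u ∈ c.dom) (α β : Fin m) :
    c.cP β (⟨c.frameP α u, c.frameP_mem hu α⟩ : Prolong A u) = if β = α then 1 else 0 := by
  rw [← c.coordDeriv_prolong_snd hu, ← Pi.single_apply]
  exact congrFun (congrArg Prod.snd (c.coordDeriv_partialMu hu α)) β

theorem frameQ_mem (hu : u ∈ c.dom) (α : Fin m) : c.frameQ A α u ∈ Prolong A u := by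
  refine (c.mem_prolong_iff A hu _ _).2 fun i => ?_
  have h1 : ∀ j, dirDeriv (dualModel n m) (fun w => c.qCoord w i) u (c.partialQ j u) =
      (EuclideanSpace.single j (1 : ℝ) : Eu n) i := fun j => by
    rw [← c.coordDeriv_fst hu, c.coordDeriv_partialQ hu]
  rw [dirDeriv_sum_right]
  simp only [dirDeriv_smul_right, h1]
  simp [c.coeff_frame hu]

theorem cQ_frameQ (hu : u ∈ c.dom) (α β : Fin m) :
    c.cQ β (⟨c.frameQ A α u, c.frameQ_mem hu α⟩ : Prolong A u) = if β = α then 1 else 0 :=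
  c.coeff_frame hu β α

theorem cP_frameQ (hu : u ∈ c.dom) (α β : Fin m) :
    c.cP β (⟨c.frameQ A α u, c.frameQ_mem hu α⟩ : Prolong A u) = 0 := by
  change dirDeriv (dualModel n m) (fun w => c.muCoord w β) u
    (∑ i, c.sig A α i u.proj • c.partialQ i u) = 0
  have h1 : ∀ j, dirDeriv (dualModel n m) (fun w => c.muCoord w β) u (c.partialQ j u) = 0 :=
    fun j => by
      rw [← c.coordDeriv_snd hu, c.coordDeriv_partialQ hu]
      rfl
  rw [dirDeriv_sum_right]
  simp only [dirDeriv_smul_right, h1, mul_zero, Finset.sum_const_zero]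

theorem dmu_comp_proj (A : LieAlgebroid n m M E) (hu : u ∈ c.dom) {f : M → ℝ}
    (hf : ContMDiffAt (𝓡 n) 𝓘(ℝ, ℝ) ∞ f u.proj) (ε : Fin m) :
    c.dmu ε (fun w => f w.proj) u = 0 := by
  have h := c.dirDeriv_comp_proj_prolong hu hf
    (⟨c.frameP ε u, c.frameP_mem hu ε⟩ : Prolong A u)
  simp only [c.cQ_frameP hu, zero_mul, Finset.sum_const_zero] at h
  exact h

theorem dmu_muCoord (hu : u ∈ c.dom) (ε γ : Fin m) :
    c.dmu ε (fun w => c.muCoord w γ) u = if γ = ε then 1 else 0 := by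
  rw [dmu, ← c.coordDeriv_snd hu, c.coordDeriv_partialMu hu]
  exact Pi.single_apply ε 1 γ

variable (hΩ : IsOpen Ω) (hH : IsRegularHamiltonian n Ω H) (hu : u ∈ c.dom) (huΩ : u ∈ Ω)

include hΩ hH hu huΩ

/-- Along the fibre only `μ_γ` and the derivatives of `H` vary, since `σ` and the structure
functions live on `M`. The second sum comes from `∂μ_γ/∂μ_ε`, the third from the Hessian of `H`. -/
theorem dmu_hamP (ε β : Fin m) :
    c.dmu ε (c.hamP A H β) u =
      -∑ i, c.sig A β i u.proj * c.dq i (c.dmu ε H) u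
        + ∑ α, c.str A α β ε u.proj * c.dmu α H u
        + ∑ α, ∑ γ, c.muCoord u γ * c.str A α β γ u.proj * c.gU H ε α u := by
  have hHu := hH.smooth.contMDiffAt (hΩ.mem_nhds huΩ)
  have hs : ∀ i, ContMDiffAt (dualModel n m) 𝓘(ℝ, ℝ) ∞
      (fun w : DualTotal m E => c.sig A β i w.proj) u := fun i =>
    contMDiffAt_comp_proj (c.contMDiffAt_sig A hu β i)
  have hds : ∀ i, dirDeriv (dualModel n m) (fun w : DualTotal m E => c.sig A β i w.proj) u
      (c.partialMu ε u) = 0 := fun i => c.dmu_comp_proj A hu (c.contMDiffAt_sig A hu β i) ε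
  have ht : ∀ α γ, ContMDiffAt (dualModel n m) 𝓘(ℝ, ℝ) ∞
      (fun w : DualTotal m E => c.str A α β γ w.proj) u := fun α γ => c.contMDiffAt_str hu α β γ
  have hdt : ∀ α γ, dirDeriv (dualModel n m) (fun w : DualTotal m E => c.str A α β γ w.proj) u
      (c.partialMu ε u) = 0 := fun α γ =>
    c.dmu_comp_proj A hu (c.contMDiffAt_coeff_section hu _ γ) ε
  have hmu : ∀ γ, ContMDiffAt (dualModel n m) 𝓘(ℝ, ℝ) ∞ (fun w => c.muCoord w γ) u :=
    fun γ => c.contMDiffAt_muCoord u γ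
  have hdmu : ∀ γ, dirDeriv (dualModel n m) (fun w => c.muCoord w γ) u (c.partialMu ε u) =
      if γ = ε then 1 else 0 := fun γ => c.dmu_muCoord hu ε γ
  have hq : ∀ i, ContMDiffAt (dualModel n m) 𝓘(ℝ, ℝ) ∞ (fun w => c.dq i H w) u :=
    fun i => c.contMDiffAt_dq hu hHu i
  have hdq : ∀ i, dirDeriv (dualModel n m) (fun w => c.dq i H w) u (c.partialMu ε u) =
      c.dq i (c.dmu ε H) u := fun i => c.dmu_dq_comm hΩ hH.smooth hu huΩ ε i
  have hm : ∀ α, ContMDiffAt (dualModel n m) 𝓘(ℝ, ℝ) ∞ (fun w => c.dmu α H w) u :=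
    fun α => c.contMDiffAt_dmu hu hHu α
  have hdm : ∀ α, dirDeriv (dualModel n m) (fun w => c.dmu α H w) u (c.partialMu ε u) =
      c.gU H ε α u := fun α => (c.gU_eq hΩ hH hu huΩ ε α).symm
  have md : ∀ {f : DualTotal m E → ℝ}, ContMDiffAt (dualModel n m) 𝓘(ℝ, ℝ) ∞ f u →
      MDifferentiableAt (dualModel n m) 𝓘(ℝ, ℝ) f u := fun hf => hf.mdifferentiableAt (by simp)
  have m1 : ∀ i, ContMDiffAt (dualModel n m) 𝓘(ℝ, ℝ) ∞
      (fun w : DualTotal m E => c.sig A β i w.proj * c.dq i H w) u := fun i => (hs i).mul (hq i)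
  have m2 : ∀ α γ, ContMDiffAt (dualModel n m) 𝓘(ℝ, ℝ) ∞
      (fun w : DualTotal m E => c.muCoord w γ * c.str A α β γ w.proj) u :=
    fun α γ => (hmu γ).mul (ht α γ)
  have m3 : ∀ α γ, ContMDiffAt (dualModel n m) 𝓘(ℝ, ℝ) ∞
      (fun w : DualTotal m E => c.muCoord w γ * c.str A α β γ w.proj * c.dmu α H w) u :=
    fun α γ => (m2 α γ).mul (hm α)
  have e1 : dirDeriv (dualModel n m)
      (fun w : DualTotal m E => ∑ i, c.sig A β i w.proj * c.dq i H w) u (c.partialMu ε u) =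
      ∑ i, c.sig A β i u.proj * c.dq i (c.dmu ε H) u := by
    rw [dirDeriv_sum _ fun i _ => md (m1 i)]
    refine Finset.sum_congr rfl fun i _ => ?_
    rw [dirDeriv_mul (md (hs i)) (md (hq i)), hds, hdq, zero_mul, add_zero]
  have e2 : dirDeriv (dualModel n m) (fun w : DualTotal m E =>
        ∑ α, ∑ γ, c.muCoord w γ * c.str A α β γ w.proj * c.dmu α H w) u (c.partialMu ε u) =
      ∑ α, ∑ γ, (c.muCoord u γ * c.str A α β γ u.proj * c.gU H ε α u
        + (if γ = ε then 1 else 0) * c.str A α β γ u.proj * c.dmu α H u) := by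
    rw [dirDeriv_sum _ fun α _ => md (ContMDiffAt.sum fun γ _ => m3 α γ)]
    refine Finset.sum_congr rfl fun α _ => ?_
    rw [dirDeriv_sum _ fun γ _ => md (m3 α γ)]
    refine Finset.sum_congr rfl fun γ _ => ?_
    rw [dirDeriv_mul (md (m2 α γ)) (md (hm α)),
      dirDeriv_mul (md (hmu γ)) (md (ht α γ)), hdm, hdmu, hdt, mul_zero, zero_add]
  have e3 : c.dmu ε (c.hamP A H β) u =
      dirDeriv (dualModel n m) (fun w : DualTotal m E =>
        -(∑ i, c.sig A β i w.proj * c.dq i H w) +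
          ∑ α, ∑ γ, c.muCoord w γ * c.str A α β γ w.proj * c.dmu α H w) u (c.partialMu ε u) := rfl
  rw [e3, dirDeriv_add (md (ContMDiffAt.sum fun i _ => m1 i).neg)
    (md (ContMDiffAt.sum fun α _ => ContMDiffAt.sum fun γ _ => m3 α γ)), dirDeriv_neg, e1, e2]
  simp only [Finset.sum_add_distrib, ite_mul, one_mul, zero_mul, Finset.sum_ite_eq',
    Finset.mem_univ, if_true]
  ring

variable (A H) in
omit hΩ hH hu huΩ in
/-- The coefficients of the canonical nonlinear connection in terms of the Hamilton section. -/
def connCoeff (ρ : ∀ u, Prolong A u) (α β : Fin m) (u : DualTotal m E) : ℝ :=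
  (1 / 2) * (-dirDeriv (dualModel n m) (c.gL H α β) u (ρ u).1.2
    + ∑ ε, c.gL H α ε u * c.dmu ε (c.hamP A H β) u
    + ∑ ε, c.gL H β ε u * c.dmu ε (c.hamP A H α) u
    + ∑ γ, c.muCoord u γ * c.str A α β γ u.proj)

/-- The contraction with `g_{αε}` meets `g^{εδ}` in the last sum of `dmu_hamP` and collapses it to
`μ_γ L^γ_{αβ}`. -/
theorem sum_gL_dmu_hamP (α β : Fin m) :
    ∑ ε, c.gL H α ε u * c.dmu ε (c.hamP A H β) u =
      -∑ i, ∑ ε, c.dq i (c.dmu ε H) u * (c.sig A β i u.proj * c.gL H α ε u)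
        + ∑ δ, ∑ ε, c.dmu δ H u * (c.gL H α ε u * c.str A δ β ε u.proj)
        + ∑ γ, c.muCoord u γ * c.str A α β γ u.proj := by
  simp only [c.dmu_hamP hΩ hH hu huΩ, mul_add, Finset.sum_add_distrib, mul_neg,
    Finset.sum_neg_distrib]
  have e1 : ∑ ε, c.gL H α ε u * ∑ i, c.sig A β i u.proj * c.dq i (c.dmu ε H) u =
      ∑ i, ∑ ε, c.dq i (c.dmu ε H) u * (c.sig A β i u.proj * c.gL H α ε u) := by
    simp only [Finset.mul_sum]
    rw [Finset.sum_comm]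
    exact Finset.sum_congr rfl fun i _ => Finset.sum_congr rfl fun ε _ => by ring
  have e2 : ∑ ε, c.gL H α ε u * ∑ δ, c.str A δ β ε u.proj * c.dmu δ H u =
      ∑ δ, ∑ ε, c.dmu δ H u * (c.gL H α ε u * c.str A δ β ε u.proj) := by
    simp only [Finset.mul_sum]
    rw [Finset.sum_comm]
    exact Finset.sum_congr rfl fun i _ => Finset.sum_congr rfl fun ε _ => by ring
  have e3 : ∑ ε, c.gL H α ε u * ∑ δ, ∑ γ, c.muCoord u γ * c.str A δ β γ u.proj * c.gU H ε δ u =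
      ∑ γ, c.muCoord u γ * c.str A α β γ u.proj := by
    calc _ = ∑ δ, (∑ ε, c.gL H α ε u * c.gU H ε δ u) *
          ∑ γ, c.muCoord u γ * c.str A δ β γ u.proj := by
          simp only [Finset.mul_sum, Finset.sum_mul]
          rw [Finset.sum_comm]
          refine Finset.sum_congr rfl fun δ _ => ?_
          rw [Finset.sum_comm]
          exact Finset.sum_congr rfl fun i _ => Finset.sum_congr rfl fun ε _ => by ring
      _ = _ := by
          simp only [c.sum_gL_gU hΩ hH hu huΩ, ite_mul, one_mul, zero_mul, Finset.sum_ite_eq,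
            Finset.mem_univ, if_true]
  rw [e1, e2, e3]

variable (hρ : HasHamiltonCoords A Ω H ρ)

include hρ

/-- Inserting the coordinates of `ρ` into `-ρ(g_{αβ})` gives the terms with derivatives of `g_{αβ}`;
the two contractions of `dmu_hamP` give the rest. Their `μ_γ L^γ` parts have opposite index order
and cancel by skewness, so only the copy present in `connCoeff` survives. -/
theorem connCoeff_eq (α β : Fin m) : c.connCoeff A H ρ α β u = c.canonicalCoeff A H α β u := by
  have h1 := c.sum_gL_dmu_hamP (A := A) hΩ hH hu huΩ α β
  have h2 := c.sum_gL_dmu_hamP (A := A) hΩ hH hu huΩ β α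
  have hHu := hH.smooth.contMDiffAt (hΩ.mem_nhds huΩ)
  have hdq : ∀ i, pdq i (c.ham H) (c.qCoord u) (c.muCoord u) = c.dq i H u :=
    fun i => (c.dq_eq hu hHu i).symm
  have hdmu : ∀ α, pdmu α (c.ham H) (c.qCoord u) (c.muCoord u) = c.dmu α H u :=
    fun α => (c.dmu_eq hu hHu α).symm
  have hg : ∀ α β, c.gLow H α β (c.qCoord u) (c.muCoord u) = c.gL H α β u := fun _ _ => rfl
  have e1 : -dirDeriv (dualModel n m) (c.gL H α β) u (ρ u).1.2 =
      ∑ γ, ∑ i, c.sig A γ i u.proj * (c.dmu γ (c.gL H α β) u * c.dq i H u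
        - c.dq i (c.gL H α β) u * c.dmu γ H u)
      + ∑ γ, ∑ ε, ∑ κ, c.muCoord u γ * c.str A κ ε γ u.proj * c.dmu ε H u *
          c.dmu κ (c.gL H α β) u := by
    rw [c.dirDeriv_eq_dq_dmu hu (c.contMDiffAt_gL hΩ hH hu huΩ α β)]
    simp only [(hρ u huΩ c hu).1, (hρ u huΩ c hu).2, hamP, add_mul, Finset.sum_add_distrib,
      mul_sub, Finset.sum_sub_distrib, neg_mul, Finset.sum_neg_distrib]
    have s1 : ∑ γ, (∑ i, c.sig A γ i u.proj * c.dq i H u) * c.dmu γ (c.gL H α β) u =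
        ∑ γ, ∑ i, c.sig A γ i u.proj * (c.dmu γ (c.gL H α β) u * c.dq i H u) := by
      simp only [Finset.sum_mul]
      exact Finset.sum_congr rfl fun i _ => Finset.sum_congr rfl fun ε _ => by ring
    have s2 : ∑ γ, c.dmu γ H u * ∑ i, c.sig A γ i u.proj * c.dq i (c.gL H α β) u =
        ∑ γ, ∑ i, c.sig A γ i u.proj * (c.dq i (c.gL H α β) u * c.dmu γ H u) := by
      simp only [Finset.mul_sum]
      exact Finset.sum_congr rfl fun i _ => Finset.sum_congr rfl fun ε _ => by ring
    have s3 : ∑ κ, (∑ ε, ∑ γ, c.muCoord u γ * c.str A ε κ γ u.proj * c.dmu ε H u) *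
          c.dmu κ (c.gL H α β) u =
        -∑ γ, ∑ ε, ∑ κ, c.muCoord u γ * c.str A κ ε γ u.proj * c.dmu ε H u *
          c.dmu κ (c.gL H α β) u := by
      simp only [Finset.sum_mul, ← Finset.sum_neg_distrib]
      rw [Finset.sum_comm' (t' := Finset.univ) (s' := fun _ => Finset.univ) (by simp)]
      simp_rw [Finset.sum_comm (s := (Finset.univ : Finset (Fin m)))
        (f := fun κ γ => c.muCoord u γ * _ * _ * _)]
      rw [Finset.sum_comm]
      refine Finset.sum_congr rfl fun γ _ => Finset.sum_congr rfl fun ε _ =>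
        Finset.sum_congr rfl fun κ _ => ?_
      rw [c.str_skew κ ε γ]
      ring
    rw [s1, s2, s3]
    ring
  have e2 : ∑ γ, c.muCoord u γ * c.str A β α γ u.proj =
      -∑ γ, c.muCoord u γ * c.str A α β γ u.proj := by
    simp only [c.str_skew α β, mul_neg, Finset.sum_neg_distrib]
  rw [connCoeff, h1, h2, e1, e2, canonicalCoeff]
  simp only [c.pdmu_gLow hΩ hH hu huΩ, c.pdq_gLow hΩ hH hu huΩ, c.pdq_pdmu hΩ hH.smooth hu huΩ,
    hdq, hdmu, hg, mul_add, Finset.sum_add_distrib]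
  ring

/-- The Lie derivative `-ℒ_ρ 𝒥_H` in local coordinates. -/
theorem lieDeriv_coords {ν : ∀ u, Prolong A u} (hν : SmoothProlongAt A ν u) :
    (∀ α, c.cQ α (-(prolongBracket A ρ (fun w => tangentStructure A H w (ν w)) u
      - tangentStructure A H u (prolongBracket A ρ ν u))) = c.cQ α (ν u)) ∧
    ∀ β, c.cP β (-(prolongBracket A ρ (fun w => tangentStructure A H w (ν w)) u
      - tangentStructure A H u (prolongBracket A ρ ν u))) =
        -c.cP β (ν u) + 2 * ∑ α, c.connCoeff A H ρ α β u * c.cQ α (ν u) := by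
  have hHu := hH.smooth.contMDiffAt (hΩ.mem_nhds huΩ)
  have hρs := hρ.smoothProlongAt hΩ hH.smooth huΩ
  have md : ∀ {f : DualTotal m E → ℝ}, ContMDiffAt (dualModel n m) 𝓘(ℝ, ℝ) ∞ f u →
      MDifferentiableAt (dualModel n m) 𝓘(ℝ, ℝ) f u := fun hf => hf.mdifferentiableAt (by simp)
  have hnear : ∀ᶠ w in 𝓝 u, w ∈ Ω ∧ w ∈ c.dom :=
    (show ∀ᶠ w in 𝓝 u, w ∈ Ω from hΩ.mem_nhds huΩ).and (c.isOpen_dom.mem_nhds hu)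
  obtain ⟨hνQ, hνP⟩ := (c.smoothProlongAt_iff hu).1 hν
  have hg := c.contMDiffAt_gL hΩ hH hu huΩ
  have jQ : ∀ α, (fun w => c.cQ α (tangentStructure A H w (ν w))) =ᶠ[𝓝 u] fun _ => 0 := fun α => by
    filter_upwards [hnear] with w hw
    exact c.cQ_tangentStructure hw.2 _ α
  have jP : ∀ β, (fun w => c.cP β (tangentStructure A H w (ν w))) =ᶠ[𝓝 u]
      fun w => ∑ α, c.cQ α (ν w) * c.gL H α β w := fun β => by
    filter_upwards [hnear] with w hw
    exact c.cP_tangentStructure hΩ hH hw.2 hw.1 _ β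
  have hJ : SmoothProlongAt A (fun w => tangentStructure A H w (ν w)) u :=
    (c.smoothProlongAt_iff hu).2
      ⟨fun α => contMDiffAt_const.congr_of_eventuallyEq (jQ α), fun β =>
        (ContMDiffAt.sum fun α _ => (hνQ α).mul (hg α β)).congr_of_eventuallyEq (jP β)⟩
  have rQ : ∀ γ, (fun w => c.cQ γ (ρ w)) =ᶠ[𝓝 u] fun w => c.dmu γ H w := fun γ => by
    filter_upwards [hnear] with w hw
    exact (hρ w hw.1 c hw.2).1 γ
  have rP : ∀ γ, (fun w => c.cP γ (ρ w)) =ᶠ[𝓝 u] fun w => c.hamP A H γ w := fun γ => by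
    filter_upwards [hnear] with w hw
    exact (hρ w hw.1 c hw.2).2 γ
  have dH : ∀ γ (p : Prolong A u), dirDeriv (dualModel n m) (fun w => c.cQ γ (ρ w)) u p.1.2 =
      ∑ α, c.cQ α p * ∑ i, c.sig A α i u.proj * c.dq i (c.dmu γ H) u
        + ∑ α, c.cP α p * c.gU H α γ u := fun γ p => by
    rw [dirDeriv_congr (rQ γ)]
    simp only [c.gU_eq hΩ hH hu huΩ]
    exact c.dirDeriv_eq_dq_dmu hu (c.contMDiffAt_dmu hu hHu γ) p
  have j0Q := fun α => (jQ α).self_of_nhds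
  have j0P := fun α => (jP α).self_of_nhds
  have dJ : ∀ β, dirDeriv (dualModel n m) (fun w => c.cP β (tangentStructure A H w (ν w))) u
      (ρ u).1.2 = ∑ α, (c.cQ α (ν u) * dirDeriv (dualModel n m) (c.gL H α β) u (ρ u).1.2
        + dirDeriv (dualModel n m) (fun w => c.cQ α (ν w)) u (ρ u).1.2 * c.gL H α β u) := fun β => by
    have hνg : ∀ α, MDifferentiableAt (dualModel n m) 𝓘(ℝ, ℝ)
        (fun w => c.cQ α (ν w) * c.gL H α β w) u := fun α => md ((hνQ α).mul (hg α β))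
    rw [dirDeriv_congr (jP β), dirDeriv_sum _ fun α _ => hνg α]
    exact Finset.sum_congr rfl fun α _ => dirDeriv_mul (md (hνQ α)) (md (hg α β)) _
  -- `𝒥ν` is vertical with components `g_{αβ} ν^α`, so differentiating `∂H/∂μ_γ` along it contracts
  -- `g_{αβ}` with `g^{βγ}` and returns `ν^γ`.
  have bQ : ∀ γ, c.cQ γ (prolongBracket A ρ (fun w => tangentStructure A H w (ν w)) u) =
      -c.cQ γ (ν u) := fun γ => by
    rw [c.cQ_bracket hu hρs hJ, dirDeriv_congr (jQ γ), dirDeriv_const, dH]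
    simp only [j0Q, j0P, mul_zero, zero_mul, Finset.sum_const_zero, zero_add, zero_sub]
    congr 1
    simp only [Finset.sum_mul]
    rw [Finset.sum_comm]
    simp only [mul_assoc, ← Finset.mul_sum, c.sum_gL_gU hΩ hH hu huΩ]
    simp
  have bP : ∀ β, c.cP β (prolongBracket A ρ (fun w => tangentStructure A H w (ν w)) u) =
      ∑ α, (c.cQ α (ν u) * dirDeriv (dualModel n m) (c.gL H α β) u (ρ u).1.2
        + dirDeriv (dualModel n m) (fun w => c.cQ α (ν w)) u (ρ u).1.2 * c.gL H α β u)
      - ∑ α, c.cQ α (ν u) * ∑ ε, c.gL H α ε u * c.dmu ε (c.hamP A H β) u := fun β => by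
    rw [c.cP_bracket hu hρs hJ, dJ, dirDeriv_congr (rP β),
      c.dirDeriv_eq_dq_dmu hu (c.contMDiffAt_hamP hu hHu β)]
    simp only [j0Q, j0P, zero_mul, Finset.sum_const_zero, zero_add]
    congr 1
    simp only [Finset.sum_mul, Finset.mul_sum]
    rw [Finset.sum_comm]
    simp only [mul_assoc]
  -- Lowering the `𝒬`-part of `[ρ, ν]`: the structure and mixed-derivative terms reassemble into
  -- `g_{βε} ∂ρ_α/∂μ_ε` via `sum_gL_dmu_hamP`, up to a `μ_γ L^γ` term, while the fibre Hessian of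
  -- `H` returns `-ν_β`.
  have tP : ∀ β, c.cP β (tangentStructure A H u (prolongBracket A ρ ν u)) =
      ∑ α, c.cQ α (ν u) * (∑ ε, c.gL H β ε u * c.dmu ε (c.hamP A H α) u
        + ∑ γ, c.muCoord u γ * c.str A α β γ u.proj)
      + ∑ α, dirDeriv (dualModel n m) (fun w => c.cQ α (ν w)) u (ρ u).1.2 * c.gL H α β u
      - c.cP β (ν u) := fun β => by
    rw [c.cP_tangentStructure hΩ hH hu huΩ]
    have s0 : ∀ α, ∑ γ, c.muCoord u γ * c.str A β α γ u.proj =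
        -∑ γ, c.muCoord u γ * c.str A α β γ u.proj := fun α => by
      simp only [c.str_skew α β, mul_neg, Finset.sum_neg_distrib]
    simp only [c.cQ_bracket hu hρs hν, dH, (hρ u huΩ c hu).1,
      c.sum_gL_dmu_hamP (A := A) hΩ hH hu huΩ, s0]
    simp only [add_mul, sub_mul, mul_add, Finset.sum_add_distrib, Finset.sum_sub_distrib, mul_neg,
      Finset.sum_neg_distrib]
    have s1 : ∑ γ, (∑ δ, ∑ α, c.dmu δ H u * c.cQ α (ν u) * c.str A δ α γ u.proj) * c.gL H γ β u =
        ∑ α, c.cQ α (ν u) * ∑ δ, ∑ ε, c.dmu δ H u * (c.gL H β ε u * c.str A δ α ε u.proj) := by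
      simp only [Finset.sum_mul, Finset.mul_sum]
      rw [Finset.sum_comm]
      simp_rw [Finset.sum_comm (s := (Finset.univ : Finset (Fin m)))
        (f := fun γ α => c.dmu _ H u * c.cQ α (ν u) * c.str A _ α γ u.proj * c.gL H γ β u)]
      rw [Finset.sum_comm]
      refine Finset.sum_congr rfl fun α _ => Finset.sum_congr rfl fun δ _ =>
        Finset.sum_congr rfl fun γ _ => ?_
      rw [c.gL_comm hΩ hH hu huΩ γ β]
      ring
    have s2 : ∑ γ, (∑ α, c.cQ α (ν u) * ∑ i, c.sig A α i u.proj * c.dq i (c.dmu γ H) u) *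
          c.gL H γ β u =
        ∑ α, c.cQ α (ν u) * ∑ i, ∑ ε, c.dq i (c.dmu ε H) u *
          (c.sig A α i u.proj * c.gL H β ε u) := by
      simp only [Finset.sum_mul, Finset.mul_sum]
      rw [Finset.sum_comm]
      refine Finset.sum_congr rfl fun α _ => ?_
      rw [Finset.sum_comm]
      refine Finset.sum_congr rfl fun i _ => Finset.sum_congr rfl fun γ _ => ?_
      rw [c.gL_comm hΩ hH hu huΩ γ β]
      ring
    have s3 : ∑ γ, (∑ α, c.cP α (ν u) * c.gU H α γ u) * c.gL H γ β u = c.cP β (ν u) := by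
      simp only [Finset.sum_mul]
      rw [Finset.sum_comm]
      simp only [mul_assoc, ← Finset.mul_sum, c.sum_gU_gL hΩ hH hu huΩ]
      simp
    rw [s1, s2, s3]
    ring
  refine ⟨fun α => ?_, fun β => ?_⟩
  · rw [cQ_neg, cQ_sub, c.cQ_tangentStructure hu, bQ, sub_zero, neg_neg]
  -- The terms `ρ(ν^α) g_{αβ}` occur in both `bP` and `tP` and cancel; this is why the Lie
  -- derivative is tensorial in `ν`.
  · rw [cP_neg, cP_sub, bP, tP]
    have s4 : 2 * ∑ α, c.connCoeff A H ρ α β u * c.cQ α (ν u) =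
        ∑ α, c.cQ α (ν u) * (-dirDeriv (dualModel n m) (c.gL H α β) u (ρ u).1.2
          + ∑ ε, c.gL H α ε u * c.dmu ε (c.hamP A H β) u
          + (∑ ε, c.gL H β ε u * c.dmu ε (c.hamP A H α) u
          + ∑ γ, c.muCoord u γ * c.str A α β γ u.proj)) := by
      rw [Finset.mul_sum]
      refine Finset.sum_congr rfl fun α _ => ?_
      rw [connCoeff]
      ring
    rw [s4]
    simp only [mul_add, Finset.sum_add_distrib, mul_neg, Finset.sum_neg_distrib]
    ring

theorem contMDiffAt_connCoeff (α β : Fin m) :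
    ContMDiffAt (dualModel n m) 𝓘(ℝ, ℝ) ∞ (c.connCoeff A H ρ α β) u := by
  have hHu := hH.smooth.contMDiffAt (hΩ.mem_nhds huΩ)
  have hg := c.contMDiffAt_gL hΩ hH hu huΩ
  have hp : ∀ ε β, ContMDiffAt (dualModel n m) 𝓘(ℝ, ℝ) ∞ (c.dmu ε (c.hamP A H β)) u :=
    fun ε β => c.contMDiffAt_dmu hu (c.contMDiffAt_hamP hu hHu β) ε
  refine contMDiffAt_const.mul (ContMDiffAt.add (ContMDiffAt.add (ContMDiffAt.add
    (ContMDiffAt.neg ?_) ?_) ?_) ?_)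
  · exact contMDiffAt_dirDeriv (b := fun w : DualTotal m E => w) (hg α β)
      (hρ.smoothProlongAt hΩ hH.smooth huΩ).2
  · exact ContMDiffAt.sum fun ε _ => (hg α ε).mul (hp ε β)
  · exact ContMDiffAt.sum fun ε _ => (hg β ε).mul (hp ε α)
  · exact ContMDiffAt.sum fun γ _ => (c.contMDiffAt_muCoord u γ).mul (c.contMDiffAt_str hu α β γ)

end LocalFrame

end HamiltonSection

/-- For symmetric `G` the right-hand side is `G (k + kᵀ) G - R G - G Rᵀ`, so multiplication by `L`
on both sides isolates the symmetric part of `k`. The skew part does not enter. -/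
theorem Matrix.eq_mul_add_mul_transpose_iff {m : ℕ} {G L D R k : Matrix (Fin m) (Fin m) ℝ}
    (hGL : G * L = 1) (hLG : L * G = 1) (hG : G.transpose = G) :
    D = (-R + G * k) * G + G * (-R + G * k).transpose ↔
      k + k.transpose = L * D * L + L * R + (L * R).transpose := by
  have hL : L.transpose = L := by
    calc L.transpose = L.transpose * (G * L) := by rw [hGL, mul_one]
      _ = (L.transpose * G.transpose) * L := by rw [hG, mul_assoc]
      _ = L := by rw [← Matrix.transpose_mul, hGL, Matrix.transpose_one, one_mul]
  have h1 : (-R + G * k) * G + G * (-R + G * k).transpose =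
      G * (k + k.transpose) * G - R * G - G * R.transpose := by
    rw [Matrix.transpose_add, Matrix.transpose_mul, Matrix.transpose_neg, hG]
    noncomm_ring
  rw [h1, Matrix.transpose_mul, hL]
  have a1 : ∀ X : Matrix (Fin m) (Fin m) ℝ, G * (L * X) = X := fun X => by
    rw [← mul_assoc, hGL, one_mul]
  have a2 : ∀ X : Matrix (Fin m) (Fin m) ℝ, L * (G * X) = X := fun X => by
    rw [← mul_assoc, hLG, one_mul]
  constructor
  · rintro rfl
    simp only [mul_sub, sub_mul, mul_assoc, a2, hGL, mul_one]
    abel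
  · intro h
    rw [h]
    simp only [mul_add, add_mul, mul_assoc, a1, hLG, mul_one]
    abel

/-! ### Nonlinear connections as matrices; the symmetric and metric conditions. -/

section Connections

variable {n m : ℕ} {M : Type*} [TopologicalSpace M] [ChartedSpace (Eu n) M]
  [IsManifold (𝓡 n) ∞ M] {E : M → Type*} [TopologicalSpace (TotalSpace (Eu m) E)]
  [∀ x, AddCommGroup (E x)] [∀ x, Module ℝ (E x)] [∀ x, TopologicalSpace (E x)]
  [FiberBundle (Eu m) E] [VectorBundle ℝ (Eu m) E] [ContMDiffVectorBundle ∞ (Eu m) E (𝓡 n)]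
  [T2Space M] {A : LieAlgebroid n m M E} {H : DualTotal m E → ℝ}
  {Ω : Set (DualTotal m E)} {ρ : ∀ u, Prolong A u}

namespace LocalFrame

variable (c : LocalFrame n m M E) {u : DualTotal m E}

/-- The endomorphism `L` is given by `L(𝒬_α) = 𝒬_α + 2 k_{αβ} 𝒫^β`, `L(𝒫^α) = -𝒫^α`. -/
def HasMatrix (L : Prolong A u →ₗ[ℝ] Prolong A u) (k : Matrix (Fin m) (Fin m) ℝ) : Prop :=
  (∀ p α, c.cQ α (L p) = c.cQ α p) ∧
    ∀ p β, c.cP β (L p) = -c.cP β p + 2 * ∑ α, k α β * c.cQ α p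

theorem exists_hasMatrix (hu : u ∈ c.dom) (k : Matrix (Fin m) (Fin m) ℝ) :
    ∃ L : Prolong A u →ₗ[ℝ] Prolong A u, c.HasMatrix L k := by
  refine ⟨
    { toFun := fun p => c.ofCoords A u (fun α => c.cQ α p)
        (fun β => -c.cP β p + 2 * ∑ α, k α β * c.cQ α p)
      map_add' := fun p q => c.prolong_ext hu (fun α => ?_) fun β => ?_
      map_smul' := fun r p => c.prolong_ext hu (fun α => ?_) fun β => ?_ },
    fun p α => c.cQ_ofCoords hu _ _ α, fun p β => c.cP_ofCoords hu _ _ β⟩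
  · simp only [cQ_add, c.cQ_ofCoords hu]
  · simp only [cP_add, cQ_add, c.cP_ofCoords hu, mul_add, Finset.sum_add_distrib]
    ring
  · simp only [RingHom.id_apply, cQ_smul, c.cQ_ofCoords hu]
  · simp only [RingHom.id_apply, cP_smul, cQ_smul, c.cP_ofCoords hu, mul_add, Finset.mul_sum]
    congr 1
    · ring
    · exact Finset.sum_congr rfl fun α _ => by ring

variable {c}

theorem HasMatrix.eq {L L' : Prolong A u →ₗ[ℝ] Prolong A u} {k : Matrix (Fin m) (Fin m) ℝ}
    (hu : u ∈ c.dom) (h : c.HasMatrix L k) (h' : c.HasMatrix L' k) : L = L' :=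
  LinearMap.ext fun p => c.prolong_ext hu (fun α => by rw [h.1, h'.1])
    fun β => by rw [h.2, h'.2]

theorem HasMatrix.comp_self {L : Prolong A u →ₗ[ℝ] Prolong A u} {k : Matrix (Fin m) (Fin m) ℝ}
    (hu : u ∈ c.dom) (h : c.HasMatrix L k) : L ∘ₗ L = LinearMap.id :=
  LinearMap.ext fun p => c.prolong_ext hu
    (fun α => by simp only [LinearMap.comp_apply, LinearMap.id_apply, h.1])
    fun β => by
      simp only [LinearMap.comp_apply, LinearMap.id_apply, h.1, h.2]
      ring

theorem HasMatrix.ker_eq {L : Prolong A u →ₗ[ℝ] Prolong A u} {k : Matrix (Fin m) (Fin m) ℝ}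
    (hu : u ∈ c.dom) (h : c.HasMatrix L k) :
    LinearMap.ker (LinearMap.id + L) = VertProlong A u := by
  ext p
  rw [LinearMap.mem_ker, LinearMap.add_apply, LinearMap.id_apply, c.mem_vertProlong_iff hu]
  constructor
  · intro hp α
    have h1 := c.cQ_add α p (L p)
    rw [hp, cQ_zero, h.1] at h1
    linarith
  · intro hp
    refine c.prolong_ext hu (fun α => ?_) fun β => ?_
    · rw [cQ_add, cQ_zero, h.1, hp, add_zero]
    · rw [cP_add, cP_zero, h.2]
      simp [hp]

variable (c) in
-- Since `L² = 1`, the vector `L p - p` lies in the `-1`-eigenspace, which is vertical, so `L` keeps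
-- `𝒬`-coordinates. On vertical vectors it is `-1`, so the `𝒫`-coordinates of the `L 𝒬_α` determine
-- it; halving them matches the factor 2 in `HasMatrix`.
theorem exists_hasMatrix_of_connection (hu : u ∈ c.dom) {L : Prolong A u →ₗ[ℝ] Prolong A u}
    (hsq : L ∘ₗ L = LinearMap.id) (hker : LinearMap.ker (LinearMap.id + L) = VertProlong A u) :
    ∃ k, c.HasMatrix L k := by
  have hQ : ∀ p α, c.cQ α (L p) = c.cQ α p := fun p α => by
    have h1 : L (L p) = p := DFunLike.congr_fun hsq p
    have h2 : L p - p ∈ VertProlong A u := by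
      rw [← hker, LinearMap.mem_ker, LinearMap.add_apply, LinearMap.id_apply, map_sub, h1]
      abel
    have h3 := (c.mem_vertProlong_iff hu _).1 h2 α
    rw [cQ_sub] at h3
    linarith
  have hV : ∀ p ∈ VertProlong A u, L p = -p := fun p hp => by
    rw [← hker, LinearMap.mem_ker, LinearMap.add_apply, LinearMap.id_apply] at hp
    exact (neg_eq_of_add_eq_zero_right hp).symm
  let Q : Fin m → Prolong A u := fun α => ⟨c.frameQ A α u, c.frameQ_mem hu α⟩
  refine ⟨Matrix.of fun α β => c.cP β (L (Q α)) / 2, hQ, fun p β => ?_⟩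
  have h1 : p - ∑ α, c.cQ α p • Q α ∈ VertProlong A u := by
    refine (c.mem_vertProlong_iff hu _).2 fun α => ?_
    rw [cQ_sub, cQ_sum]
    simp only [cQ_smul, Q, c.cQ_frameQ hu]
    simp
  have h2 := congrArg (c.cP β) (hV _ h1)
  rw [map_sub, map_sum, cP_neg, cP_sub, cP_sub, cP_sum, cP_sum] at h2
  simp only [map_smul, cP_smul, Q, c.cP_frameQ hu, mul_zero, Finset.sum_const_zero, sub_zero] at h2
  rw [Finset.mul_sum, ← sub_eq_iff_eq_add, ← h2]
  congr 1
  refine Finset.sum_congr rfl fun α _ => ?_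
  simp only [Matrix.of_apply, Q]
  ring

theorem HasMatrix.cQ_verProj {N : ∀ u, Prolong A u →ₗ[ℝ] Prolong A u}
    {k : Matrix (Fin m) (Fin m) ℝ} (h : c.HasMatrix (N u) k) (p : Prolong A u) (α : Fin m) :
    c.cQ α (verProj N u p) = 0 := by
  have h1 : verProj N u p = (1 / 2 : ℝ) • (p - N u p) := rfl
  rw [h1, c.cQ_smul, c.cQ_sub, h.1 p α, sub_self, mul_zero]

theorem HasMatrix.cP_verProj {N : ∀ u, Prolong A u →ₗ[ℝ] Prolong A u}
    {k : Matrix (Fin m) (Fin m) ℝ} (h : c.HasMatrix (N u) k) (p : Prolong A u) (β : Fin m) :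
    c.cP β (verProj N u p) = c.cP β p - ∑ α, k α β * c.cQ α p := by
  have h1 : verProj N u p = (1 / 2 : ℝ) • (p - N u p) := rfl
  rw [h1, c.cP_smul, c.cP_sub, h.2 p β]
  ring

/-- The symplectic form on two horizontal vectors. -/
theorem HasMatrix.symp_eq {L : Prolong A u →ₗ[ℝ] Prolong A u} {k : Matrix (Fin m) (Fin m) ℝ}
    (h : c.HasMatrix L k) {p q : Prolong A u} (hp : L p = p) (hq : L q = q) :
    c.symp A p q = ∑ α, ∑ β, (k β α - k α β + ∑ γ, c.muCoord u γ * c.str A α β γ u.proj) *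
      (c.cQ α p * c.cQ β q) := by
  -- For a fixed vector the matrix relation reads `2 p_β = 2 k_{αβ} p^α`: the horizontal space is a
  -- graph over the `𝒬`-coordinates.
  have hP : ∀ {r : Prolong A u}, L r = r → ∀ β, c.cP β r = ∑ α, k α β * c.cQ α r :=
    fun {r} hr β => by
      have h1 := h.2 r β
      rw [hr] at h1
      linarith
  simp only [symp, hP hp, hP hq, add_mul, sub_mul, Finset.sum_add_distrib, Finset.sum_sub_distrib,
    Finset.sum_mul, Finset.mul_sum]
  rw [Finset.sum_comm (f := fun β α => k α β * c.cQ α p * c.cQ β q)]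
  congr 1
  · congr 1
    · exact Finset.sum_congr rfl fun α _ => Finset.sum_congr rfl fun β _ => by ring
    · exact Finset.sum_congr rfl fun α _ => Finset.sum_congr rfl fun β _ => by ring
  · simp only [mul_assoc]

end LocalFrame

theorem SmoothProlongAt.horProj {u : DualTotal m E} {N : ∀ u, Prolong A u →ₗ[ℝ] Prolong A u}
    {X : ∀ u, Prolong A u} (hX : SmoothProlongAt A X u)
    (hNX : SmoothProlongAt A (fun w => N w (X w)) u) :
    SmoothProlongAt A (fun w => horProj N w (X w)) u := by
  obtain ⟨c, hc⟩ := exists_localFrame n m E u.proj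
  obtain ⟨h1, h2⟩ := (c.smoothProlongAt_iff hc).1 hX
  obtain ⟨h3, h4⟩ := (c.smoothProlongAt_iff hc).1 hNX
  refine (c.smoothProlongAt_iff hc).2 ⟨fun α => ?_, fun α => ?_⟩
  · refine (contMDiffAt_const (c := (1 / 2 : ℝ)).mul ((h1 α).add (h3 α))).congr_of_eventuallyEq
      (Filter.Eventually.of_forall fun w => ?_)
    exact (c.cQ_smul α _ _).trans (by rw [LinearMap.add_apply, LocalFrame.cQ_add]; rfl)
  · refine (contMDiffAt_const (c := (1 / 2 : ℝ)).mul ((h2 α).add (h4 α))).congr_of_eventuallyEq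
      (Filter.Eventually.of_forall fun w => ?_)
    exact (c.cP_smul α _ _).trans (by rw [LinearMap.add_apply, LocalFrame.cP_add]; rfl)

theorem SmoothProlongAt.verProj {u : DualTotal m E} {N : ∀ u, Prolong A u →ₗ[ℝ] Prolong A u}
    {X : ∀ u, Prolong A u} (hX : SmoothProlongAt A X u)
    (hNX : SmoothProlongAt A (fun w => N w (X w)) u) :
    SmoothProlongAt A (fun w => verProj N w (X w)) u := by
  obtain ⟨c, hc⟩ := exists_localFrame n m E u.proj
  obtain ⟨h1, h2⟩ := (c.smoothProlongAt_iff hc).1 hX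
  obtain ⟨h3, h4⟩ := (c.smoothProlongAt_iff hc).1 hNX
  refine (c.smoothProlongAt_iff hc).2 ⟨fun α => ?_, fun α => ?_⟩
  · refine (contMDiffAt_const (c := (1 / 2 : ℝ)).mul ((h1 α).sub (h3 α))).congr_of_eventuallyEq
      (Filter.Eventually.of_forall fun w => ?_)
    exact (c.cQ_smul α _ _).trans (by rw [LinearMap.sub_apply, LocalFrame.cQ_sub]; rfl)
  · refine (contMDiffAt_const (c := (1 / 2 : ℝ)).mul ((h2 α).sub (h4 α))).congr_of_eventuallyEq
      (Filter.Eventually.of_forall fun w => ?_)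
    exact (c.cP_smul α _ _).trans (by rw [LinearMap.sub_apply, LocalFrame.cP_sub]; rfl)

namespace IsNonlinearConnection

variable {N : ∀ u, Prolong A u →ₗ[ℝ] Prolong A u} (hN : IsNonlinearConnection A Ω N)
  (hΩ : IsOpen Ω)

include hN

theorem exists_hasMatrix {u : DualTotal m E} (huΩ : u ∈ Ω) (c : LocalFrame n m M E)
    (hu : u ∈ c.dom) : ∃ k, c.HasMatrix (N u) k :=
  c.exists_hasMatrix_of_connection hu (hN.sq u huΩ) (hN.ker u huΩ)

theorem apply_vertical {u : DualTotal m E} (huΩ : u ∈ Ω) {p : Prolong A u}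
    (hp : p ∈ VertProlong A u) : N u p = -p := by
  rw [← hN.ker u huΩ, LinearMap.mem_ker, LinearMap.add_apply, LinearMap.id_apply] at hp
  exact (neg_eq_of_add_eq_zero_right hp).symm

theorem apply_horProj {u : DualTotal m E} (huΩ : u ∈ Ω) (p : Prolong A u) :
    N u (horProj N u p) = horProj N u p := by
  have h1 : N u (N u p) = p := DFunLike.congr_fun (hN.sq u huΩ) p
  simp only [horProj, LinearMap.smul_apply, LinearMap.add_apply, LinearMap.id_apply, map_smul,
    map_add, h1, add_comm]

theorem horProj_vertical {u : DualTotal m E} (huΩ : u ∈ Ω) {p : Prolong A u}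
    (hp : p ∈ VertProlong A u) : horProj N u p = 0 := by
  rw [horProj, LinearMap.smul_apply, LinearMap.add_apply, LinearMap.id_apply,
    hN.apply_vertical huΩ hp, add_neg_cancel, smul_zero]

theorem verProj_vertical {u : DualTotal m E} (huΩ : u ∈ Ω) {p : Prolong A u}
    (hp : p ∈ VertProlong A u) : verProj N u p = p := by
  rw [verProj, LinearMap.smul_apply, LinearMap.sub_apply, LinearMap.id_apply,
    hN.apply_vertical huΩ hp, sub_neg_eq_add, ← two_smul ℝ p, smul_smul]
  norm_num

include hΩ

theorem smooth_at {X : ∀ u, Prolong A u} (hX : SmoothProlong A Ω X) {u : DualTotal m E}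
    (huΩ : u ∈ Ω) : SmoothProlongAt A (fun w => N w (X w)) u :=
  (hN.smooth X hX).at hΩ huΩ

/-- The Lagrangian condition is tested on horizontal projections of sections through `𝒬_α` and
`𝒬_β`. Projecting does not change the `𝒬`-coordinates, so the double sum of `HasMatrix.symp_eq`
reduces to one entry. -/
theorem sub_transpose_of_symmetric (hS : IsSymmetricConnection A Ω N) {u : DualTotal m E}
    (huΩ : u ∈ Ω) {c : LocalFrame n m M E} (hu : u ∈ c.dom) {k : Matrix (Fin m) (Fin m) ℝ}
    (hk : c.HasMatrix (N u) k) (α β : Fin m) :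
    k α β - k β α = ∑ γ, c.muCoord u γ * c.str A α β γ u.proj := by
  have hsec : ∀ α : Fin m, ∃ X : ∀ u, Prolong A u, SmoothProlong A Ω X ∧
      (∀ w ∈ Ω, N w (X w) = X w) ∧ ∀ β, c.cQ β (X u) = if β = α then 1 else 0 := fun α => by
    obtain ⟨X, hX, hXu⟩ :=
      c.exists_section_eq hu (⟨c.frameQ A α u, c.frameQ_mem hu α⟩ : Prolong A u)
    have hXs : SmoothProlong A Ω X := (smoothProlong_iff hΩ).2 fun w _ => hX w
    refine ⟨fun w => horProj N w (X w), (smoothProlong_iff hΩ).2 fun w hw =>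
      (hX w).horProj (hN.smooth_at hΩ hXs hw), fun w hw => hN.apply_horProj hw _, fun β => ?_⟩
    change c.cQ β ((1 / 2 : ℝ) • (X u + N u (X u))) = _
    rw [LocalFrame.cQ_smul, LocalFrame.cQ_add, hk.1, hXu, c.cQ_frameQ hu]
    ring
  obtain ⟨X, hX, hNX, hXQ⟩ := hsec α
  obtain ⟨Y, hY, hNY, hYQ⟩ := hsec β
  have h1 := hS X Y hX hY hNX hNY u huΩ
  rw [c.symplectic_eq hu (hX.at hΩ huΩ) (hY.at hΩ huΩ), hk.symp_eq (hNX u huΩ) (hNY u huΩ)] at h1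
  simp only [hXQ, hYQ] at h1
  simp only [mul_ite, mul_one, mul_zero, Finset.sum_ite_eq', Finset.mem_univ, if_true] at h1
  linarith

variable (hH : IsRegularHamiltonian n Ω H) (hρ : HasHamiltonCoords A Ω H ρ)

include hH hρ

/-- The dynamical covariant derivative of a vertical section in local coordinates. -/
theorem dynCovDeriv_coords {X : ∀ u, Prolong A u} (hX : SmoothProlong A Ω X)
    (hXv : ∀ u ∈ Ω, X u ∈ VertProlong A u) {u : DualTotal m E} (huΩ : u ∈ Ω)
    {c : LocalFrame n m M E} (hu : u ∈ c.dom) {k : Matrix (Fin m) (Fin m) ℝ}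
    (hk : c.HasMatrix (N u) k) :
    dynCovDeriv A N ρ X u ∈ VertProlong A u ∧
    ∀ β, c.cP β (dynCovDeriv A N ρ X u) =
      dirDeriv (dualModel n m) (fun w => c.cP β (X w)) u (ρ u).1.2
        + ∑ ε, c.cP ε (X u) * (-c.dmu ε (c.hamP A H β) u + ∑ α, c.gU H ε α u * k α β) := by
  have hHu := hH.smooth.contMDiffAt (hΩ.mem_nhds huΩ)
  have hρs := hρ.smoothProlongAt hΩ hH.smooth huΩ
  have hnear : ∀ᶠ w in 𝓝 u, w ∈ Ω ∧ w ∈ c.dom :=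
    (show ∀ᶠ w in 𝓝 u, w ∈ Ω from hΩ.mem_nhds huΩ).and (c.isOpen_dom.mem_nhds hu)
  have hXu := hX.at hΩ huΩ
  have hhs : SmoothProlongAt A (fun w => horProj N w (X w)) u :=
    hXu.horProj (hN.smooth_at hΩ hX huΩ)
  have hvs : SmoothProlongAt A (fun w => verProj N w (X w)) u :=
    hXu.verProj (hN.smooth_at hΩ hX huΩ)
  have hX0 : ∀ α, c.cQ α (X u) = 0 := (c.mem_vertProlong_iff hu _).1 (hXv u huΩ)
  -- `X` is vertical on all of `Ω`, so `hX` vanishes on a neighbourhood of `u` and its bracket with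
  -- `ρ` is zero.
  have h1 : prolongBracket A ρ (fun w => horProj N w (X w)) u = 0 := by
    refine c.prolong_ext hu (fun γ => ?_) fun γ => ?_
    · have e1 : (fun w => c.cQ γ (horProj N w (X w))) =ᶠ[𝓝 u] fun _ => 0 := by
        filter_upwards [hnear] with w hw
        rw [hN.horProj_vertical hw.1 (hXv w hw.1), LocalFrame.cQ_zero]
      rw [c.cQ_bracket hu hρs hhs, dirDeriv_congr e1, dirDeriv_const,
        hN.horProj_vertical huΩ (hXv u huΩ)]
      simp [LocalFrame.cQ_zero, dirDeriv_zero_right]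
    · have e1 : (fun w => c.cP γ (horProj N w (X w))) =ᶠ[𝓝 u] fun _ => 0 := by
        filter_upwards [hnear] with w hw
        rw [hN.horProj_vertical hw.1 (hXv w hw.1), LocalFrame.cP_zero]
      rw [c.cP_bracket hu hρs hhs, dirDeriv_congr e1, dirDeriv_const,
        hN.horProj_vertical huΩ (hXv u huΩ)]
      simp [LocalFrame.cP_zero, dirDeriv_zero_right]
  set b := prolongBracket A ρ (fun w => verProj N w (X w)) u with hb
  have hdX : ∀ {f : DualTotal m E → ℝ}, ContMDiffAt (dualModel n m) 𝓘(ℝ, ℝ) ∞ f u →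
      dirDeriv (dualModel n m) f u (X u).1.2 = ∑ α, c.cP α (X u) * c.dmu α f u := fun hf => by
    rw [c.dirDeriv_eq_dq_dmu hu hf]
    simp [hX0]
  -- The bracket `[ρ, X]` is not vertical: its `𝒬`-part is `-g^{εγ} X_ε`. The vertical projection
  -- passes this through `k`, which is the origin of the term `G k`.
  have bQ : ∀ γ, c.cQ γ b = -∑ ε, c.cP ε (X u) * c.gU H ε γ u := fun γ => by
    have e1 : (fun w => c.cQ γ (verProj N w (X w))) =ᶠ[𝓝 u] fun _ => 0 := by
      filter_upwards [hnear] with w hw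
      rw [hN.verProj_vertical hw.1 (hXv w hw.1)]
      exact (c.mem_vertProlong_iff hw.2 _).1 (hXv w hw.1) γ
    have e2 : (fun w => c.cQ γ (ρ w)) =ᶠ[𝓝 u] c.dmu γ H := by
      filter_upwards [hnear] with w hw
      exact (hρ w hw.1 c hw.2).1 γ
    rw [hb, c.cQ_bracket hu hρs hvs, dirDeriv_congr e1, dirDeriv_const, dirDeriv_congr e2,
      hN.verProj_vertical huΩ (hXv u huΩ), hdX (c.contMDiffAt_dmu hu hHu γ)]
    simp [hX0, c.gU_eq hΩ hH hu huΩ]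
  have bP : ∀ γ, c.cP γ b = dirDeriv (dualModel n m) (fun w => c.cP γ (X w)) u (ρ u).1.2
      - ∑ ε, c.cP ε (X u) * c.dmu ε (c.hamP A H γ) u := fun γ => by
    have e1 : (fun w => c.cP γ (verProj N w (X w))) =ᶠ[𝓝 u] fun w => c.cP γ (X w) := by
      filter_upwards [hnear] with w hw
      rw [hN.verProj_vertical hw.1 (hXv w hw.1)]
    have e2 : (fun w => c.cP γ (ρ w)) =ᶠ[𝓝 u] c.hamP A H γ := by
      filter_upwards [hnear] with w hw
      exact (hρ w hw.1 c hw.2).2 γ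
    rw [hb, c.cP_bracket hu hρs hvs, dirDeriv_congr e1, dirDeriv_congr e2,
      hN.verProj_vertical huΩ (hXv u huΩ), hdX (c.contMDiffAt_hamP (A := A) hu hHu γ)]
  have h2 : dynCovDeriv A N ρ X u = verProj N u b := by
    rw [dynCovDeriv, h1, map_zero, zero_add]
  rw [h2]
  clear_value b
  refine ⟨(c.mem_vertProlong_iff hu _).2 (hk.cQ_verProj b), fun β => ?_⟩
  · rw [hk.cP_verProj b β, bP β]
    have e3 : ∑ α, k α β * c.cQ α b = -∑ ε, c.cP ε (X u) * ∑ α, c.gU H ε α u * k α β := by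
      simp only [bQ, mul_neg, Finset.sum_neg_distrib, Finset.mul_sum]
      rw [Finset.sum_comm]
      congr 1
      exact Finset.sum_congr rfl fun ε _ => Finset.sum_congr rfl fun α _ => by ring
    rw [e3]
    simp only [mul_add, mul_neg, Finset.sum_add_distrib, Finset.sum_neg_distrib]
    ring

/-- The failure of the metric condition in local coordinates. -/
theorem metric_defect {X Y : ∀ u, Prolong A u} (hX : SmoothProlong A Ω X)
    (hXv : ∀ u ∈ Ω, X u ∈ VertProlong A u) (hY : SmoothProlong A Ω Y)
    (hYv : ∀ u ∈ Ω, Y u ∈ VertProlong A u) {u : DualTotal m E} (huΩ : u ∈ Ω)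
    {c : LocalFrame n m M E} (hu : u ∈ c.dom) {k : Matrix (Fin m) (Fin m) ℝ}
    (hk : c.HasMatrix (N u) k) {D G R B : Matrix (Fin m) (Fin m) ℝ}
    (hD : D = Matrix.of fun α β => dirDeriv (dualModel n m) (c.gU H α β) u (ρ u).1.2)
    (hG : G = Matrix.of fun α β => c.gU H α β u)
    (hR : R = Matrix.of fun ε β => c.dmu ε (c.hamP A H β) u) (hB : B = -R + G * k) :
    dirDeriv (dualModel n m) (fun w => vertMetric A H w (X w) (Y w)) u (ρ u).1.2
      - (vertMetric A H u (dynCovDeriv A N ρ X u) (Y u)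
        + vertMetric A H u (X u) (dynCovDeriv A N ρ Y u)) =
    ∑ α, ∑ β, c.cP α (X u) * c.cP β (Y u) * (D - (B * G + G * B.transpose)) α β := by
  have hBe : ∀ ε β, -c.dmu ε (c.hamP A H β) u + ∑ α, c.gU H ε α u * k α β = B ε β := fun ε β => by
    rw [hB, hG, hR]
    rfl
  obtain ⟨vX, cX⟩ := hN.dynCovDeriv_coords hΩ hH hρ hX hXv huΩ hu hk
  obtain ⟨vY, cY⟩ := hN.dynCovDeriv_coords hΩ hH hρ hY hYv huΩ hu hk
  simp only [hBe] at cX cY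
  have hGe : ∀ α β, c.gU H α β u = G α β := fun α β => by rw [hG]; rfl
  have hDe : ∀ α β, dirDeriv (dualModel n m) (c.gU H α β) u (ρ u).1.2 = D α β := fun α β => by
    rw [hD]; rfl
  obtain ⟨-, sX⟩ := (c.smoothProlongAt_iff hu).1 (hX.at hΩ huΩ)
  obtain ⟨-, sY⟩ := (c.smoothProlongAt_iff hu).1 (hY.at hΩ huΩ)
  have sG := c.contMDiffAt_gU hΩ hH hu huΩ
  have md : ∀ {f : DualTotal m E → ℝ}, ContMDiffAt (dualModel n m) 𝓘(ℝ, ℝ) ∞ f u →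
      MDifferentiableAt (dualModel n m) 𝓘(ℝ, ℝ) f u := fun hf => hf.mdifferentiableAt (by simp)
  have m1 : ∀ α β, ContMDiffAt (dualModel n m) 𝓘(ℝ, ℝ) ∞
      (fun w => c.cP α (X w) * c.cP β (Y w)) u := fun α β => (sX α).mul (sY β)
  have m2 : ∀ α β, ContMDiffAt (dualModel n m) 𝓘(ℝ, ℝ) ∞
      (fun w => c.cP α (X w) * c.cP β (Y w) * c.gU H α β w) u := fun α β => (m1 α β).mul (sG α β)
  have e1 : (fun w => vertMetric A H w (X w) (Y w)) =ᶠ[𝓝 u]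
      fun w => ∑ α, ∑ β, c.cP α (X w) * c.cP β (Y w) * c.gU H α β w := by
    filter_upwards [hΩ.mem_nhds huΩ, c.isOpen_dom.mem_nhds hu] with w hw hwc
    exact c.vertMetric_eq hΩ hH hwc hw (hXv w hw) (hYv w hw)
  have e2 : dirDeriv (dualModel n m) (fun w => vertMetric A H w (X w) (Y w)) u (ρ u).1.2 =
      ∑ α, ∑ β, (c.cP α (X u) * c.cP β (Y u) * D α β
        + (c.cP α (X u) * dirDeriv (dualModel n m) (fun w => c.cP β (Y w)) u (ρ u).1.2
          + dirDeriv (dualModel n m) (fun w => c.cP α (X w)) u (ρ u).1.2 * c.cP β (Y u))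
            * G α β) := by
    rw [dirDeriv_congr e1, dirDeriv_sum _ fun α _ => md (ContMDiffAt.sum fun β _ => m2 α β)]
    refine Finset.sum_congr rfl fun α _ => ?_
    rw [dirDeriv_sum _ fun β _ => md (m2 α β)]
    refine Finset.sum_congr rfl fun β _ => ?_
    rw [dirDeriv_mul (md (m1 α β)) (md (sG α β)), dirDeriv_mul (md (sX α)) (md (sY β)), hDe, hGe]
  rw [e2, c.vertMetric_eq hΩ hH hu huΩ vX (hYv u huΩ), c.vertMetric_eq hΩ hH hu huΩ (hXv u huΩ) vY]
  simp only [cX, cY, hGe, Matrix.sub_apply, Matrix.add_apply, Matrix.mul_apply,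
    Matrix.transpose_apply]
  have e3 : ∑ α, ∑ β, (∑ ε, c.cP ε (X u) * B ε α) * c.cP β (Y u) * G α β =
      ∑ α, ∑ β, c.cP α (X u) * c.cP β (Y u) * ∑ ε, B α ε * G ε β := by
    simp only [Finset.sum_mul, Finset.mul_sum]
    rw [Finset.sum_comm]
    simp_rw [Finset.sum_comm (f := fun α ε => c.cP ε (X u) * B ε α * c.cP _ (Y u) * G α _)]
    rw [Finset.sum_comm]
    exact Finset.sum_congr rfl fun α _ => Finset.sum_congr rfl fun β _ =>
      Finset.sum_congr rfl fun ε _ => by ring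
  have e4 : ∑ α, ∑ β, c.cP α (X u) * (∑ ε, c.cP ε (Y u) * B ε β) * G α β =
      ∑ α, ∑ β, c.cP α (X u) * c.cP β (Y u) * ∑ ε, G α ε * B β ε := by
    simp only [Finset.sum_mul, Finset.mul_sum]
    refine Finset.sum_congr rfl fun α _ => ?_
    rw [Finset.sum_comm]
    exact Finset.sum_congr rfl fun β _ => Finset.sum_congr rfl fun ε _ => by ring
  -- The terms with `ρ(X_α)` and `ρ(Y_β)` cancel, leaving an expression bilinear in the values of
  -- `X` and `Y` at `u`.
  simp only [add_mul, mul_add, mul_sub, Finset.sum_add_distrib, Finset.sum_sub_distrib, e3, e4]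
  ring

end IsNonlinearConnection

end Connections

/-! ### The canonical connection: construction, properties and uniqueness. -/

section CanonicalConnection

variable {n m : ℕ} {M : Type*} [TopologicalSpace M] [ChartedSpace (Eu n) M]
  [IsManifold (𝓡 n) ∞ M] {E : M → Type*} [TopologicalSpace (TotalSpace (Eu m) E)]
  [∀ x, AddCommGroup (E x)] [∀ x, Module ℝ (E x)] [∀ x, TopologicalSpace (E x)]
  [FiberBundle (Eu m) E] [VectorBundle ℝ (Eu m) E] [ContMDiffVectorBundle ∞ (Eu m) E (𝓡 n)]
  [T2Space M] {A : LieAlgebroid n m M E} {H : DualTotal m E → ℝ}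
  {Ω : Set (DualTotal m E)} {ρ : ∀ u, Prolong A u}

/-- The endomorphisms `N u` have the coefficients of the canonical connection in all local
frames. -/
def HasConnCoeff (Ω : Set (DualTotal m E)) (H : DualTotal m E → ℝ) (ρ : ∀ u, Prolong A u)
    (N : ∀ u, Prolong A u →ₗ[ℝ] Prolong A u) : Prop :=
  ∀ u ∈ Ω, ∀ c : LocalFrame n m M E, u ∈ c.dom →
    c.HasMatrix (N u) (Matrix.of fun α β => c.connCoeff A H ρ α β u)

variable (hΩ : IsOpen Ω) (hH : IsRegularHamiltonian n Ω H) (hρ : HasHamiltonCoords A Ω H ρ)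

include hΩ hH hρ

/-- The right-hand side mentions no frame; it serves to compare endomorphisms constructed in
different frames. -/
theorem LocalFrame.HasMatrix.eq_lieDeriv {c : LocalFrame n m M E} {u : DualTotal m E}
    (huΩ : u ∈ Ω) (hu : u ∈ c.dom) {L : Prolong A u →ₗ[ℝ] Prolong A u}
    (hL : c.HasMatrix L (Matrix.of fun α β => c.connCoeff A H ρ α β u))
    {ν : ∀ u, Prolong A u} (hν : SmoothProlongAt A ν u) :
    L (ν u) = -(prolongBracket A ρ (fun w => tangentStructure A H w (ν w)) u
      - tangentStructure A H u (prolongBracket A ρ ν u)) := by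
  obtain ⟨h1, h2⟩ := c.lieDeriv_coords hΩ hH hu huΩ hρ hν
  refine c.prolong_ext hu (fun α => ?_) fun β => ?_
  · rw [h1 α, hL.1 (ν u) α]
  · rw [h2 β, hL.2 (ν u) β]
    rfl

/-- The endomorphism is constructed from one frame at each point. Every other frame yields the same
one, since both agree with `-ℒ_ρ 𝒥_H` on the value of any smooth section. -/
theorem exists_hasConnCoeff : ∃ N : ∀ u, Prolong A u →ₗ[ℝ] Prolong A u, HasConnCoeff Ω H ρ N := by
  have h1 : ∀ u, ∃ L : Prolong A u →ₗ[ℝ] Prolong A u, u ∈ Ω → ∀ c : LocalFrame n m M E,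
      u ∈ c.dom → c.HasMatrix L (Matrix.of fun α β => c.connCoeff A H ρ α β u) := by
    intro u
    by_cases huΩ : u ∈ Ω
    · obtain ⟨c₀, hc₀⟩ := exists_localFrame n m E u.proj
      obtain ⟨L, hL⟩ := c₀.exists_hasMatrix (A := A) hc₀
        (Matrix.of fun α β => c₀.connCoeff A H ρ α β u)
      refine ⟨L, fun _ c hc => ?_⟩
      obtain ⟨L', hL'⟩ := c.exists_hasMatrix (A := A) hc
        (Matrix.of fun α β => c.connCoeff A H ρ α β u)
      have h2 : L = L' := LinearMap.ext fun p => by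
        obtain ⟨ν, hν, rfl⟩ := c.exists_section_eq hc p
        rw [hL.eq_lieDeriv hΩ hH hρ huΩ hc₀ (hν u), hL'.eq_lieDeriv hΩ hH hρ huΩ hc (hν u)]
      rw [h2]
      exact hL'
    · exact ⟨0, fun h => absurd h huΩ⟩
  choose N hN using h1
  exact ⟨N, fun u hu => hN u hu⟩

/-- The two relations that determine the coefficients of the canonical connection. -/
theorem LocalFrame.connCoeff_relations (c : LocalFrame n m M E) {u : DualTotal m E} (huΩ : u ∈ Ω)
    (hu : u ∈ c.dom) {k D G L R : Matrix (Fin m) (Fin m) ℝ}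
    (hk : k = Matrix.of fun α β => c.connCoeff A H ρ α β u)
    (hD : D = Matrix.of fun α β => dirDeriv (dualModel n m) (c.gU H α β) u (ρ u).1.2)
    (hG : G = Matrix.of fun α β => c.gU H α β u) (hL : L = Matrix.of fun α β => c.gL H α β u)
    (hR : R = Matrix.of fun ε β => c.dmu ε (c.hamP A H β) u) :
    k + k.transpose = L * D * L + L * R + (L * R).transpose ∧
      ∀ α β, k α β - k β α = ∑ γ, c.muCoord u γ * c.str A α β γ u.proj := by
  have hLG : L * G = 1 := by
    ext α β
    rw [Matrix.mul_apply, Matrix.one_apply, hL, hG]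
    exact c.sum_gL_gU hΩ hH hu huΩ α β
  have md : ∀ {f : DualTotal m E → ℝ}, ContMDiffAt (dualModel n m) 𝓘(ℝ, ℝ) ∞ f u →
      MDifferentiableAt (dualModel n m) 𝓘(ℝ, ℝ) f u := fun hf => hf.mdifferentiableAt (by simp)
  have sU := c.contMDiffAt_gU hΩ hH hu huΩ
  have sL := c.contMDiffAt_gL hΩ hH hu huΩ
  set D' : Matrix (Fin m) (Fin m) ℝ :=
    Matrix.of fun α β => dirDeriv (dualModel n m) (c.gL H α β) u (ρ u).1.2 with hD'
  -- The identity `G L = 1` holds near `u`, so it may be differentiated along `ρ`. It yields `L D L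
  -- = -ρ(L)`, the first term of `connCoeff`.
  have h1 : G * D' + D * L = 0 := by
    ext α γ
    have m1 : ∀ β, ContMDiffAt (dualModel n m) 𝓘(ℝ, ℝ) ∞
        (fun w => c.gU H α β w * c.gL H β γ w) u := fun β => (sU α β).mul (sL β γ)
    have e1 : (fun w => ∑ β, c.gU H α β w * c.gL H β γ w) =ᶠ[𝓝 u]
        fun _ => if α = γ then 1 else 0 := by
      filter_upwards [hΩ.mem_nhds huΩ, c.isOpen_dom.mem_nhds hu] with w hw hwc
      exact c.sum_gU_gL hΩ hH hwc hw α γ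
    have e2 := dirDeriv_congr (I := dualModel n m) e1 (ρ u).1.2
    rw [dirDeriv_const, dirDeriv_sum _ fun β _ => md (m1 β)] at e2
    rw [Matrix.add_apply, Matrix.mul_apply, Matrix.mul_apply, ← Finset.sum_add_distrib,
      Matrix.zero_apply, ← e2]
    refine Finset.sum_congr rfl fun β _ => ?_
    rw [dirDeriv_mul (md (sU α β)) (md (sL β γ)), hG, hD, hL]
    rfl
  have h2 : L * D * L = -D' := by
    have h3 : D * L = -(G * D') := by
      rw [add_comm] at h1
      exact eq_neg_of_add_eq_zero_left h1
    rw [mul_assoc, h3, mul_neg, ← mul_assoc, hLG, one_mul]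
  have h4 : ∀ α β, ∑ γ, c.muCoord u γ * c.str A β α γ u.proj =
      -∑ γ, c.muCoord u γ * c.str A α β γ u.proj := fun α β => by
    simp only [c.str_skew α β, mul_neg, Finset.sum_neg_distrib]
  have h5 : ∀ α β, dirDeriv (dualModel n m) (c.gL H β α) u (ρ u).1.2 =
      dirDeriv (dualModel n m) (c.gL H α β) u (ρ u).1.2 := fun α β => by
    refine dirDeriv_congr ?_ _
    filter_upwards [hΩ.mem_nhds huΩ, c.isOpen_dom.mem_nhds hu] with w hw hwc
    exact c.gL_comm hΩ hH hwc hw β α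
  constructor
  · rw [h2]
    ext α β
    rw [Matrix.add_apply, Matrix.add_apply, Matrix.add_apply, Matrix.transpose_apply,
      Matrix.transpose_apply, Matrix.mul_apply, Matrix.mul_apply, Matrix.neg_apply, hk, hD', hL, hR]
    simp only [Matrix.of_apply, LocalFrame.connCoeff, h4 α β, h5 α β]
    ring
  · intro α β
    rw [hk]
    simp only [Matrix.of_apply, LocalFrame.connCoeff, h4 α β, h5 α β]
    ring

theorem HasConnCoeff.isNonlinearConnection {N : ∀ u, Prolong A u →ₗ[ℝ] Prolong A u}
    (hN : HasConnCoeff Ω H ρ N) : IsNonlinearConnection A Ω N where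
  smooth X hX := (smoothProlong_iff hΩ).2 fun u huΩ => by
    obtain ⟨c, hu⟩ := exists_localFrame n m E u.proj
    obtain ⟨h1, h2⟩ := (c.smoothProlongAt_iff hu).1 (hX.at hΩ huΩ)
    have hnear : ∀ᶠ w in 𝓝 u, w ∈ Ω ∧ w ∈ c.dom :=
      (show ∀ᶠ w in 𝓝 u, w ∈ Ω from hΩ.mem_nhds huΩ).and (c.isOpen_dom.mem_nhds hu)
    refine (c.smoothProlongAt_iff hu).2 ⟨fun α => ?_, fun β => ?_⟩
    · refine (h1 α).congr_of_eventuallyEq ?_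
      filter_upwards [hnear] with w hw
      exact (hN w hw.1 c hw.2).1 (X w) α
    · have h3 : ContMDiffAt (dualModel n m) 𝓘(ℝ, ℝ) ∞
          (fun w => -c.cP β (X w) + 2 * ∑ α, c.connCoeff A H ρ α β w * c.cQ α (X w)) u :=
        (h2 β).neg.add (contMDiffAt_const.mul (ContMDiffAt.sum fun α _ =>
          (c.contMDiffAt_connCoeff hΩ hH hu huΩ hρ α β).mul (h1 α)))
      refine h3.congr_of_eventuallyEq ?_
      filter_upwards [hnear] with w hw
      exact (hN w hw.1 c hw.2).2 (X w) β
  sq u huΩ := by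
    obtain ⟨c, hu⟩ := exists_localFrame n m E u.proj
    exact (hN u huΩ c hu).comp_self hu
  ker u huΩ := by
    obtain ⟨c, hu⟩ := exists_localFrame n m E u.proj
    exact (hN u huΩ c hu).ker_eq hu

theorem HasConnCoeff.isLieDerivConnection {N : ∀ u, Prolong A u →ₗ[ℝ] Prolong A u}
    (hN : HasConnCoeff Ω H ρ N) : IsLieDerivConnection A Ω H ρ N := by
  intro ν hν u huΩ
  obtain ⟨c, hu⟩ := exists_localFrame n m E u.proj
  exact (hN u huΩ c hu).eq_lieDeriv hΩ hH hρ huΩ hu (hν.at hΩ huΩ)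

theorem HasConnCoeff.hasCanonicalCoeff {N : ∀ u, Prolong A u →ₗ[ℝ] Prolong A u}
    (hN : HasConnCoeff Ω H ρ N) : HasCanonicalCoeff A Ω H N := by
  intro c u huΩ hu α
  refine ⟨c.frameQ_mem hu α, ?_⟩
  have hk := hN u huΩ c hu
  let Q : Prolong A u := ⟨c.frameQ A α u, c.frameQ_mem hu α⟩
  let P : Fin m → Prolong A u := fun β => ⟨c.frameP β u, c.frameP_mem hu β⟩
  have h1 : N u Q = Q + (2 : ℝ) • ∑ β, c.canonicalCoeff A H α β u • P β := by
    refine c.prolong_ext hu (fun β => ?_) fun β => ?_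
    · rw [hk.1 Q β, LocalFrame.cQ_add, LocalFrame.cQ_smul, LocalFrame.cQ_sum]
      simp only [LocalFrame.cQ_smul, P, c.cQ_frameP hu, mul_zero, Finset.sum_const_zero, add_zero]
    · rw [hk.2 Q β, LocalFrame.cP_add, LocalFrame.cP_smul, LocalFrame.cP_sum]
      simp only [LocalFrame.cP_smul, P, Q, c.cP_frameP hu, c.cP_frameQ hu, c.cQ_frameQ hu,
        Matrix.of_apply, mul_ite, mul_one, mul_zero, Finset.sum_ite_eq, Finset.sum_ite_eq',
        Finset.mem_univ, if_true, neg_zero, c.connCoeff_eq hΩ hH hu huΩ hρ]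
  have h2 := congrArg Subtype.val h1
  refine h2.trans ?_
  simp only [Submodule.coe_add, Submodule.coe_smul, Submodule.coe_sum, Q, P]

theorem HasConnCoeff.isSymmetricConnection {N : ∀ u, Prolong A u →ₗ[ℝ] Prolong A u}
    (hN : HasConnCoeff Ω H ρ N) : IsSymmetricConnection A Ω N := by
  intro ρ₁ ρ₂ h₁ h₂ hN₁ hN₂ u huΩ
  obtain ⟨c, hu⟩ := exists_localFrame n m E u.proj
  have hk := hN u huΩ c hu
  rw [c.symplectic_eq hu (h₁.at hΩ huΩ) (h₂.at hΩ huΩ), hk.symp_eq (hN₁ u huΩ) (hN₂ u huΩ)]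
  refine Finset.sum_eq_zero fun α _ => Finset.sum_eq_zero fun β _ => ?_
  rw [← (c.connCoeff_relations hΩ hH hρ huΩ hu rfl rfl rfl rfl rfl).2 α β]
  ring

theorem LocalFrame.gram_relations (c : LocalFrame n m M E) {u : DualTotal m E} (huΩ : u ∈ Ω)
    (hu : u ∈ c.dom) {G L : Matrix (Fin m) (Fin m) ℝ}
    (hG : G = Matrix.of fun α β => c.gU H α β u) (hL : L = Matrix.of fun α β => c.gL H α β u) :
    G * L = 1 ∧ L * G = 1 ∧ G.transpose = G := by
  refine ⟨?_, ?_, ?_⟩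
  · ext α β
    rw [Matrix.mul_apply, Matrix.one_apply, hL, hG]
    exact c.sum_gU_gL hΩ hH hu huΩ α β
  · ext α β
    rw [Matrix.mul_apply, Matrix.one_apply, hL, hG]
    exact c.sum_gL_gU hΩ hH hu huΩ α β
  · ext α β
    rw [hG]
    exact c.gU_comm hΩ hH hu huΩ β α

theorem HasConnCoeff.isMetricConnection {N : ∀ u, Prolong A u →ₗ[ℝ] Prolong A u}
    (hN : HasConnCoeff Ω H ρ N) : IsMetricConnection A Ω H ρ N := by
  intro X Y hX hY hXv hYv u huΩ
  obtain ⟨c, hu⟩ := exists_localFrame n m E u.proj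
  have hk := hN u huΩ c hu
  have h1 := (hN.isNonlinearConnection hΩ hH hρ).metric_defect hΩ hH hρ hX hXv hY hYv huΩ hu hk
    rfl rfl rfl rfl
  obtain ⟨hGL, hLG, hGt⟩ := c.gram_relations hΩ hH hρ huΩ hu rfl rfl
  have h2 := (Matrix.eq_mul_add_mul_transpose_iff hGL hLG hGt).2
    (c.connCoeff_relations hΩ hH hρ huΩ hu rfl rfl rfl rfl rfl).1
  rw [sub_eq_zero.2 h2] at h1
  simp only [Matrix.zero_apply, mul_zero, Finset.sum_const_zero] at h1
  exact sub_eq_zero.1 h1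

/-- Metricity prescribes `k' + k'ᵀ` and symmetry prescribes `k' - k'ᵀ`; the canonical coefficients
satisfy the same two relations, so the matrices coincide. -/
theorem IsNonlinearConnection.eq_of_metric_of_symmetric
    {N N' : ∀ u, Prolong A u →ₗ[ℝ] Prolong A u} (hN : HasConnCoeff Ω H ρ N)
    (hN' : IsNonlinearConnection A Ω N') (hM : IsMetricConnection A Ω H ρ N')
    (hS : IsSymmetricConnection A Ω N') {u : DualTotal m E} (huΩ : u ∈ Ω) : N' u = N u := by
  obtain ⟨c, hu⟩ := exists_localFrame n m E u.proj
  have hk := hN u huΩ c hu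
  obtain ⟨k', hk'⟩ := hN'.exists_hasMatrix huΩ c hu
  obtain ⟨hGL, hLG, hGt⟩ := c.gram_relations hΩ hH hρ huΩ hu rfl rfl
  obtain ⟨h1, h2⟩ := c.connCoeff_relations hΩ hH hρ huΩ hu rfl rfl rfl rfl rfl
  have h3 := hN'.sub_transpose_of_symmetric hΩ hS huΩ hu hk'
  have h4 := (Matrix.eq_mul_add_mul_transpose_iff (k := k')
    (D := Matrix.of fun α β => dirDeriv (dualModel n m) (c.gU H α β) u (ρ u).1.2)
    (R := Matrix.of fun ε β => c.dmu ε (c.hamP A H β) u) hGL hLG hGt).1 (by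
      rw [← sub_eq_zero]
      ext α β
      -- Vertical test sections that pass through `𝒫^α` and `𝒫^β` at `u` pick out a single entry of
      -- the matrix in `metric_defect`.
      have hsec : ∀ α : Fin m, ∃ X : ∀ u, Prolong A u, SmoothProlong A Ω X ∧
          (∀ w ∈ Ω, X w ∈ VertProlong A w) ∧ ∀ β, c.cP β (X u) = if β = α then 1 else 0 :=
        fun α => by
          obtain ⟨X, hX, hX1, hX2⟩ := c.exists_section (A := A) hu 0 (Pi.single α 1)
          refine ⟨X, (smoothProlong_iff hΩ).2 fun w _ => hX w, fun w _ => hX2 rfl w, fun β => ?_⟩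
          rw [← Pi.single_apply]
          exact (hX1.self_of_nhds β).2
      obtain ⟨X, hX, hXv, hXP⟩ := hsec α
      obtain ⟨Y, hY, hYv, hYP⟩ := hsec β
      have h5 := hN'.metric_defect hΩ hH hρ hX hXv hY hYv huΩ hu hk' rfl rfl rfl rfl
      rw [sub_eq_zero.2 (hM X Y hX hY hXv hYv u huΩ)] at h5
      simp only [hXP, hYP, mul_ite, mul_one, mul_zero, ite_mul, one_mul, zero_mul,
        Finset.sum_ite_eq', Finset.mem_univ, if_true] at h5
      exact h5.symm)
  have h6 : k' = Matrix.of fun α β => c.connCoeff A H ρ α β u := by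
    rw [← h1] at h4
    ext α β
    have e1 := congrFun (congrFun h4 α) β
    rw [Matrix.add_apply, Matrix.add_apply, Matrix.transpose_apply, Matrix.transpose_apply] at e1
    have e2 := (h3 α β).trans (h2 α β).symm
    linarith
  rw [h6] at hk'
  exact hk'.eq hu hk

end CanonicalConnection

end

/-- The canonical nonlinear connection induced by a regular Hamiltonian exists and is the unique
nonlinear connection on `𝒯E*` that is metric and symmetric. (`Ω` is an arbitrary open subset of
`E*`, for instance `E*` itself or `E*` without its zero section.) -/
theorem theorem1p6p3 {n m : ℕ} {M : Type*} [TopologicalSpace M] [T2Space M]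
    [SecondCountableTopology M] [ChartedSpace (Eu n) M] [IsManifold (𝓡 n) ∞ M]
    {E : M → Type*} [TopologicalSpace (TotalSpace (Eu m) E)]
    [∀ x, AddCommGroup (E x)] [∀ x, Module ℝ (E x)] [∀ x, TopologicalSpace (E x)]
    [FiberBundle (Eu m) E] [VectorBundle ℝ (Eu m) E] [ContMDiffVectorBundle ∞ (Eu m) E (𝓡 n)]
    (A : LieAlgebroid n m M E) (Ω : Set (DualTotal m E)) (hΩ : IsOpen Ω)
    (H : DualTotal m E → ℝ) (hH : IsRegularHamiltonian n Ω H) :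
    ∃ ρ : ∀ u, Prolong A u, IsHamiltonSection A Ω H ρ ∧
      (∀ ρ' : ∀ u, Prolong A u, IsHamiltonSection A Ω H ρ' → ∀ u ∈ Ω, ρ' u = ρ u) ∧
      ∃ N : ∀ u, Prolong A u →ₗ[ℝ] Prolong A u,
        IsNonlinearConnection A Ω N ∧ IsCanonicalConnection A Ω H ρ N ∧
        IsMetricConnection A Ω H ρ N ∧ IsSymmetricConnection A Ω N ∧
        ∀ N' : ∀ u, Prolong A u →ₗ[ℝ] Prolong A u, IsNonlinearConnection A Ω N' →
          IsMetricConnection A Ω H ρ N' → IsSymmetricConnection A Ω N' →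
            ∀ u ∈ Ω, N' u = N u := by
  obtain ⟨ρ, hρ⟩ := exists_hasHamiltonCoords A hΩ hH.smooth
  obtain ⟨N, hN⟩ := exists_hasConnCoeff hΩ hH hρ
  exact ⟨ρ, hρ.isHamiltonSection hΩ hH.smooth,
    fun ρ' hρ' u hu => hρ.eq_of_isHamiltonSection hΩ hH.smooth hρ' hu,
    N, hN.isNonlinearConnection hΩ hH hρ,
    ⟨hN.isLieDerivConnection hΩ hH hρ, hN.hasCanonicalCoeff hΩ hH hρ⟩,
    hN.isMetricConnection hΩ hH hρ, hN.isSymmetricConnection hΩ hH hρ,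
    fun N' hN' hM hS u hu => hN'.eq_of_metric_of_symmetric hΩ hH hρ hN hM hS hu⟩
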